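/- Let $\mathbf S^2=\{x\in\mathbf R^3:|x|=1\}$ with surface measure $\lambda$ (total mass $4\pi$), and let $Y_{lm}$ ($l\ge 0$, $|m|\le l$) be the standard complex orthonormal spherical harmonics, $\Delta_{\mathbf S^2}Y_{lm}=-\mu_lY_{lm}$ with $\mu_l=l(l+1)$. On one probability space let the following be given. (i) $T=\{T(x):x\in\mathbf S^2\}$ is a real, jointly measurable, zero-mean Gaussian random field which is isotropic, i.e. $\{T(gx)\}_{x}$ and $\{T(x)\}_{x}$ have the same law for every $g\in SO(3)$. Put $a_{lm}=\int_{\mathbf S^2}T(x)\overline{Y_{lm}(x)}\,\lambda(dx)$; the angular power spectrum of $T$ is $C_l=\mathbb E|a_{lm}|^2$ (which does not depend on $m$). (ii) For every $y\in\mathbf S^2$, $B^y=(B^y_s)_{s\ge 0}$ is the rotational Brownian motion on $\mathbf S^2$ with continuous paths, started at $y$, whose generator is $\Delta_{\mathbf S^2}$ (without the factor $\tfrac12$), and $D^y=(D^y_t)_{t\ge0}$ is a subordinator with Laplace exponent $\Psi(\mu)=b\mu+\int_0^\infty(1-e^{-\mu s})M(ds)$, i.e. $\mathbb E e^{-\mu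 D^y_t}=e^{-t\Psi(\mu)}$ for $\mu \ge 0$, where $b\ge0$ and $M$ is a measure on $(0,\infty)$ with $\int_0^\infty (s\wedge 1)M(ds)<\infty$. For every $y$, $B^y$ and $D^y$ are independent, and there is a $\sigma$-algebra $\mathfrak F_T$, independent of $(B^y,D^y)$ for every $y$, with respect to which (together with the Borel sets of $\mathbf S^2$) $T$ is jointly measurable. Define the coordinates changed random field $\mathfrak T^\Psi_t(y)=T\big(B^y_{D^y_t}\big)$, $t\ge 0$, $y\in\mathbf S^2$. Theorem 2 (Time covariance). For all $x\in\mathbf S^2$, all $g\in SO(3)$ and all $0\le t_1\le t_2<\infty$, the product $\mathfrak T^\Psi_{t_1}(gx)\,\mathfrak T^\Psi_{t_2}(gx)$ is integrable and $$\mathbb E\big[\mathfrak T^\Psi_{t_1}(gx)\,\mathfrak T^\Psi_{t_2}(gx)\big]=\sum_{l=0}^\infty\frac{2l+1}{4\pi}\,C_l\,e^{-(t_2-t_1)\Psi(\mu_l)},$$ where the series converges. For $t_1<\infty$ and $t_2=\infty$ the formula holds in the limit: as $t_2\to\infty$ the left-hand side converges to $\sum_{l=0}^\infty\frac{2l+1}{4\pi}\,C_l\,p_l$,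 where $p_l=\lim_{t\to\infty}e^{-t\Psi(\mu_l)}$, i.e. $p_l=1$ if $\Psi(\mu_l)=0$ and $p_l=0$ otherwise. -/

import Mathlib

open MeasureTheory ProbabilityTheory Filter Topology
open scoped NNReal

noncomputable section

namespace SphereField

/-- Three-dimensional Euclidean space. -/
abbrev E3 : Type := EuclideanSpace ℝ (Fin 3)

/-- The unit sphere `{x ∈ ℝ³ : |x| = 1}`. -/
abbrev S2 : Type := Metric.sphere (0 : E3) 1

/-- The surface (Lebesgue) measure on the unit sphere, of total mass `4π`. -/
def surfaceMeasure : Measure S2 := (volume : Measure E3).toSphere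

/-! ### Rotations -/

/-- The rotation group `SO(3)`. -/
abbrev SO3 : Type := Matrix.specialOrthogonalGroup (Fin 3) ℝ

theorem norm_rotate (g : SO3) (x : E3) :
    ‖(WithLp.toLp 2 (Matrix.mulVec g.1 x.ofLp) : E3)‖ = ‖x‖ := by
  have hg : Matrix.transpose g.1 * g.1 = 1 := by
    have h := (Matrix.mem_specialOrthogonalGroup_iff.1 g.2).1
    exact (Matrix.mem_orthogonalGroup_iff' (Fin 3) ℝ).1 h
  have key : Matrix.mulVec g.1 x.ofLp ⬝ᵥ Matrix.mulVec g.1 x.ofLp = x.ofLp ⬝ᵥ x.ofLp := by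
    rw [Matrix.dotProduct_mulVec, ← Matrix.mulVec_transpose, Matrix.mulVec_mulVec, hg,
      Matrix.one_mulVec]
  have h2 : ∀ v : E3, ‖v‖ ^ 2 = v.ofLp ⬝ᵥ v.ofLp := by
    intro v
    rw [EuclideanSpace.norm_sq_eq]
    simp [dotProduct, sq]
  rw [← sq_eq_sq₀ (norm_nonneg _) (norm_nonneg _), h2, h2]
  exact key

/-- The point `g x` of the sphere, for a rotation `g`. -/
def rotate (g : SO3) (x : S2) : S2 :=
  ⟨WithLp.toLp 2 (Matrix.mulVec g.1 x.1.ofLp), by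
    rw [mem_sphere_zero_iff_norm, norm_rotate]
    exact mem_sphere_zero_iff_norm.1 x.2⟩

/-! ### Spherical harmonics -/

/-- The Legendre polynomial of degree `l`, by the formula of Rodrigues. -/
def legendre (l : ℕ) : Polynomial ℝ :=
  Polynomial.C (1 / (2 ^ l * (l.factorial : ℝ))) *
    Polynomial.derivative^[l] ((Polynomial.X ^ 2 - 1) ^ l)

/-- The spherical harmonic of degree `l` and order `m ≥ 0`,
`√((2l+1)/(4π) · (l-m)!/(l+m)!) · (-1)^m (1 - z²)^{m/2} Q_l^{(m)}(z) · e^{imφ}` at `z = cos ϑ`.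
In Cartesian coordinates `cos ϑ = x₂` and `(1 - z²)^{m/2} e^{imφ} = (x₀ + i x₁)^m`. -/
def sphericalHarmonicNonneg (l m : ℕ) (x : S2) : ℂ :=
  (Real.sqrt ((2 * l + 1) / (4 * Real.pi) * ((l - m).factorial / (l + m).factorial)) : ℂ) *
    ((-1) ^ m * ((x.1 0 : ℂ) + Complex.I * (x.1 1 : ℂ)) ^ m *
      ((Polynomial.derivative^[m] (legendre l)).eval (x.1 2) : ℝ))

/-- The spherical harmonic `Y_{lm}`, `|m| ≤ l`, with `Y_{l,-m} = (-1)^m Y_{lm}^*`. -/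
def sphericalHarmonic (l : ℕ) (m : ℤ) (x : S2) : ℂ :=
  if 0 ≤ m then sphericalHarmonicNonneg l m.natAbs x
  else (-1) ^ m.natAbs * (starRingEnd ℂ) (sphericalHarmonicNonneg l m.natAbs x)

/-! ### Isotropic Gaussian random fields on the sphere -/

/-- `T` is a zero-mean, isotropic (with rotationally invariant law), jointly measurable Gaussian
random field on the sphere, whose randomness is carried by the σ-algebra `𝓕T`. -/
structure IsIsotropicGaussianField {Ω : Type*} (𝓕T : MeasurableSpace Ω) [mΩ : MeasurableSpace Ω]
    (P : Measure Ω) (T : S2 → Ω → ℝ) : Prop where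
  le : 𝓕T ≤ mΩ
  measurable : @Measurable (S2 × Ω) ℝ (MeasurableSpace.prod inferInstance 𝓕T) inferInstance
    (fun p => T p.1 p.2)
  gaussian : IsGaussianProcess T P
  mean_zero : ∀ x, ∫ ω, T x ω ∂P = 0
  isotropic : ∀ g : SO3,
    IdentDistrib (fun ω (x : S2) => T (rotate g x) ω) (fun ω (x : S2) => T x ω) P P

/-- The random Fourier coefficient `a_{lm} = ∫ T(x) Y_{lm}^*(x) λ(dx)`. -/
def fourierCoeff {Ω : Type*} (T : S2 → Ω → ℝ) (l : ℕ) (m : ℤ) (ω : Ω) : ℂ :=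
  ∫ x, (T x ω : ℂ) * (starRingEnd ℂ) (sphericalHarmonic l m x) ∂surfaceMeasure

/-- `C` is the angular power spectrum of `T`: `C_l = 𝔼|a_{lm}|²`. For an isotropic field the
right-hand side is the same for all `|m| ≤ l`; this is not assumed here: whichever order `m` is
used to compute `C_l`, in each degree, is allowed. -/
def IsAngularPowerSpectrum {Ω : Type*} [MeasurableSpace Ω] (P : Measure Ω)
    (T : S2 → Ω → ℝ) (C : ℕ → ℝ) : Prop :=
  ∀ l : ℕ, ∃ m : ℤ, |m| ≤ (l : ℤ) ∧ C l = ∫ ω, ‖fourierCoeff T l m ω‖ ^ 2 ∂P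

/-! ### Rotational Brownian motion -/

/-- The spherical Laplace operator applied to (the restriction to the sphere of) `f`: the Euclidean
Laplacian of the extension `y ↦ f (y / |y|)` that is constant along rays. -/
def sphericalLaplacian (f : E3 → ℝ) (x : S2) : ℝ :=
  Laplacian.laplacian (fun y : E3 => f (‖y‖⁻¹ • y)) x.1

/-- `B` is a rotational Brownian motion on the sphere started at `x`: a process with continuous
paths that solves the martingale problem for the spherical Laplace operator (no factor `1/2`, so
that its transition function solves `∂_t u = Δ u`). The smooth functions on the sphere are the
restrictions of the smooth functions on `ℝ³`. -/
structure IsSphericalBrownianMotion {Ω : Type*} [MeasurableSpace Ω] (P : Measure Ω)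
    (B : ℝ≥0 → Ω → S2) (x : S2) : Prop where
  measurable : ∀ t, Measurable (B t)
  continuous_paths : ∀ ω, Continuous fun t => B t ω
  start : ∀ᵐ ω ∂P, B 0 ω = x
  martingale : ∀ f : E3 → ℝ, ContDiff ℝ (⊤ : ℕ∞) f →
    Martingale
      (fun (t : ℝ≥0) ω =>
        f (B t ω).1 - ∫ s in (0 : ℝ)..t, sphericalLaplacian f (B s.toNNReal ω))
      (Filtration.natural B fun t => (measurable t).stronglyMeasurable) P

/-! ### Subordinators -/

/-- `M` is the Lévy measure of a subordinator: a measure on `(0, ∞)` with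
`∫ (y ∧ 1) M(dy) < ∞`. -/
structure IsSubordinatorLevyMeasure (M : Measure ℝ) : Prop where
  support : M (Set.Iic 0) = 0
  integrable : ∫⁻ y, ENNReal.ofReal (min y 1) ∂M < ⊤

/-- The Laplace exponent `Ψ(μ) = bμ + ∫ (1 - e^{-μy}) M(dy)`. -/
def laplaceExponent (b : ℝ) (M : Measure ℝ) (μ : ℝ) : ℝ :=
  b * μ + ∫ y, (1 - Real.exp (-μ * y)) ∂M

/-- `D` is a subordinator (a Lévy process with non-decreasing paths) with drift `b` and Lévy
measure `M`, that is, with `𝔼 exp(-μ D_t) = exp(-t Ψ(μ))`. -/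
structure IsSubordinator {Ω : Type*} [MeasurableSpace Ω] (P : Measure Ω)
    (D : ℝ≥0 → Ω → ℝ≥0) (b : ℝ) (M : Measure ℝ) : Prop where
  measurable : ∀ t, Measurable (D t)
  start : ∀ᵐ ω ∂P, D 0 ω = 0
  monotone_paths : ∀ ω, Monotone fun t => D t ω
  right_continuous_paths : ∀ ω t, ContinuousWithinAt (fun s => D s ω) (Set.Ici t) t
  indep_increments : HasIndepIncrements (fun t ω => (D t ω : ℝ)) P
  stationary_increments : ∀ s h : ℝ≥0,
    IdentDistrib (fun ω => (D (s + h) ω : ℝ) - D s ω) (fun ω => (D h ω : ℝ)) P P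
  laplace_transform : ∀ (t : ℝ≥0) (μ : ℝ), 0 ≤ μ →
    ∫ ω, Real.exp (-μ * D t ω) ∂P = Real.exp (-(t : ℝ) * laplaceExponent b M μ)

/-! ### The coordinates changed random field -/

/-- The coordinates changed random field: `T` observed along the Brownian motion `B x` started at
`x`, run with the clock `D x`; that is, `𝔗_t(x) = T(B_{D_t})` with `B_0 = x`. -/
def coordField {Ω : Type*} (T : S2 → Ω → ℝ) (B : S2 → ℝ≥0 → Ω → S2)
    (D : S2 → ℝ≥0 → Ω → ℝ≥0) (t : ℝ≥0) (x : S2) (ω : Ω) : ℝ :=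
  T (B x (D x t ω) ω) ω

end SphereField

end

open SphereField

noncomputable section

namespace SphereField

/-! Let `U` and `V` be the positions of the time-changed Brownian motion at times `t₁ ≤ t₂`. The
field is independent of the pair `(U, V)`, so freezing the endpoints gives `E[T(U) T(V)] = E κ(⟨U,
V⟩)`. Here `κ` (`covFn`) is the covariance as a function of the inner product; this makes sense
because any two pairs of points with the same inner product differ by a rotation. Two facts then
yield the formula: the expansion `κ(⟨x, y⟩) = ∑ (2l+1)/(4π) C_l P_l(⟨x, y⟩)`, dominated by the
summable sequence `(2l+1)/(4π) C_l`, and the identity `E P_l(⟨U, V⟩) = exp(-(t₂ - t₁) Ψ(l(l+1)))`.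

Expansion. The Funk-Hecke formula makes every spherical harmonic of degree `l` an eigenfunction of
the covariance operator, with an eigenvalue depending only on `l`; that eigenvalue is `C_l`
(`integral_norm_fourierCoeff_sq`). The delicate point is that the sum equals `κ` everywhere,
although `κ` is a priori only bounded and measurable. Bessel's inequality gives `∑ (2l+1)/(4π) C_l ≤
κ(1)`. For the converse, almost every sample path is in `L²` of the sphere, so its mean square
oscillation at small scales tends to zero. Taking expectations shows that averages of `κ` against an
approximate identity tend to `κ(1)` (`tendsto_integral_covFn_mul_bump`), and these averages are
bounded by the series because `C_l ≥ 0` and `P_l ≤ 1`. Equality at `1` means that the multipole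
expansion converges in mean square, and Cauchy-Schwarz carries this to all pairs of points
(`hasSum_covFn_inner`).

Motion. The function `P_l(⟨w, ·⟩)` is an eigenfunction of the spherical Laplacian, so the martingale
problem gives a linear integral equation for its correlation between two times, hence exponential
decay. Averaging over `w` with the reproducing property leaves `E P_l(⟨B_s, B_t⟩) = exp(-l(l+1)(t -
s))`, whatever the law of `B_s` (`integral_legendre_inner`). Conditioning on the independent clock
and using its stationary increments replaces `l(l+1)` by `Ψ(l(l+1))`. The limit `t₂ → ∞` is
dominated convergence, since each exponential is at most one. -/

/-! ### Legendre polynomials: differential equation, endpoint values, span -/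

open Polynomial in
-- The power `f = (X ^ 2 - 1) ^ l` satisfies `(X ^ 2 - 1) f' = 2 l X f`; this is that equation
-- differentiated `n + 1` times, by induction instead of the Leibniz rule. At `n = l` the terms
-- collect into Legendre's equation for the `l`-th derivative of `f`.
theorem iterate_derivative_sq_sub_one_pow (l n : ℕ) :
    ((X : ℝ[X]) ^ 2 - 1) * derivative^[n + 2] ((X ^ 2 - 1) ^ l) +
        2 * ((n : ℝ[X]) + 1) * X * derivative^[n + 1] ((X ^ 2 - 1) ^ l) +
        ((n : ℝ[X]) + 1) * (n : ℝ[X]) * derivative^[n] ((X ^ 2 - 1) ^ l) =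
      2 * (l : ℝ[X]) * (X * derivative^[n + 1] ((X ^ 2 - 1) ^ l) +
        ((n : ℝ[X]) + 1) * derivative^[n] ((X ^ 2 - 1) ^ l)) := by
  induction n with
  | zero =>
    have h0 : ((X : ℝ[X]) ^ 2 - 1) * derivative ((X ^ 2 - 1) ^ l) =
        2 * (l : ℝ[X]) * X * (X ^ 2 - 1) ^ l := by
      rcases l with _ | l
      · simp
      · rw [derivative_pow_succ]
        simp only [derivative_sub, derivative_X_pow, derivative_one]
        simp only [Nat.cast_add, Nat.cast_one, map_add, map_one, map_natCast]
        push_cast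
        ring
    have h1 := congrArg derivative h0
    simp only [derivative_mul, derivative_sub, derivative_X_pow, derivative_one, derivative_X,
      derivative_natCast, derivative_ofNat] at h1
    simp only [Function.iterate_succ_apply', Function.iterate_zero_apply]
    simp only [map_ofNat, Nat.cast_ofNat] at h1
    push_cast at h1 ⊢
    linear_combination h1
  | succ n ih =>
    have h1 := congrArg derivative ih
    simp only [derivative_mul, derivative_add, derivative_sub, derivative_X_pow, derivative_one,
      derivative_X, derivative_natCast, derivative_ofNat,
      ← Function.iterate_succ_apply' derivative] at h1
    simp only [map_ofNat, Nat.cast_ofNat] at h1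
    push_cast at h1 ⊢
    linear_combination h1

open Polynomial in
/-- The differential equation of Legendre. -/
theorem legendre_ode (l : ℕ) :
    (1 - (X : ℝ[X]) ^ 2) * derivative (derivative (legendre l)) - 2 * X * derivative (legendre l) =
      -((l : ℝ[X]) * ((l : ℝ[X]) + 1)) * legendre l := by
  have h := iterate_derivative_sq_sub_one_pow l l
  simp only [legendre, derivative_C_mul]
  simp only [Function.iterate_succ_apply'] at h
  linear_combination (-(C (1 / (2 ^ l * (l.factorial : ℝ))))) * h

open Polynomial in
-- Legendre's equation differentiated `m` times: the equation of the factor of `Y_{lm}` that depends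
-- on the height only.
theorem iterate_derivative_legendre_ode (l m : ℕ) :
    (1 - (X : ℝ[X]) ^ 2) * derivative (derivative (derivative^[m] (legendre l))) -
        2 * ((m : ℝ[X]) + 1) * X * derivative (derivative^[m] (legendre l)) =
      ((m : ℝ[X]) * ((m : ℝ[X]) + 1) - (l : ℝ[X]) * ((l : ℝ[X]) + 1)) *
        derivative^[m] (legendre l) := by
  induction m with
  | zero =>
    have := legendre_ode l
    simp only [Function.iterate_zero_apply]
    push_cast
    linear_combination this
  | succ n ih =>
    have h1 := congrArg derivative ih
    simp only [derivative_mul, derivative_add, derivative_sub, derivative_X_pow, derivative_one,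
      derivative_X, derivative_natCast, derivative_ofNat] at h1
    simp only [map_ofNat, Nat.cast_ofNat] at h1
    simp only [Function.iterate_succ_apply']
    push_cast at h1 ⊢
    linear_combination h1

open Polynomial in
-- The `l`-th derivative at `a` is `l!` times the `l`-th Taylor coefficient, and the factor `(X - C
-- a) ^ l` shifts the constant coefficient of `q` into that place. With Rodrigues' formula it gives
-- the values of `P_l` at `1` and `-1`.
theorem eval_iterate_derivative_X_sub_C_pow_mul (a : ℝ) (l : ℕ) (q : ℝ[X]) :
    (derivative^[l] ((X - C a) ^ l * q)).eval a = l.factorial * q.eval a := by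
  have h1 : derivative^[l] ((X - C a) ^ l * q) =
      l.factorial • hasseDeriv l ((X - C a) ^ l * q) := by
    rw [← factorial_smul_hasseDeriv]; rfl
  rw [h1, eval_smul, nsmul_eq_mul, ← taylor_coeff]
  have h : taylor a ((X - C a) ^ l * q) = X ^ l * taylor a q := by
    rw [taylor_mul]
    congr 1
    rw [taylor_pow]
    simp
  have h2 : (X ^ l * taylor a q).coeff l = (taylor a q).coeff 0 := by
    simpa using coeff_X_pow_mul (taylor a q) l 0
  rw [h, h2, taylor_coeff_zero]

open Polynomial in
theorem legendre_eval_one (l : ℕ) : (legendre l).eval 1 = 1 := by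
  have h : ((X : ℝ[X]) ^ 2 - 1) ^ l = (X - C 1) ^ l * (X + 1) ^ l := by
    rw [← mul_pow]; simp; ring
  rw [legendre, eval_mul, h, eval_iterate_derivative_X_sub_C_pow_mul]
  simp only [eval_C, eval_pow, eval_add, eval_X, eval_one]
  have : (l.factorial : ℝ) ≠ 0 := by positivity
  field_simp
  norm_num

open Polynomial in
theorem legendre_eval_neg_one_sq (l : ℕ) : (legendre l).eval (-1) ^ 2 = 1 := by
  have h : ((X : ℝ[X]) ^ 2 - 1) ^ l = (X - C (-1)) ^ l * (X - 1) ^ l := by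
    rw [← mul_pow]; simp; ring
  rw [legendre, eval_mul, h, eval_iterate_derivative_X_sub_C_pow_mul]
  simp only [eval_C, eval_pow, eval_sub, eval_X, eval_one]
  have : (l.factorial : ℝ) ≠ 0 := by positivity
  field_simp
  rw [← pow_mul, ← pow_mul, mul_comm l 2, pow_mul, pow_mul]
  norm_num

open Polynomial in
theorem monic_X_sq_sub_one : ((X : ℝ[X]) ^ 2 - 1).Monic := by
  simpa using monic_X_pow_sub_C (1 : ℝ) two_ne_zero

open Polynomial in
theorem natDegree_X_sq_sub_one_pow (l : ℕ) : (((X : ℝ[X]) ^ 2 - 1) ^ l).natDegree = 2 * l := by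
  rw [monic_X_sq_sub_one.natDegree_pow]
  have : ((X : ℝ[X]) ^ 2 - 1).natDegree = 2 := by
    simpa using natDegree_X_pow_sub_C (n := 2) (r := (1 : ℝ))
  rw [this, mul_comm]

open Polynomial in
theorem natDegree_legendre_le (l : ℕ) : (legendre l).natDegree ≤ l := by
  refine (natDegree_C_mul_le _ _).trans ?_
  refine (natDegree_iterate_derivative _ _).trans ?_
  rw [natDegree_X_sq_sub_one_pow]
  omega

open Polynomial in
theorem coeff_legendre_ne_zero (l : ℕ) : (legendre l).coeff l ≠ 0 := by
  rw [legendre, coeff_C_mul, coeff_iterate_derivative]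
  have h : (((X : ℝ[X]) ^ 2 - 1) ^ l).coeff (l + l) = 1 := by
    rw [← two_mul, ← natDegree_X_sq_sub_one_pow l]
    exact (monic_X_sq_sub_one.pow l).coeff_natDegree
  rw [h, nsmul_eq_mul, mul_one]
  have : ((l + l).descFactorial l : ℝ) ≠ 0 := by
    rw [Nat.cast_ne_zero, Ne, Nat.descFactorial_eq_zero_iff_lt]
    omega
  positivity

/-- The Legendre polynomials, as a sequence of polynomials with one in each degree. -/
def legendreSequence : Polynomial.Sequence ℝ where
  elems' := legendre
  degree_eq' l := Polynomial.degree_eq_of_le_of_coeff_ne_zero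
    (Polynomial.degree_le_of_natDegree_le (natDegree_legendre_le l)) (coeff_legendre_ne_zero l)

theorem span_legendre : Submodule.span ℝ (Set.range legendre) = ⊤ :=
  legendreSequence.span fun i => by
    rw [isUnit_iff_ne_zero, Polynomial.leadingCoeff_ne_zero]
    exact legendreSequence.ne_zero i

theorem span_legendre_degreeLT (n : ℕ) :
    Submodule.span ℝ (legendre '' Set.Iio n) = Polynomial.degreeLT ℝ n :=
  legendreSequence.span_degreeLT fun i _ => by
    rw [isUnit_iff_ne_zero, Polynomial.leadingCoeff_ne_zero]
    exact legendreSequence.ne_zero i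

/-! ### The surface measure: total mass and integrability -/

instance : IsFiniteMeasure surfaceMeasure := by
  unfold surfaceMeasure; infer_instance

theorem surfaceMeasure_real_univ : surfaceMeasure.real Set.univ = 4 * Real.pi := by
  rw [surfaceMeasure, Measure.toSphere_real_apply_univ, measureReal_def,
    EuclideanSpace.volume_ball_fin_three]
  rw [ENNReal.toReal_mul, ENNReal.toReal_pow, ENNReal.toReal_ofReal zero_le_one,
    ENNReal.toReal_ofReal (by positivity)]
  simp
  ring

theorem integrable_of_continuous {E : Type*} [NormedAddCommGroup E] {f : S2 → E}
    (hf : Continuous f) : Integrable f surfaceMeasure :=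
  hf.integrable_of_hasCompactSupport (HasCompactSupport.of_compactSpace f)

/-! ### Invariance of the surface measure -/

/-- The homeomorphism of the sphere induced by a linear isometry of the ambient space. -/
def sphereHomeo (L : E3 ≃ₗᵢ[ℝ] E3) : S2 ≃ₜ S2 where
  toFun x := ⟨L x.1, by simp⟩
  invFun x := ⟨L.symm x.1, by simp⟩
  left_inv x := by simp
  right_inv x := by simp
  continuous_toFun := by fun_prop
  continuous_invFun := by fun_prop

open scoped Pointwise in
-- The measure of a set on the sphere is, up to a constant, the volume of the cone over it. A linear
-- isometry preserves volume and commutes with the formation of cones.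
theorem measurePreserving_sphereHomeo (L : E3 ≃ₗᵢ[ℝ] E3) :
    MeasurePreserving (sphereHomeo L) surfaceMeasure surfaceMeasure := by
  refine ⟨(sphereHomeo L).continuous.measurable, ?_⟩
  ext s hs
  rw [Measure.map_apply (sphereHomeo L).continuous.measurable hs, surfaceMeasure,
    Measure.toSphere_apply' _ hs,
    Measure.toSphere_apply' _ ((sphereHomeo L).continuous.measurable hs)]
  congr 1
  rw [← L.measurePreserving.measure_preimage_emb L.toHomeomorph.measurableEmbedding
    (Set.Ioo (0 : ℝ) 1 • (Subtype.val '' s))]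
  congr 1
  ext v
  simp only [Set.mem_smul, Set.mem_image, Set.mem_preimage, exists_exists_and_eq_and]
  constructor
  · rintro ⟨r, hr, y, hy, rfl⟩
    exact ⟨r, hr, _, hy, by simp [sphereHomeo]⟩
  · rintro ⟨r, hr, y, hy, hv⟩
    refine ⟨r, hr, (sphereHomeo L).symm y, by simpa using hy, L.injective ?_⟩
    rw [← hv, map_smul]
    simp [sphereHomeo]

theorem integral_comp_sphereHomeo {E : Type*} [NormedAddCommGroup E] [NormedSpace ℝ E]
    (L : E3 ≃ₗᵢ[ℝ] E3) (f : S2 → E) :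
    ∫ x, f (sphereHomeo L x) ∂surfaceMeasure = ∫ x, f x ∂surfaceMeasure :=
  (measurePreserving_sphereHomeo L).integral_comp (sphereHomeo L).measurableEmbedding f

/-- The linear isometry given by a rotation. -/
def rotateLI (g : SO3) : E3 ≃ₗᵢ[ℝ] E3 :=
  LinearIsometry.toLinearIsometryEquiv
    { toFun := fun x => WithLp.toLp 2 (Matrix.mulVec g.1 x.ofLp)
      map_add' := fun x y => by simp [Matrix.mulVec_add]
      map_smul' := fun c x => by simp [Matrix.mulVec_smul]
      norm_map' := fun x => norm_rotate g x } rfl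

theorem sphereHomeo_rotateLI (g : SO3) (x : S2) : sphereHomeo (rotateLI g) x = rotate g x := rfl

theorem inner_rotate (g : SO3) (x y : S2) :
    inner ℝ (rotate g x).1 (rotate g y).1 = inner ℝ x.1 y.1 :=
  (rotateLI g).inner_map_map x.1 y.1

/-! ### Coordinates and two-point homogeneity of the sphere -/

theorem inner_E3 (x y : E3) : inner ℝ x y = x 0 * y 0 + x 1 * y 1 + x 2 * y 2 := by
  simp [PiLp.inner_apply, Fin.sum_univ_three]
  ring

theorem sum_sq_S2 (x : S2) : x.1 0 ^ 2 + x.1 1 ^ 2 + x.1 2 ^ 2 = 1 := by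
  have h := mem_sphere_zero_iff_norm.1 x.2
  rw [EuclideanSpace.norm_eq, Real.sqrt_eq_one] at h
  simpa [Fin.sum_univ_three] using h

theorem inner_self_S2 (x : S2) : inner ℝ x.1 x.1 = (1 : ℝ) := by
  rw [inner_E3]; linear_combination sum_sq_S2 x

theorem inner_mem_Icc (x y : S2) : inner ℝ x.1 y.1 ∈ Set.Icc (-1 : ℝ) 1 := by
  have h := abs_real_inner_le_norm x.1 y.1
  rw [mem_sphere_zero_iff_norm.1 x.2, mem_sphere_zero_iff_norm.1 y.2, mul_one] at h
  exact abs_le.1 h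

theorem continuous_inner_S2 (x : S2) : Continuous fun y : S2 => inner ℝ x.1 y.1 := by fun_prop

theorem continuous_inner_S2_prod : Continuous fun p : S2 × S2 => inner ℝ p.1.1 p.2.1 := by
  fun_prop

/-- The north pole. -/
def pole : S2 := ⟨!₂[0, 0, 1], by
  rw [mem_sphere_zero_iff_norm, EuclideanSpace.norm_eq]; simp [Fin.sum_univ_three]⟩

theorem inner_pole (y : S2) : inner ℝ pole.1 y.1 = y.1 2 := by
  rw [inner_E3]; simp [pole]

/-- The point of height `t` on the meridian through the first coordinate vector. -/
def meridian (t : Set.Icc (-1 : ℝ) 1) : S2 := ⟨!₂[Real.sqrt (1 - t.1 ^ 2), 0, t.1], by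
  rw [mem_sphere_zero_iff_norm, EuclideanSpace.norm_eq, Real.sqrt_eq_one]
  have : 0 ≤ 1 - t.1 ^ 2 := by nlinarith [t.2.1, t.2.2]
  simp [Fin.sum_univ_three, Real.sq_sqrt this]⟩

theorem exists_unit_orthogonal (x : S2) : ∃ a : S2, inner ℝ x.1 a.1 = (0 : ℝ) := by
  have hx := sum_sq_S2 x
  by_cases h : x.1 0 ^ 2 + x.1 1 ^ 2 = 0
  · have h0 : x.1 0 = 0 := by nlinarith [sq_nonneg (x.1 0), sq_nonneg (x.1 1)]
    refine ⟨⟨!₂[1, 0, 0], ?_⟩, ?_⟩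
    · rw [mem_sphere_zero_iff_norm, EuclideanSpace.norm_eq]; simp [Fin.sum_univ_three]
    · rw [inner_E3]; simp [h0]
  · set r := Real.sqrt (x.1 0 ^ 2 + x.1 1 ^ 2) with hr
    have hr2 : r ^ 2 = x.1 0 ^ 2 + x.1 1 ^ 2 := Real.sq_sqrt (by positivity)
    have hr0 : r ≠ 0 := fun h0 => h (by rw [← hr2, h0]; simp)
    refine ⟨⟨!₂[-x.1 1 / r, x.1 0 / r, 0], ?_⟩, ?_⟩
    · rw [mem_sphere_zero_iff_norm, EuclideanSpace.norm_eq, Real.sqrt_eq_one]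
      simp only [Fin.sum_univ_three, Real.norm_eq_abs, sq_abs]
      simp
      field_simp
      linarith
    · rw [inner_E3]; simp; ring

theorem exists_orthogonal_decomposition (x y : S2) : ∃ a : S2, inner ℝ x.1 a.1 = (0 : ℝ) ∧
    ∀ i, y.1 i = inner ℝ x.1 y.1 * x.1 i + Real.sqrt (1 - inner ℝ x.1 y.1 ^ 2) * a.1 i := by
  set t : ℝ := inner ℝ x.1 y.1 with ht
  have hx := sum_sq_S2 x
  have hy := sum_sq_S2 y
  have htt : x.1 0 * y.1 0 + x.1 1 * y.1 1 + x.1 2 * y.1 2 = t := by rw [ht, inner_E3]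
  have hsum : (y.1 0 - t * x.1 0) ^ 2 + (y.1 1 - t * x.1 1) ^ 2 + (y.1 2 - t * x.1 2) ^ 2 =
      1 - t ^ 2 := by
    linear_combination hy + t ^ 2 * hx - 2 * t * htt
  -- If `t ^ 2 = 1`, then `y = ± x` has no component orthogonal to `x`, and any unit vector
  -- orthogonal to `x` serves. Otherwise the orthogonal component is normalized.
  by_cases h : 1 - t ^ 2 = 0
  · obtain ⟨a, ha⟩ := exists_unit_orthogonal x
    refine ⟨a, ha, fun i => ?_⟩
    rw [h] at hsum ⊢
    have h0 : y.1 0 - t * x.1 0 = 0 := by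
      nlinarith [sq_nonneg (y.1 0 - t * x.1 0), sq_nonneg (y.1 1 - t * x.1 1),
        sq_nonneg (y.1 2 - t * x.1 2)]
    have h1 : y.1 1 - t * x.1 1 = 0 := by
      nlinarith [sq_nonneg (y.1 0 - t * x.1 0), sq_nonneg (y.1 1 - t * x.1 1),
        sq_nonneg (y.1 2 - t * x.1 2)]
    have h2 : y.1 2 - t * x.1 2 = 0 := by
      nlinarith [sq_nonneg (y.1 0 - t * x.1 0), sq_nonneg (y.1 1 - t * x.1 1),
        sq_nonneg (y.1 2 - t * x.1 2)]
    fin_cases i <;> simp <;> linarith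
  · set r := Real.sqrt (1 - t ^ 2) with hr
    have hr2 : r ^ 2 = 1 - t ^ 2 := Real.sq_sqrt (by rw [← hsum]; positivity)
    have hr0 : r ≠ 0 := fun h0 => h (by rw [← hr2, h0]; simp)
    refine ⟨⟨!₂[(y.1 0 - t * x.1 0) / r, (y.1 1 - t * x.1 1) / r, (y.1 2 - t * x.1 2) / r], ?_⟩,
      ?_, ?_⟩
    · rw [mem_sphere_zero_iff_norm, EuclideanSpace.norm_eq, Real.sqrt_eq_one]
      simp only [Fin.sum_univ_three, Real.norm_eq_abs, sq_abs]
      simp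
      field_simp
      linarith
    · rw [inner_E3]
      simp
      field_simp
      linear_combination htt - t * hx
    · intro i
      fin_cases i <;> simp <;> field_simp <;> ring

/-- The matrix has columns `a`, `x × a`, `x`, where `a` is the unit vector of
`exists_orthogonal_decomposition`. It sends the pole to its third column, and a meridian point,
whose second coordinate is zero, to `√(1 - t²) a + t x = y`. Hence a rotationally invariant function
of two points depends on their inner product alone. -/
theorem exists_rotate_pole_meridian (x y : S2) :
    ∃ g : SO3, rotate g pole = x ∧
      rotate g (meridian ⟨inner ℝ x.1 y.1, inner_mem_Icc x y⟩) = y := by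
  obtain ⟨a, hxa, hy⟩ := exists_orthogonal_decomposition x y
  have hx := sum_sq_S2 x
  have ha := sum_sq_S2 a
  rw [inner_E3] at hxa
  set x0 := x.1 0 with hx0
  set x1 := x.1 1 with hx1
  set x2 := x.1 2 with hx2
  set a0 := a.1 0 with ha0
  set a1 := a.1 1 with ha1
  set a2 := a.1 2 with ha2
  let A : Matrix (Fin 3) (Fin 3) ℝ :=
    !![a0, x1 * a2 - x2 * a1, x0; a1, x2 * a0 - x0 * a2, x1; a2, x0 * a1 - x1 * a0, x2]
  have hb : (x1 * a2 - x2 * a1) ^ 2 + (x2 * a0 - x0 * a2) ^ 2 + (x0 * a1 - x1 * a0) ^ 2 = 1 := by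
    linear_combination (a0 ^ 2 + a1 ^ 2 + a2 ^ 2) * hx + ha -
      (x0 * a0 + x1 * a1 + x2 * a2) * hxa
  have hA : A ∈ Matrix.specialOrthogonalGroup (Fin 3) ℝ := by
    rw [Matrix.mem_specialOrthogonalGroup_iff]
    constructor
    · rw [Matrix.mem_orthogonalGroup_iff']
      ext i j
      rw [Matrix.mul_apply, Fin.sum_univ_three]
      fin_cases i <;> fin_cases j <;> simp [A]
      · linear_combination ha
      · ring
      · linear_combination hxa
      · ring
      · linear_combination hb
      · ring
      · linear_combination hxa
      · ring
      · linear_combination hx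
    · rw [Matrix.det_fin_three]
      simp [A]
      linear_combination hb
  refine ⟨⟨A, hA⟩, ?_, ?_⟩
  · apply Subtype.ext
    ext i
    fin_cases i <;> simp [rotate, pole, A,
      hx0, hx1, hx2]
  · apply Subtype.ext
    ext i
    rw [hy]
    fin_cases i <;> simp [rotate, meridian, A,
      hx0, hx1, hx2, ha0, ha1, ha2] <;> ring

theorem integral_inner {E : Type*} [NormedAddCommGroup E] [NormedSpace ℝ E] (h : ℝ → E) (x : S2) :
    ∫ y, h (inner ℝ x.1 y.1) ∂surfaceMeasure = ∫ y : S2, h (y.1 2) ∂surfaceMeasure := by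
  obtain ⟨g, hg, -⟩ := exists_rotate_pole_meridian x x
  rw [← integral_comp_sphereHomeo (rotateLI g)]
  simp only [sphereHomeo_rotateLI]
  refine integral_congr_ae (Eventually.of_forall fun y => ?_)
  simp only
  rw [← inner_pole y, ← inner_rotate g pole y, hg]

/-! ### Infinitesimal rotations -/

/-- The value of a polynomial at a point of the sphere. -/
def evalS2 (x : S2) : MvPolynomial (Fin 3) ℂ →+* ℂ := MvPolynomial.eval fun i => (x.1 i : ℂ)

theorem continuous_evalS2 (p : MvPolynomial (Fin 3) ℂ) : Continuous fun x => evalS2 x p := by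
  unfold evalS2
  induction p using MvPolynomial.induction_on with
  | C a => simpa using continuous_const
  | add p q hp hq => simp only [map_add]; exact hp.add hq
  | mul_X p i hp =>
    simp only [map_mul, MvPolynomial.eval_X]
    exact hp.mul (by fun_prop)

theorem integrable_evalS2 (p : MvPolynomial (Fin 3) ℂ) :
    Integrable (fun x => evalS2 x p) surfaceMeasure :=
  integrable_of_continuous (continuous_evalS2 p)

theorem hasDerivAt_eval {v v' : ℝ → Fin 3 → ℂ} {t : ℝ}
    (hv : ∀ i, HasDerivAt (fun s => v s i) (v' t i) t) (p : MvPolynomial (Fin 3) ℂ) :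
    HasDerivAt (fun s => MvPolynomial.eval (v s) p)
      (∑ i, v' t i * MvPolynomial.eval (v t) (MvPolynomial.pderiv i p)) t := by
  induction p using MvPolynomial.induction_on with
  | C a => simpa using hasDerivAt_const t a
  | add p q hp hq =>
    simp only [map_add, mul_add, Finset.sum_add_distrib]
    exact hp.add hq
  | mul_X p i hp =>
    have h := hp.mul (hv i)
    simp only [map_mul, MvPolynomial.eval_X]
    refine h.congr_deriv ?_
    simp only [Derivation.leibniz, MvPolynomial.pderiv_X, smul_eq_mul, map_add, map_mul,
      MvPolynomial.eval_X, mul_add, Finset.sum_add_distrib]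
    rw [add_comm]
    congr 1
    · rw [Finset.sum_eq_single i]
      · simp; ring
      · intro j _ hj; simp [hj]
      · simp
    · rw [Finset.sum_mul]
      exact Finset.sum_congr rfl fun j _ => by ring

/-- The generator `X_i ∂_j - X_j ∂_i` of the rotations in a coordinate plane. -/
def rotD (i j : Fin 3) : Derivation ℂ (MvPolynomial (Fin 3) ℂ) (MvPolynomial (Fin 3) ℂ) :=
  MvPolynomial.mkDerivation ℂ fun k =>
    if k = j then MvPolynomial.X i else if k = i then -MvPolynomial.X j else 0

theorem rotD_apply {i j : Fin 3} (hij : i ≠ j) (p : MvPolynomial (Fin 3) ℂ) :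
    rotD i j p = MvPolynomial.X i * MvPolynomial.pderiv j p -
      MvPolynomial.X j * MvPolynomial.pderiv i p := by
  have : rotD i j = (MvPolynomial.X i : MvPolynomial (Fin 3) ℂ) • MvPolynomial.pderiv j -
      (MvPolynomial.X j : MvPolynomial (Fin 3) ℂ) • MvPolynomial.pderiv i := by
    apply MvPolynomial.derivation_ext
    intro k
    simp only [rotD, MvPolynomial.mkDerivation_X, Derivation.sub_apply, Derivation.smul_apply,
      MvPolynomial.pderiv_X, smul_eq_mul]
    by_cases h1 : k = j
    · subst h1; simp [hij.symm]
    · by_cases h2 : k = i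
      · subst h2; simp [hij]
      · simp [h1, h2]
  rw [this]
  simp

/-- The rotation of angle `t` in a coordinate plane. -/
def planeRotation {i j : Fin 3} (hij : i ≠ j) (t : ℝ) : E3 ≃ₗᵢ[ℝ] E3 :=
  LinearIsometry.toLinearIsometryEquiv
    { toFun := fun x => WithLp.toLp 2 fun k =>
        if k = i then Real.cos t * x i - Real.sin t * x j
        else if k = j then Real.sin t * x i + Real.cos t * x j else x k
      map_add' := fun x y => by
        ext k; simp; split_ifs <;> ring
      map_smul' := fun c x => by
        ext k; simp; split_ifs <;> ring
      norm_map' := fun x => by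
        rw [← sq_eq_sq₀ (norm_nonneg _) (norm_nonneg _), EuclideanSpace.norm_sq_eq,
          EuclideanSpace.norm_sq_eq]
        have h := Real.sin_sq_add_cos_sq t
        simp only [Fin.sum_univ_three, Real.norm_eq_abs, sq_abs]
        fin_cases i <;> fin_cases j <;> simp at hij ⊢
        · linear_combination (x 0 ^ 2 + x 1 ^ 2) * h
        · linear_combination (x 0 ^ 2 + x 2 ^ 2) * h
        · linear_combination (x 0 ^ 2 + x 1 ^ 2) * h
        · linear_combination (x 1 ^ 2 + x 2 ^ 2) * h
        · linear_combination (x 0 ^ 2 + x 2 ^ 2) * h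
        · linear_combination (x 1 ^ 2 + x 2 ^ 2) * h } rfl

theorem planeRotation_apply {i j : Fin 3} (hij : i ≠ j) (t : ℝ) (x : E3) (k : Fin 3) :
    planeRotation hij t x k = if k = i then Real.cos t * x i - Real.sin t * x j
        else if k = j then Real.sin t * x i + Real.cos t * x j else x k := rfl

theorem hasDerivAt_evalS2_planeRotation {i j : Fin 3} (hij : i ≠ j) (t : ℝ) (x : S2)
    (p : MvPolynomial (Fin 3) ℂ) :
    HasDerivAt (fun s => evalS2 (sphereHomeo (planeRotation hij s) x) p)
      (evalS2 (sphereHomeo (planeRotation hij t) x) (rotD i j p)) t := by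
  let v : ℝ → Fin 3 → ℂ := fun s k => ((planeRotation hij s x.1 k : ℝ) : ℂ)
  let v' : ℝ → Fin 3 → ℂ := fun s k => if k = i then -v s j else if k = j then v s i else 0
  have hv : ∀ k, HasDerivAt (fun s => v s k) (v' t k) t := by
    intro k
    have hc := Real.hasDerivAt_cos t
    have hs := Real.hasDerivAt_sin t
    by_cases h1 : k = i
    · subst h1
      have := ((hc.mul_const (x.1 k)).sub (hs.mul_const (x.1 j))).ofReal_comp
      simp only [v, v', planeRotation_apply, if_true, hij.symm, if_false]
      refine this.congr_deriv ?_
      push_cast; ring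
    · by_cases h2 : k = j
      · subst h2
        have := ((hs.mul_const (x.1 i)).add (hc.mul_const (x.1 k))).ofReal_comp
        simp only [v, v', planeRotation_apply, if_true, hij.symm, if_false]
        refine this.congr_deriv ?_
        push_cast; ring
      · simp only [v, v', planeRotation_apply, h1, h2, if_false]
        exact hasDerivAt_const _ _
  refine (hasDerivAt_eval hv p).congr_deriv ?_
  rw [rotD_apply hij, map_sub, map_mul, map_mul]
  have hX : ∀ k, evalS2 (sphereHomeo (planeRotation hij t) x) (MvPolynomial.X k) = v t k :=
    fun k => MvPolynomial.eval_X _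
  rw [hX, hX]
  have hsum : ∀ q : Fin 3 → ℂ, ∑ k, v' t k * q k = v t i * q j - v t j * q i := by
    intro q
    rw [← Finset.sum_subset (Finset.subset_univ {i, j}), Finset.sum_pair hij]
    · simp [v', hij.symm]; ring
    · intro k _ hk
      simp only [Finset.mem_insert, Finset.mem_singleton, not_or] at hk
      simp [v', hk.1, hk.2]
  exact hsum _

/-- The infinitesimal form of rotation invariance: the integral of `p` composed with a rotation does
not depend on the angle, and its derivative at angle zero, taken under the integral, is the
left-hand side. -/
theorem integral_rotD {i j : Fin 3} (hij : i ≠ j) (p : MvPolynomial (Fin 3) ℂ) :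
    ∫ x, evalS2 x (rotD i j p) ∂surfaceMeasure = 0 := by
  obtain ⟨C, hC⟩ := isCompact_univ.exists_bound_of_continuousOn
    (continuous_evalS2 (rotD i j p)).continuousOn
  have h := (hasDerivAt_integral_of_dominated_loc_of_deriv_le (μ := surfaceMeasure)
    (F := fun s x => evalS2 (sphereHomeo (planeRotation hij s) x) p)
    (F' := fun s x => evalS2 (sphereHomeo (planeRotation hij s) x) (rotD i j p))
    (x₀ := (0 : ℝ)) (s := Set.univ) (bound := fun _ => C) univ_mem
    (Eventually.of_forall fun s =>
      ((continuous_evalS2 p).comp (sphereHomeo _).continuous).aestronglyMeasurable)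
    (integrable_of_continuous ((continuous_evalS2 p).comp (sphereHomeo _).continuous))
    ((continuous_evalS2 _).comp (sphereHomeo _).continuous).aestronglyMeasurable
    (Eventually.of_forall fun x s _ => hC _ (Set.mem_univ _))
    (integrable_const C)
    (Eventually.of_forall fun x s _ => hasDerivAt_evalS2_planeRotation hij s x p)).2
  simp only [integral_comp_sphereHomeo _ fun y => evalS2 y p,
    integral_comp_sphereHomeo _ fun y => evalS2 y (rotD i j p)] at h
  exact h.unique (hasDerivAt_const _ _)

theorem integral_rotD_rotD_mul {i j : Fin 3} (hij : i ≠ j) (u v : MvPolynomial (Fin 3) ℂ) :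
    ∫ x, evalS2 x (rotD i j (rotD i j u) * v) ∂surfaceMeasure =
      -∫ x, evalS2 x (rotD i j u * rotD i j v) ∂surfaceMeasure := by
  have h := integral_rotD hij (rotD i j u * v)
  simp only [Derivation.leibniz, smul_eq_mul, map_add] at h
  rw [integral_add (integrable_evalS2 _) (integrable_evalS2 _)] at h
  simp only [mul_comm v] at h
  linear_combination h

/-- The spherical Laplace operator on polynomials. -/
def lapD (p : MvPolynomial (Fin 3) ℂ) : MvPolynomial (Fin 3) ℂ :=
  rotD 0 1 (rotD 0 1 p) + rotD 1 2 (rotD 1 2 p) + rotD 2 0 (rotD 2 0 p)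

/-- Each generator is antisymmetric, being a derivation whose values have integral zero, so its
square is symmetric. -/
theorem integral_lapD_mul (u v : MvPolynomial (Fin 3) ℂ) :
    ∫ x, evalS2 x (lapD u * v) ∂surfaceMeasure = ∫ x, evalS2 x (u * lapD v) ∂surfaceMeasure := by
  have key : ∀ i j : Fin 3, i ≠ j →
      ∫ x, evalS2 x (rotD i j (rotD i j u) * v) ∂surfaceMeasure =
      ∫ x, evalS2 x (u * rotD i j (rotD i j v)) ∂surfaceMeasure := by
    intro i j hij
    rw [integral_rotD_rotD_mul hij]
    simp only [mul_comm u]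
    rw [integral_rotD_rotD_mul hij]
    simp only [mul_comm (rotD i j u)]
  have hadd : ∀ p q, ∫ x, evalS2 x (p + q) ∂surfaceMeasure =
      ∫ x, evalS2 x p ∂surfaceMeasure + ∫ x, evalS2 x q ∂surfaceMeasure := by
    intro p q
    simp only [map_add]
    exact integral_add (integrable_evalS2 _) (integrable_evalS2 _)
  simp only [lapD, add_mul, mul_add]
  rw [hadd, hadd, hadd, hadd, key 0 1 (by decide), key 1 2 (by decide), key 2 0 (by decide)]

/-- A linear form. -/
def linForm (a : Fin 3 → ℂ) : MvPolynomial (Fin 3) ℂ :=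
  ∑ i, MvPolynomial.C (a i) * MvPolynomial.X i

/-- The polar form of the squared gradient. -/
def gradD (u v : MvPolynomial (Fin 3) ℂ) : MvPolynomial (Fin 3) ℂ :=
  rotD 0 1 u * rotD 0 1 v + rotD 1 2 u * rotD 1 2 v + rotD 2 0 u * rotD 2 0 v

theorem lapD_mul (u v : MvPolynomial (Fin 3) ℂ) :
    lapD (u * v) = lapD u * v + 2 * gradD u v + u * lapD v := by
  simp only [lapD, gradD, Derivation.leibniz, smul_eq_mul, map_add]
  ring

theorem lapD_aeval (u : MvPolynomial (Fin 3) ℂ) (p : Polynomial ℂ) :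
    lapD (Polynomial.aeval u p) =
      Polynomial.aeval u (Polynomial.derivative (Polynomial.derivative p)) * gradD u u +
        Polynomial.aeval u (Polynomial.derivative p) * lapD u := by
  simp only [lapD, gradD, Derivation.map_aeval, Derivation.leibniz, smul_eq_mul]
  ring

theorem gradD_aeval_aeval (u v : MvPolynomial (Fin 3) ℂ) (p q : Polynomial ℂ) :
    gradD (Polynomial.aeval u p) (Polynomial.aeval v q) =
      Polynomial.aeval u (Polynomial.derivative p) * Polynomial.aeval v (Polynomial.derivative q) *
        gradD u v := by
  simp only [gradD, Derivation.map_aeval, smul_eq_mul]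
  ring

theorem lapD_linForm (a : Fin 3 → ℂ) : lapD (linForm a) = -2 * linForm a := by
  simp [lapD, linForm, Fin.sum_univ_three, Derivation.leibniz, smul_eq_mul, rotD,
    MvPolynomial.mkDerivation_X]
  ring

theorem sum_sq_S2_complex (x : S2) : (x.1 0 : ℂ) ^ 2 + (x.1 1 : ℂ) ^ 2 + (x.1 2 : ℂ) ^ 2 = 1 := by
  have h := congrArg (fun r : ℝ => (r : ℂ)) (sum_sq_S2 x)
  push_cast at h
  exact h

theorem evalS2_linForm (a : Fin 3 → ℂ) (x : S2) :
    evalS2 x (linForm a) = a 0 * x.1 0 + a 1 * x.1 1 + a 2 * x.1 2 := by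
  simp [evalS2, linForm, Fin.sum_univ_three]

/-- Lagrange's identity for `(x × a) · (x × b)`, with `|x| = 1`. The form is bilinear, without
conjugation, so that complex vectors such as `(1, i, 0)` can be isotropic. -/
theorem evalS2_gradD_linForm (a b : Fin 3 → ℂ) (x : S2) :
    evalS2 x (gradD (linForm a) (linForm b)) = (a 0 * b 0 + a 1 * b 1 + a 2 * b 2) -
      evalS2 x (linForm a) * evalS2 x (linForm b) := by
  rw [evalS2_linForm, evalS2_linForm]
  simp [gradD, linForm, Fin.sum_univ_three, Derivation.leibniz, smul_eq_mul, rotD,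
    MvPolynomial.mkDerivation_X, evalS2]
  linear_combination (a 0 * b 0 + a 1 * b 1 + a 2 * b 2) * sum_sq_S2_complex x

theorem evalS2_aeval (u : MvPolynomial (Fin 3) ℂ) (p : Polynomial ℂ) (x : S2) :
    evalS2 x (Polynomial.aeval u p) = p.eval (evalS2 x u) := by
  induction p using Polynomial.induction_on' with
  | add p q hp hq => simp [hp, hq]
  | monomial n a => simp [Polynomial.aeval_monomial, evalS2]

/-! ### Spherical harmonics as eigenfunctions -/

/-- `f` is the restriction to the sphere of a polynomial and an eigenfunction of the spherical
Laplace operator for the eigenvalue `-l (l + 1)`. -/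
def IsHarmonicOfDegree (l : ℕ) (f : S2 → ℂ) : Prop :=
  ∃ u, (∀ x, f x = evalS2 x u) ∧ ∀ x, evalS2 x (lapD u) = -((l : ℂ) * (l + 1)) * f x

theorem IsHarmonicOfDegree.continuous {l : ℕ} {f : S2 → ℂ} (hf : IsHarmonicOfDegree l f) :
    Continuous f := by
  obtain ⟨u, hu, -⟩ := hf
  rw [funext hu]
  exact continuous_evalS2 u

/-- Eigenfunctions of a symmetric operator for distinct eigenvalues: `k(k+1) - l(l+1) = (k - l)(k +
l + 1)`. -/
theorem IsHarmonicOfDegree.integral_mul_eq_zero {k l : ℕ} (hkl : k ≠ l) {f g : S2 → ℂ}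
    (hf : IsHarmonicOfDegree k f) (hg : IsHarmonicOfDegree l g) :
    ∫ x, f x * g x ∂surfaceMeasure = 0 := by
  obtain ⟨u, hu, hu'⟩ := hf
  obtain ⟨v, hv, hv'⟩ := hg
  have h := integral_lapD_mul u v
  have h1 : ∀ x, evalS2 x (lapD u * v) = -((k : ℂ) * (k + 1)) * (f x * g x) := fun x => by
    rw [map_mul, hu', hv, mul_assoc]
  have h2 : ∀ x, evalS2 x (u * lapD v) = -((l : ℂ) * (l + 1)) * (f x * g x) := fun x => by
    rw [map_mul, hv', hu]; ring
  simp only [h1, h2, integral_const_mul] at h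
  have hne : ((k : ℂ) * (k + 1)) - ((l : ℂ) * (l + 1)) ≠ 0 := by
    have : ((k : ℂ) * (k + 1)) - ((l : ℂ) * (l + 1)) = ((k : ℂ) - l) * ((k + l + 1 : ℕ) : ℂ) := by
      push_cast; ring
    rw [this]
    refine mul_ne_zero (sub_ne_zero.2 (by exact_mod_cast hkl))
      (Nat.cast_ne_zero.2 (Nat.succ_ne_zero _))
  refine (mul_eq_zero.1 (?_ : (((k : ℂ) * (k + 1)) - ((l : ℂ) * (l + 1))) *
    ∫ x, f x * g x ∂surfaceMeasure = 0)).resolve_left hne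
  linear_combination -h

theorem IsHarmonicOfDegree.const_mul {l : ℕ} {f : S2 → ℂ} (hf : IsHarmonicOfDegree l f) (c : ℂ) :
    IsHarmonicOfDegree l fun x => c * f x := by
  obtain ⟨u, hu, hu'⟩ := hf
  have hc : lapD (MvPolynomial.C c * u) = MvPolynomial.C c * lapD u := by
    rw [← MvPolynomial.smul_eq_C_mul, ← MvPolynomial.smul_eq_C_mul]
    simp [lapD]
  refine ⟨MvPolynomial.C c * u, fun x => ?_, fun x => ?_⟩
  · simp [hu, evalS2]
  · rw [hc, map_mul, hu']
    simp [evalS2]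
    ring

/-- The polynomial `p(⟨a, ·⟩)`. -/
def zonal (a : S2) (p : Polynomial ℝ) : MvPolynomial (Fin 3) ℂ :=
  Polynomial.aeval (linForm fun i => (a.1 i : ℂ)) (p.map Complex.ofRealHom)

theorem evalS2_linForm_ofReal (a x : S2) :
    evalS2 x (linForm fun i => (a.1 i : ℂ)) = ((inner ℝ a.1 x.1 : ℝ) : ℂ) := by
  rw [evalS2_linForm, inner_E3]; push_cast; ring

theorem eval_map_ofReal (p : Polynomial ℝ) (t : ℝ) :
    (p.map Complex.ofRealHom).eval (t : ℂ) = ((p.eval t : ℝ) : ℂ) := by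
  rw [Polynomial.eval_map]
  exact Polynomial.eval₂_at_apply Complex.ofRealHom t

theorem evalS2_zonal (a x : S2) (p : Polynomial ℝ) :
    evalS2 x (zonal a p) = ((p.eval (inner ℝ a.1 x.1) : ℝ) : ℂ) := by
  rw [zonal, evalS2_aeval, evalS2_linForm_ofReal, eval_map_ofReal]

open Polynomial in
-- For `t = ⟨a, x⟩` the squared gradient is `1 - t²` and the Laplacian is `-2t`; the chain rule then
-- produces Legendre's operator.
theorem evalS2_lapD_zonal (a x : S2) (p : ℝ[X]) :
    evalS2 x (lapD (zonal a p)) =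
      ((((1 - X ^ 2) * derivative (derivative p) - 2 * X * derivative p).eval
        (inner ℝ a.1 x.1) : ℝ) : ℂ) := by
  rw [zonal, lapD_aeval, map_add, map_mul, map_mul, evalS2_aeval, evalS2_aeval,
    evalS2_gradD_linForm, lapD_linForm, map_mul, evalS2_linForm_ofReal, derivative_map,
    derivative_map, eval_map_ofReal, eval_map_ofReal]
  have := sum_sq_S2_complex a
  have h2 : evalS2 x (-2) = -2 := by rw [map_neg, map_ofNat]
  rw [h2]
  simp only [eval_sub, eval_mul, eval_one, eval_pow, eval_X, eval_ofNat]
  push_cast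
  linear_combination (((derivative (derivative p)).eval (inner ℝ a.1 x.1) : ℝ) : ℂ) * this

theorem isHarmonicOfDegree_legendre (l : ℕ) (a : S2) :
    IsHarmonicOfDegree l fun x => (((legendre l).eval (inner ℝ a.1 x.1) : ℝ) : ℂ) := by
  refine ⟨zonal a (legendre l), fun x => (evalS2_zonal a x _).symm, fun x => ?_⟩
  rw [evalS2_lapD_zonal, legendre_ode]
  simp

open Polynomial in
-- With `w = x₀ + i x₁` and `z = x₂`, the vector of `w` is isotropic and orthogonal to that of `z`.
-- The Laplacian of `w^m q(z)` is therefore `w^m` times a second order operator in `z` applied to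
-- `q`, and `q = P_l^{(m)}` satisfies its eigenvalue equation.
theorem isHarmonicOfDegree_sphericalHarmonicNonneg (l m : ℕ) :
    IsHarmonicOfDegree l (sphericalHarmonicNonneg l m) := by
  set q : ℂ[X] := (derivative^[m] (legendre l)).map Complex.ofRealHom with hq
  let a : Fin 3 → ℂ := ![1, Complex.I, 0]
  let b : Fin 3 → ℂ := ![0, 0, 1]
  have ha : ∀ x, evalS2 x (linForm a) = (x.1 0 : ℂ) + Complex.I * (x.1 1 : ℂ) := fun x => by
    rw [evalS2_linForm]; simp [a]
  have hb : ∀ x, evalS2 x (linForm b) = (x.1 2 : ℂ) := fun x => by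
    rw [evalS2_linForm]; simp [b]
  have key : IsHarmonicOfDegree l fun x : S2 => ((x.1 0 : ℂ) + Complex.I * (x.1 1 : ℂ)) ^ m *
      ((Polynomial.derivative^[m] (legendre l)).eval (x.1 2) : ℝ) := by
    refine ⟨aeval (linForm a) (X ^ m : ℂ[X]) * aeval (linForm b) q, fun x => ?_, fun x => ?_⟩
    · rw [map_mul, evalS2_aeval, evalS2_aeval, ha, hb, hq, eval_map_ofReal]
      simp
    · have ode := congrArg (fun p : ℝ[X] => ((p.eval (x.1 2) : ℝ) : ℂ))
        (iterate_derivative_legendre_ode l m)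
      simp only [eval_sub, eval_mul, eval_one, eval_pow, eval_X, eval_ofNat, eval_add,
        eval_natCast] at ode
      push_cast at ode
      have haa : a 0 * a 0 + a 1 * a 1 + a 2 * a 2 = 0 := by simp [a]
      have hab : a 0 * b 0 + a 1 * b 1 + a 2 * b 2 = 0 := by simp [a, b]
      have hbb : b 0 * b 0 + b 1 * b 1 + b 2 * b 2 = 1 := by simp [b]
      have h2 : evalS2 x (-2) = -2 := by rw [map_neg, map_ofNat]
      have h2' : evalS2 x 2 = 2 := by rw [map_ofNat]
      rw [lapD_mul, lapD_aeval, lapD_aeval, gradD_aeval_aeval, lapD_linForm, lapD_linForm]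
      simp only [map_add, map_mul, evalS2_aeval, evalS2_gradD_linForm, haa, hab, hbb, ha, hb, h2,
        h2', hq, derivative_map, eval_map_ofReal]
      -- Euler's identities for `w ^ m`, multiplied by `w` and `w ^ 2` so that no exponent `m - 1`
      -- or `m - 2` occurs for small `m`.
      have hd : (x.1 0 + Complex.I * x.1 1 : ℂ) * (derivative (X ^ m : ℂ[X])).eval
          (x.1 0 + Complex.I * x.1 1 : ℂ) = m * (x.1 0 + Complex.I * x.1 1 : ℂ) ^ m := by
        rcases m with _ | m
        · simp
        · simp; ring
      have hdd : (x.1 0 + Complex.I * x.1 1 : ℂ) ^ 2 * (derivative (derivative (X ^ m : ℂ[X]))).eval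
          (x.1 0 + Complex.I * x.1 1 : ℂ) = m * (m - 1) * (x.1 0 + Complex.I * x.1 1 : ℂ) ^ m := by
        rcases m with _ | _ | m
        · simp
        · simp
        · simp; ring
      simp only [eval_pow, eval_X]
      set w : ℂ := x.1 0 + Complex.I * x.1 1
      set q0 : ℂ := ((eval (x.1 2) (derivative^[m] (legendre l)) : ℝ) : ℂ)
      set q1 : ℂ := ((eval (x.1 2) (derivative (derivative^[m] (legendre l))) : ℝ) : ℂ)
      linear_combination w ^ m * ode - q0 * hdd - 2 * (x.1 2 : ℂ) * q1 * hd - 2 * q0 * hd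
  have h := key.const_mul ((Real.sqrt ((2 * l + 1) / (4 * Real.pi) *
    ((l - m).factorial / (l + m).factorial)) : ℂ) * (-1) ^ m)
  have he : sphericalHarmonicNonneg l m = fun x : S2 => ((Real.sqrt ((2 * l + 1) / (4 * Real.pi) *
      ((l - m).factorial / (l + m).factorial)) : ℂ) * (-1) ^ m) *
      (((x.1 0 : ℂ) + Complex.I * (x.1 1 : ℂ)) ^ m *
      ((Polynomial.derivative^[m] (legendre l)).eval (x.1 2) : ℝ)) := by
    funext x
    rw [sphericalHarmonicNonneg]
    ring
  rw [he]
  exact h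

/-! ### Integrals of functions of the height -/

theorem continuous_height : Continuous fun x : S2 => x.1 2 := by fun_prop

theorem integrable_eval_height (p : Polynomial ℝ) :
    Integrable (fun x : S2 => p.eval (x.1 2)) surfaceMeasure :=
  integrable_of_continuous (p.continuous.comp continuous_height)

/-- The integral over the sphere of a polynomial in the height. -/
def heightIntegral : Polynomial ℝ →ₗ[ℝ] ℝ where
  toFun p := ∫ x : S2, p.eval (x.1 2) ∂surfaceMeasure
  map_add' p q := by
    simp only [Polynomial.eval_add]
    exact integral_add (integrable_eval_height p) (integrable_eval_height q)
  map_smul' c p := by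
    simp only [Polynomial.eval_smul, smul_eq_mul, RingHom.id_apply]
    exact integral_const_mul _ _

theorem heightIntegral_apply (p : Polynomial ℝ) :
    heightIntegral p = ∫ x : S2, p.eval (x.1 2) ∂surfaceMeasure := rfl

open Polynomial in
-- The symmetry of the Laplace operator, tested against the constant `1`.
theorem heightIntegral_laplace (p : ℝ[X]) :
    heightIntegral ((1 - X ^ 2) * derivative (derivative p) - 2 * X * derivative p) = 0 := by
  have h := integral_lapD_mul (zonal pole p) 1
  have h1 : lapD 1 = 0 := by simp [lapD]
  simp only [mul_one, h1, mul_zero, map_zero, integral_zero, evalS2_lapD_zonal, inner_pole] at h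
  rw [integral_complex_ofReal] at h
  exact_mod_cast h

open Polynomial in
-- `heightIntegral_laplace` applied to `X ^ (n + 2)` links the moments of order `n` and `n + 2`. The
-- recursion starts from the total mass and from `X`, an eigenfunction for a nonzero eigenvalue. No
-- spherical coordinates are needed.
theorem heightIntegral_X_pow (n : ℕ) :
    heightIntegral (X ^ n) = 2 * Real.pi * ((1 - (-1) ^ (n + 1)) / (n + 1)) := by
  induction n using Nat.twoStepInduction with
  | zero =>
    rw [heightIntegral_apply]
    simp [surfaceMeasure_real_univ]
    ring
  | one =>
    have h := heightIntegral_laplace X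
    have h1 : (1 - X ^ 2) * derivative (derivative X) - 2 * X * derivative X =
        (-2 : ℝ) • (X : ℝ[X]) := by
      simp only [smul_eq_C_mul, map_neg, map_ofNat, derivative_X, derivative_one]
      ring
    rw [h1, map_smul] at h
    simp at h ⊢
    exact h
  | more n ih _ =>
    have h := heightIntegral_laplace (X ^ (n + 2))
    have h1 : (1 - X ^ 2) * derivative (derivative (X ^ (n + 2))) -
        2 * X * derivative (X ^ (n + 2)) =
        (((n : ℝ) + 2) * (n + 1)) • (X : ℝ[X]) ^ n -
          (((n : ℝ) + 2) * (n + 3)) • (X : ℝ[X]) ^ (n + 2) := by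
      simp only [smul_eq_C_mul, map_add, map_mul, map_ofNat, map_natCast, map_one]
      simp
      ring
    rw [h1, map_sub, map_smul, map_smul, ih] at h
    have h2 : ((n : ℝ) + 2) ≠ 0 := by positivity
    have h3 : ((n : ℝ) + 3) ≠ 0 := by positivity
    have h4 : ((n : ℝ) + 1) ≠ 0 := by positivity
    have h5 : ((n : ℝ) + 3) * heightIntegral (X ^ (n + 2)) =
        2 * Real.pi * (1 - (-1) ^ (n + 1)) := by
      refine mul_left_cancel₀ h2 ?_
      simp only [smul_eq_mul] at h
      field_simp at h
      linear_combination -h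
    push_cast
    rw [eq_comm, mul_div_assoc', div_eq_iff (by positivity)]
    linear_combination -h5

open Polynomial in
/-- The theorem of Archimedes, for polynomials. -/
theorem heightIntegral_eq (p : ℝ[X]) :
    heightIntegral p = 2 * Real.pi * ∫ t in (-1 : ℝ)..1, p.eval t := by
  induction p using Polynomial.induction_on' with
  | add p q hp hq =>
    rw [map_add, hp, hq]
    simp only [eval_add]
    rw [intervalIntegral.integral_add (p.continuous.intervalIntegrable _ _)
      (q.continuous.intervalIntegrable _ _)]
    ring
  | monomial n a =>
    rw [← smul_X_eq_monomial, map_smul, heightIntegral_X_pow]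
    simp only [eval_smul, eval_pow, eval_X, smul_eq_mul]
    rw [intervalIntegral.integral_const_mul, integral_pow]
    simp
    ring

open Polynomial in
theorem heightIntegral_derivative (p : ℝ[X]) :
    heightIntegral (derivative p) = 2 * Real.pi * (p.eval 1 - p.eval (-1)) := by
  rw [heightIntegral_eq, intervalIntegral.integral_eq_sub_of_hasDerivAt
    (fun t _ => p.hasDerivAt t) ((derivative p).continuous.intervalIntegrable _ _)]

open Polynomial in
-- The Wronskian of the two polynomials times `1 - X ^ 2` vanishes at both endpoints, and by
-- Legendre's equation its derivative is a nonzero multiple of the product.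
theorem heightIntegral_legendre_mul_legendre {k l : ℕ} (hkl : k ≠ l) :
    heightIntegral (legendre k * legendre l) = 0 := by
  have h := heightIntegral_derivative ((1 - X ^ 2) * (derivative (legendre k) * legendre l -
    legendre k * derivative (legendre l)))
  have h1 : derivative ((1 - X ^ 2) * (derivative (legendre k) * legendre l -
      legendre k * derivative (legendre l))) =
      ((l : ℝ) * (l + 1) - k * (k + 1)) • (legendre k * legendre l) := by
    simp only [derivative_mul, derivative_sub, derivative_one, derivative_X_pow, smul_eq_C_mul]
    simp only [map_ofNat, Nat.cast_ofNat, map_sub, map_mul, map_add, map_natCast, map_one]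
    linear_combination legendre l * legendre_ode k - legendre k * legendre_ode l
  rw [h1, map_smul] at h
  simp only [eval_mul, eval_sub, eval_pow, eval_X, eval_one, smul_eq_mul] at h
  have hne : (l : ℝ) * (l + 1) - k * (k + 1) ≠ 0 := by
    have : (l : ℝ) * (l + 1) - k * (k + 1) = ((l : ℝ) - k) * ((k + l + 1 : ℕ) : ℝ) := by
      push_cast; ring
    rw [this]
    exact mul_ne_zero (sub_ne_zero.2 (by exact_mod_cast hkl.symm))
      (Nat.cast_ne_zero.2 (Nat.succ_ne_zero _))
  refine (mul_eq_zero.1 (h.trans ?_)).resolve_left hne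
  norm_num

open Polynomial in
theorem heightIntegral_mul_legendre_of_degree_lt {l : ℕ} {r : ℝ[X]}
    (hr : r.degree < (l : WithBot ℕ)) :
    heightIntegral (r * legendre l) = 0 := by
  rw [← mem_degreeLT, ← span_legendre_degreeLT] at hr
  induction hr using Submodule.span_induction with
  | mem p hp =>
    obtain ⟨k, hk, rfl⟩ := hp
    exact heightIntegral_legendre_mul_legendre hk.ne
  | zero => simp
  | add p q _ _ hp hq => rw [add_mul, map_add, hp, hq, add_zero]
  | smul c p _ hp => rw [smul_mul_assoc, map_smul, hp, smul_zero]

open Polynomial in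
-- The derivative of `X P_l²` is `P_l² + 2 X P_l' P_l`, and `X P_l' - l P_l` has degree below `l`,
-- hence is orthogonal to `P_l`. The integral is thus `2l + 1` times the squared norm, while the
-- boundary values of `X P_l²` are `1` and `-1`.
theorem heightIntegral_legendre_sq (l : ℕ) :
    heightIntegral (legendre l * legendre l) = 4 * Real.pi / (2 * l + 1) := by
  have h := heightIntegral_derivative (X * (legendre l) ^ 2)
  have hdeg : (X * derivative (legendre l) - (l : ℝ) • legendre l).degree < (l : WithBot ℕ) := by
    rw [degree_lt_iff_coeff_zero]
    intro m hm
    have hX : (X * derivative (legendre l)).coeff m = (legendre l).coeff m * m := by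
      rcases m with _ | m
      · simp
      · rw [coeff_X_mul, coeff_derivative]; push_cast; ring
    rw [coeff_sub, hX, coeff_smul, smul_eq_mul]
    rcases hm.eq_or_lt with rfl | hlt
    · ring
    · rw [coeff_eq_zero_of_natDegree_lt ((natDegree_legendre_le l).trans_lt hlt)]; ring
  have h0 := heightIntegral_mul_legendre_of_degree_lt hdeg
  have h1 : derivative (X * (legendre l) ^ 2) = (2 * (l : ℝ) + 1) • (legendre l * legendre l) +
      (2 : ℝ) • ((X * derivative (legendre l) - (l : ℝ) • legendre l) * legendre l) := by
    simp only [derivative_mul, derivative_X, derivative_pow, smul_eq_C_mul, map_add, map_mul,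
      map_ofNat, map_natCast, map_one]
    push_cast
    ring
  rw [h1, map_add, map_smul, map_smul, h0] at h
  simp only [eval_mul, eval_pow, eval_X, legendre_eval_one, legendre_eval_neg_one_sq,
    smul_eq_mul] at h
  rw [eq_div_iff (by positivity)]
  linear_combination h

open Polynomial in
-- Integration by parts and the differential equation show that passing from order `m` to `m + 1`
-- multiplies the integral by `(l - m)(l + m + 1)`, which is the change in `(l + m)! / (l - m)!`.
theorem heightIntegral_assocLegendre_sq {l m : ℕ} (hm : m ≤ l) :
    heightIntegral ((1 - X ^ 2) ^ m * (derivative^[m] (legendre l)) ^ 2) *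
      ((l - m).factorial : ℝ) = 4 * Real.pi / (2 * l + 1) * (l + m).factorial := by
  induction m with
  | zero =>
    have := heightIntegral_legendre_sq l
    simp only [pow_zero, one_mul, Function.iterate_zero_apply, sq, Nat.sub_zero, add_zero]
    rw [this]
  | succ m ih =>
    have ih := ih (by omega)
    set q := derivative^[m] (legendre l) with hq
    have h := heightIntegral_derivative ((1 - X ^ 2) ^ (m + 1) * (q * derivative q))
    have h1 : derivative ((1 - X ^ 2) ^ (m + 1) * (q * derivative q)) =
        (1 - X ^ 2) ^ (m + 1) * (derivative q) ^ 2 +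
          ((m : ℝ) * (m + 1) - l * (l + 1)) • ((1 - X ^ 2) ^ m * q ^ 2) := by
      have ode := iterate_derivative_legendre_ode l m
      rw [← hq] at ode
      simp only [derivative_mul, derivative_pow, derivative_one, derivative_X,
        smul_eq_C_mul, map_sub, map_mul, map_add, map_natCast, map_one]
      simp
      linear_combination (1 - X ^ 2) ^ m * q * ode
    rw [h1, map_add, map_smul] at h
    have h2 : heightIntegral ((1 - X ^ 2) ^ (m + 1) * (derivative q) ^ 2) =
        ((l - m : ℕ) : ℝ) * (l + m + 1) * heightIntegral ((1 - X ^ 2) ^ m * q ^ 2) := by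
      rw [Nat.cast_sub (by omega)]
      simp at h
      linear_combination h
    rw [Function.iterate_succ_apply', ← hq, h2]
    have h3 : (l - m).factorial = (l - m) * (l - (m + 1)).factorial := by
      obtain ⟨d, rfl⟩ := Nat.exists_eq_add_of_le hm
      rw [show m + 1 + d - m = d + 1 by omega, show m + 1 + d - (m + 1) = d by omega,
        Nat.factorial_succ]
    rw [h3] at ih
    push_cast at ih
    rw [← add_assoc, Nat.factorial_succ]
    push_cast
    linear_combination ((l : ℝ) + m + 1) * ih

open Polynomial in
theorem integral_norm_sphericalHarmonicNonneg_sq {l m : ℕ} (hm : m ≤ l) :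
    ∫ x, ‖sphericalHarmonicNonneg l m x‖ ^ 2 ∂surfaceMeasure = 1 := by
  have h := heightIntegral_assocLegendre_sq hm
  have hx : ∀ x : S2, ‖sphericalHarmonicNonneg l m x‖ ^ 2 =
      ((2 * l + 1) / (4 * Real.pi) * ((l - m).factorial / (l + m).factorial)) *
        ((1 - X ^ 2) ^ m * (derivative^[m] (legendre l)) ^ 2).eval (x.1 2) := by
    intro x
    have hw : ‖(x.1 0 : ℂ) + Complex.I * (x.1 1 : ℂ)‖ ^ 2 = 1 - x.1 2 ^ 2 := by
      rw [← Complex.normSq_eq_norm_sq, Complex.normSq_apply]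
      simp
      linear_combination sum_sq_S2 x
    have hs : ‖(Real.sqrt ((2 * l + 1) / (4 * Real.pi) *
        ((l - m).factorial / (l + m).factorial)) : ℂ)‖ ^ 2 =
        (2 * l + 1) / (4 * Real.pi) * ((l - m).factorial / (l + m).factorial) := by
      rw [Complex.norm_real, Real.norm_eq_abs, sq_abs, Real.sq_sqrt (by positivity)]
    rw [sphericalHarmonicNonneg, norm_mul, mul_pow, hs, norm_mul, norm_mul, norm_pow, norm_pow,
      mul_pow, mul_pow, ← pow_mul _ m 2, ← pow_mul _ m 2, mul_comm m 2, pow_mul _ 2 m,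
      pow_mul _ 2 m, hw, Complex.norm_real, Real.norm_eq_abs, sq_abs]
    simp
  simp only [hx, integral_const_mul]
  rw [← heightIntegral_apply]
  have h1 : ((l + m).factorial : ℝ) ≠ 0 := by positivity
  have hpi := Real.pi_ne_zero
  have h2 : (2 * (l : ℝ) + 1) ≠ 0 := by positivity
  field_simp at h ⊢
  linear_combination h

/-! ### A polynomial approximate identity -/

open Polynomial in
/-- The polynomial `(n + 1) / (4π) ((1 + t) / 2)^n`. -/
def bump (n : ℕ) : ℝ[X] := C ((n + 1) / (4 * Real.pi) / 2 ^ n) * (1 + X) ^ n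

theorem bump_eval (n : ℕ) (t : ℝ) :
    (bump n).eval t = (n + 1) / (4 * Real.pi) * ((1 + t) / 2) ^ n := by
  simp [bump, div_pow]
  ring

theorem bump_nonneg (n : ℕ) {t : ℝ} (ht : -1 ≤ t) : 0 ≤ (bump n).eval t := by
  rw [bump_eval]
  have : 0 ≤ (1 + t) / 2 := by linarith
  positivity

open Polynomial in
theorem heightIntegral_bump (n : ℕ) : heightIntegral (bump n) = 1 := by
  have h := heightIntegral_derivative (C (1 / (4 * Real.pi) / 2 ^ n) * (1 + X) ^ (n + 1))
  have h1 : derivative (C (1 / (4 * Real.pi) / 2 ^ n) * (1 + X) ^ (n + 1)) = bump n := by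
    rw [derivative_C_mul, derivative_pow_succ, bump]
    have : (C ((n + 1) / (4 * Real.pi) / 2 ^ n) : ℝ[X]) =
        C (1 / (4 * Real.pi) / 2 ^ n) * C ((n : ℝ) + 1) := by
      rw [← C_mul]; congr 1; ring
    rw [this]
    simp
    ring
  rw [← h1, h]
  simp
  have := Real.pi_ne_zero
  norm_num
  field_simp
  ring

theorem exists_bump_le (δ : ℝ) (hδ : 0 < δ) (hδ2 : δ ≤ 2) (ε : ℝ) (hε : 0 < ε) :
    ∀ᶠ n : ℕ in atTop, ∀ t : ℝ, -1 ≤ t → t ≤ 1 - δ → (bump n).eval t ≤ ε := by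
  have hr0 : 0 ≤ 1 - δ / 2 := by linarith
  have hr1 : 1 - δ / 2 < 1 := by linarith
  have h1 := tendsto_self_mul_const_pow_of_lt_one hr0 hr1
  have h2 := tendsto_pow_atTop_nhds_zero_of_lt_one hr0 hr1
  have h3 := ((h1.add h2).const_mul (1 / (4 * Real.pi)))
  simp only [add_zero, mul_zero] at h3
  filter_upwards [h3.eventually (ge_mem_nhds hε)] with n hn t ht1 ht2
  rw [bump_eval]
  refine le_trans ?_ hn
  have : ((1 + t) / 2) ^ n ≤ (1 - δ / 2) ^ n :=
    pow_le_pow_left₀ (by linarith) (by linarith) n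
  have hpi := Real.pi_pos
  calc ((n : ℝ) + 1) / (4 * Real.pi) * ((1 + t) / 2) ^ n
      ≤ ((n : ℝ) + 1) / (4 * Real.pi) * (1 - δ / 2) ^ n := by gcongr
    _ = _ := by ring

theorem dist_sq_S2 (x y : S2) : dist x y ^ 2 = 2 - 2 * inner ℝ x.1 y.1 := by
  rw [Subtype.dist_eq, dist_eq_norm, @norm_sub_sq ℝ, mem_sphere_zero_iff_norm.1 x.2,
    mem_sphere_zero_iff_norm.1 y.2]
  simp
  ring

theorem continuous_eval_inner (p : Polynomial ℝ) (x : S2) :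
    Continuous fun y : S2 => p.eval (inner ℝ x.1 y.1) :=
  p.continuous.comp (continuous_inner_S2 x)

theorem integral_eval_inner (p : Polynomial ℝ) (x : S2) :
    ∫ y, p.eval (inner ℝ x.1 y.1) ∂surfaceMeasure = heightIntegral p :=
  integral_inner (fun t => p.eval t) x

/-- Near the diagonal `w` is small by uniform continuity; away from it the bump is uniformly small.
Both bounds are independent of `x`. -/
theorem eventually_integral_bump_mul_le {w : S2 × S2 → ℝ} (hw : Continuous w)
    (hw0 : ∀ x, w (x, x) = 0) (ε : ℝ) (hε : 0 < ε) :
    ∀ᶠ n : ℕ in atTop, ∀ x : S2,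
      ∫ y, (bump n).eval (inner ℝ x.1 y.1) * |w (x, y)| ∂surfaceMeasure ≤ ε := by
  obtain ⟨M, hM⟩ := isCompact_univ.exists_bound_of_continuousOn hw.continuousOn
  have hM0 : 0 ≤ M := (norm_nonneg _).trans (hM (pole, pole) (Set.mem_univ _))
  obtain ⟨η, hη, hηw⟩ := Metric.uniformContinuous_iff.1
    (CompactSpace.uniformContinuous_of_continuous hw) (ε / 2) (by positivity)
  -- Since the squared distance is `2 - 2⟨x, y⟩`, an inner product above `1 - δ` forces a distance
  -- below `η` once `2 δ ≤ η ^ 2`. The cap `2` is required by `exists_bump_le`.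
  set δ := min (η ^ 2 / 2) 2 with hδ
  have hδ0 : 0 < δ := by positivity
  filter_upwards [exists_bump_le δ hδ0 (min_le_right _ _) (ε / (2 * (4 * Real.pi * (M + 1))))
    (by have := Real.pi_pos; positivity)] with n hn x
  have hb : ∀ y : S2, (bump n).eval (inner ℝ x.1 y.1) * |w (x, y)| ≤
      (bump n).eval (inner ℝ x.1 y.1) * (ε / 2) + ε / (2 * (4 * Real.pi)) := by
    intro y
    have ht := inner_mem_Icc x y
    have hb0 := bump_nonneg n ht.1
    have hpi := Real.pi_pos
    by_cases h : inner ℝ x.1 y.1 ≤ 1 - δ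
    · have h1 := hn _ ht.1 h
      have h2 : |w (x, y)| ≤ M + 1 := (hM (x, y) (Set.mem_univ _)).trans (by linarith)
      calc (bump n).eval (inner ℝ x.1 y.1) * |w (x, y)|
          ≤ ε / (2 * (4 * Real.pi * (M + 1))) * (M + 1) := by gcongr
        _ = ε / (2 * (4 * Real.pi)) := by field_simp
        _ ≤ _ := by
          have : 0 ≤ (bump n).eval (inner ℝ x.1 y.1) * (ε / 2) := by positivity
          linarith
    · have hd : dist x y < η := by
        rw [← sq_lt_sq₀ dist_nonneg hη.le, dist_sq_S2]
        have := min_le_left (η ^ 2 / 2) 2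
        push Not at h
        linarith
      have h2 : |w (x, y)| ≤ ε / 2 := by
        have h3 := @hηw (x, y) (x, x) (by
          rw [Prod.dist_eq]; simp only [dist_self]; rw [dist_comm]; exact max_lt hη hd)
        rw [hw0, Real.dist_eq, sub_zero] at h3
        exact h3.le
      calc (bump n).eval (inner ℝ x.1 y.1) * |w (x, y)|
          ≤ (bump n).eval (inner ℝ x.1 y.1) * (ε / 2) := by gcongr
        _ ≤ _ := le_add_of_nonneg_right (by positivity)
  have hwx : Continuous fun y => w (x, y) := by fun_prop
  calc ∫ y, (bump n).eval (inner ℝ x.1 y.1) * |w (x, y)| ∂surfaceMeasure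
      ≤ ∫ y, ((bump n).eval (inner ℝ x.1 y.1) * (ε / 2) + ε / (2 * (4 * Real.pi)))
          ∂surfaceMeasure :=
        integral_mono (integrable_of_continuous ((continuous_eval_inner _ _).mul hwx.abs))
          (integrable_of_continuous (((continuous_eval_inner _ _).mul continuous_const).add
            continuous_const)) hb
    _ = ε := by
        have hi : Integrable (fun y : S2 => (bump n).eval (inner ℝ x.1 y.1) * (ε / 2))
          surfaceMeasure := integrable_of_continuous ((continuous_eval_inner _ _).mul
            continuous_const)
        rw [integral_add hi (integrable_const _), integral_mul_const, integral_eval_inner,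
          heightIntegral_bump, integral_const, surfaceMeasure_real_univ, smul_eq_mul]
        have := Real.pi_ne_zero
        field_simp
        ring

theorem tendsto_integral_bump_mul {f : S2 → ℂ} (hf : Continuous f) (x : S2) :
    Tendsto (fun n => ∫ y, (((bump n).eval (inner ℝ x.1 y.1) : ℝ) : ℂ) * f y ∂surfaceMeasure)
      atTop (𝓝 (f x)) := by
  rw [Metric.tendsto_nhds]
  intro ε hε
  have h := eventually_integral_bump_mul_le (w := fun p => ‖f p.2 - f p.1‖) (by fun_prop)
    (by simp) (ε / 2) (by positivity)
  filter_upwards [h] with n hn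
  have hc : Continuous fun y : S2 => (((bump n).eval (inner ℝ x.1 y.1) : ℝ) : ℂ) :=
    Complex.continuous_ofReal.comp (continuous_eval_inner _ _)
  have h1 : ∫ y, (((bump n).eval (inner ℝ x.1 y.1) : ℝ) : ℂ) * f y ∂surfaceMeasure - f x =
      ∫ y, (((bump n).eval (inner ℝ x.1 y.1) : ℝ) : ℂ) * (f y - f x) ∂surfaceMeasure := by
    have hi : ∀ {g : S2 → ℂ}, Continuous g → Integrable (fun y : S2 =>
        (((bump n).eval (inner ℝ x.1 y.1) : ℝ) : ℂ) * g y) surfaceMeasure := fun hg =>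
      integrable_of_continuous (hc.mul hg)
    simp only [mul_sub]
    rw [integral_sub (hi hf) (hi (g := fun _ => f x) continuous_const), integral_mul_const,
      integral_complex_ofReal, integral_eval_inner, heightIntegral_bump]
    simp
  rw [dist_eq_norm, h1]
  refine (norm_integral_le_integral_norm _).trans_lt ?_
  refine lt_of_le_of_lt (le_of_eq ?_) ((hn x).trans_lt (by linarith))
  refine integral_congr_ae (Eventually.of_forall fun y => ?_)
  simp only [norm_mul, Complex.norm_real, Real.norm_eq_abs, abs_norm]
  rw [abs_of_nonneg (bump_nonneg n (inner_mem_Icc x y).1)]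

/-! ### The Funk-Hecke formula -/

/-- Both sides are linear in `p`, so Legendre polynomials suffice: for degrees other than `l` both
sides vanish by orthogonality, and for degree `l` they coincide. The remaining integral against
`P_l` is identified in `reproducing`. -/
theorem integral_poly_mul_mul (l : ℕ) {f : S2 → ℂ} (hf : IsHarmonicOfDegree l f) (x : S2)
    (p : Polynomial ℝ) :
    (∫ y, ((p.eval (inner ℝ x.1 y.1) : ℝ) : ℂ) * f y ∂surfaceMeasure) *
        (heightIntegral (legendre l * legendre l) : ℝ) =
      (heightIntegral (p * legendre l) : ℝ) *
        ∫ y, (((legendre l).eval (inner ℝ x.1 y.1) : ℝ) : ℂ) * f y ∂surfaceMeasure := by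
  have hint : ∀ q : Polynomial ℝ,
      Integrable (fun y => ((q.eval (inner ℝ x.1 y.1) : ℝ) : ℂ) * f y) surfaceMeasure := fun q =>
    integrable_of_continuous
      ((Complex.continuous_ofReal.comp (continuous_eval_inner _ _)).mul hf.continuous)
  have hp : p ∈ Submodule.span ℝ (Set.range legendre) := by rw [span_legendre]; trivial
  induction hp using Submodule.span_induction with
  | mem q hq =>
    obtain ⟨k, rfl⟩ := hq
    by_cases hk : k = l
    · subst hk; ring
    · rw [(isHarmonicOfDegree_legendre k x).integral_mul_eq_zero hk hf,
        heightIntegral_legendre_mul_legendre hk]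
      simp
  | zero => simp
  | add q r _ _ hq hr =>
    simp only [Polynomial.eval_add, Complex.ofReal_add, add_mul, map_add]
    rw [integral_add (hint q) (hint r), add_mul, hq, hr]
  | smul c q _ hq =>
    simp only [Polynomial.eval_smul, smul_eq_mul, Complex.ofReal_mul, mul_assoc, smul_mul_assoc,
      map_smul]
    rw [integral_const_mul, mul_assoc, hq]

theorem heightIntegral_legendre_sq_pos (l : ℕ) :
    0 < heightIntegral (legendre l * legendre l) := by
  rw [heightIntegral_legendre_sq]
  have := Real.pi_pos
  positivity

theorem tendsto_heightIntegral_bump_mul (p : Polynomial ℝ) :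
    Tendsto (fun n => heightIntegral (bump n * p)) atTop (𝓝 (p.eval 1)) := by
  have h := tendsto_integral_bump_mul (f := fun y => ((p.eval (inner ℝ pole.1 y.1) : ℝ) : ℂ))
    (Complex.continuous_ofReal.comp (continuous_eval_inner _ _)) pole
  rw [inner_self_S2] at h
  refine (Complex.continuous_re.tendsto _).comp h |>.congr fun n => ?_
  simp only [Function.comp, inner_pole, ← Complex.ofReal_mul, ← Polynomial.eval_mul]
  rw [integral_complex_ofReal, Complex.ofReal_re, heightIntegral_apply]

/-- `integral_poly_mul_mul` is applied to the bumps. Concentration at `x` turns the left side into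
`f x` times the squared norm of `P_l`, and the coefficient on the right into `P_l(1) = 1`. -/
theorem IsHarmonicOfDegree.reproducing {l : ℕ} {f : S2 → ℂ} (hf : IsHarmonicOfDegree l f)
    (x : S2) :
    ∫ y, (((legendre l).eval (inner ℝ x.1 y.1) : ℝ) : ℂ) * f y ∂surfaceMeasure =
      (heightIntegral (legendre l * legendre l) : ℝ) * f x := by
  have h1 := (tendsto_integral_bump_mul hf.continuous x).mul_const
    ((heightIntegral (legendre l * legendre l) : ℝ) : ℂ)
  simp only [integral_poly_mul_mul l hf x] at h1
  have h2 := ((Complex.continuous_ofReal.tendsto _).comp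
    (tendsto_heightIntegral_bump_mul (legendre l))).mul_const
    (∫ y, (((legendre l).eval (inner ℝ x.1 y.1) : ℝ) : ℂ) * f y ∂surfaceMeasure)
  have h3 := tendsto_nhds_unique h1 h2
  rw [legendre_eval_one] at h3
  simp only [Complex.ofReal_one, one_mul] at h3
  rw [← h3]; ring

theorem IsHarmonicOfDegree.funk_hecke_polynomial {l : ℕ} {f : S2 → ℂ}
    (hf : IsHarmonicOfDegree l f) (x : S2) (p : Polynomial ℝ) :
    ∫ y, ((p.eval (inner ℝ x.1 y.1) : ℝ) : ℂ) * f y ∂surfaceMeasure =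
      (heightIntegral (p * legendre l) : ℝ) * f x := by
  have h := integral_poly_mul_mul l hf x p
  rw [hf.reproducing] at h
  have h0 : ((heightIntegral (legendre l * legendre l) : ℝ) : ℂ) ≠ 0 :=
    Complex.ofReal_ne_zero.2 (heightIntegral_legendre_sq_pos l).ne'
  refine mul_right_cancel₀ h0 ?_
  rw [h]; ring

theorem height_mem_Icc (y : S2) : y.1 2 ∈ Set.Icc (-1 : ℝ) 1 := by
  rw [← inner_pole]; exact inner_mem_Icc _ _

/-- Bounded continuous functions are dense in `L¹` of the distribution of the height, and
Weierstrass approximates them on `[-1, 1]`. Approximation in `L¹` is what a merely measurable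
covariance allows. -/
theorem exists_polynomial_integral_sub_le {κ : ℝ → ℝ} (hκ : Measurable κ) {M : ℝ}
    (hM : ∀ t, |κ t| ≤ M) {ε : ℝ} (hε : 0 < ε) :
    ∃ p : Polynomial ℝ, ∫ y : S2, |κ (y.1 2) - p.eval (y.1 2)| ∂surfaceMeasure ≤ ε := by
  have hm : Measurable fun y : S2 => y.1 2 := continuous_height.measurable
  set ν : Measure ℝ := surfaceMeasure.map fun y : S2 => y.1 2 with hν
  have : IsFiniteMeasure ν := Measure.isFiniteMeasure_map _ _
  have hi : Integrable κ ν := Integrable.of_bound hκ.aestronglyMeasurable M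
    (Eventually.of_forall hM)
  obtain ⟨g, hg, hgi⟩ := hi.exists_boundedContinuous_integral_sub_le (half_pos hε)
  have hpi := Real.pi_pos
  obtain ⟨p, hp⟩ := exists_polynomial_near_of_continuousOn (-1) 1 g g.continuous.continuousOn
    (ε / (8 * Real.pi)) (by positivity)
  refine ⟨p, ?_⟩
  have hg' : ∫ y : S2, ‖κ (y.1 2) - g (y.1 2)‖ ∂surfaceMeasure ≤ ε / 2 := by
    refine le_trans (le_of_eq ?_) hg
    exact (integral_map (f := fun t => ‖κ t - g t‖) hm.aemeasurable
      (hκ.sub g.continuous.measurable).norm.aestronglyMeasurable).symm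
  have hb : ∀ y : S2, |κ (y.1 2) - p.eval (y.1 2)| ≤ ‖κ (y.1 2) - g (y.1 2)‖ +
      ε / (8 * Real.pi) := by
    intro y
    have h1 := hp _ (height_mem_Icc y)
    rw [abs_sub_comm] at h1
    rw [Real.norm_eq_abs]
    have := abs_sub_le (κ (y.1 2)) (g (y.1 2)) (p.eval (y.1 2))
    linarith
  have hi1 : Integrable (fun y : S2 => κ (y.1 2)) surfaceMeasure :=
    (integrable_map_measure hκ.aestronglyMeasurable hm.aemeasurable).1 hi
  have hi2 : Integrable (fun y : S2 => g (y.1 2)) surfaceMeasure :=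
    integrable_of_continuous (g.continuous.comp continuous_height)
  calc _ ≤ ∫ y : S2, (‖κ (y.1 2) - g (y.1 2)‖ + ε / (8 * Real.pi)) ∂surfaceMeasure :=
        integral_mono (hi1.sub (integrable_eval_height p)).abs
          ((hi1.sub hi2).norm.add (integrable_const _)) hb
    _ ≤ ε := by
        have hi3 : Integrable (fun y : S2 => ‖κ (y.1 2) - g (y.1 2)‖) surfaceMeasure :=
          (hi1.sub hi2).norm
        rw [integral_add hi3 (integrable_const _), integral_const,
          surfaceMeasure_real_univ, smul_eq_mul]
        have : 4 * Real.pi * (ε / (8 * Real.pi)) = ε / 2 := by field_simp; norm_num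
        rw [this]
        linarith

/-- The coefficients of the expansion of a function of the height in Legendre polynomials. -/
def zonalCoeff (κ : ℝ → ℝ) (l : ℕ) : ℝ :=
  ∫ y : S2, κ (y.1 2) * (legendre l).eval (y.1 2) ∂surfaceMeasure

/-- The Funk-Hecke formula. -/
theorem IsHarmonicOfDegree.funk_hecke {l : ℕ} {f : S2 → ℂ} (hf : IsHarmonicOfDegree l f)
    {κ : ℝ → ℝ} (hκ : Measurable κ) {M : ℝ} (hM : ∀ t, |κ t| ≤ M) (x : S2) :
    ∫ y, (κ (inner ℝ x.1 y.1) : ℂ) * f y ∂surfaceMeasure = (zonalCoeff κ l : ℝ) * f x := by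
  obtain ⟨A, hA⟩ := isCompact_univ.exists_bound_of_continuousOn hf.continuous.continuousOn
  obtain ⟨A', hA'⟩ := isCompact_univ.exists_bound_of_continuousOn
    ((legendre l).continuous.comp continuous_height).continuousOn
  have hA0 : 0 ≤ A := (norm_nonneg _).trans (hA pole (Set.mem_univ _))
  have hA0' : 0 ≤ A' := (norm_nonneg _).trans (hA' pole (Set.mem_univ _))
  have hi : ∀ x : S2, Integrable (fun y : S2 => κ (inner ℝ x.1 y.1)) surfaceMeasure := fun x =>
    Integrable.of_bound (hκ.comp (continuous_inner_S2 x).measurable).aestronglyMeasurable M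
      (Eventually.of_forall fun y => hM _)
  have hip : ∀ x : S2, ∀ p : Polynomial ℝ,
      Integrable (fun y : S2 => p.eval (inner ℝ x.1 y.1)) surfaceMeasure := fun x p =>
    integrable_of_continuous (continuous_eval_inner p x)
  rw [← sub_eq_zero, ← norm_le_zero_iff]
  refine le_of_forall_pos_le_add fun ε hε => ?_
  -- Replacing `κ` by `p` costs at most `A` times the `L¹` error in the integral and `A' * A` times
  -- it in the coefficient term, where `A` bounds `f` and `A'` bounds `P_l`.
  obtain ⟨p, hp⟩ := exists_polynomial_integral_sub_le hκ hM
    (ε := ε / (A + A' * A + 1)) (by positivity)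
  have h1 : ‖∫ y, (κ (inner ℝ x.1 y.1) : ℂ) * f y ∂surfaceMeasure -
      ∫ y, ((p.eval (inner ℝ x.1 y.1) : ℝ) : ℂ) * f y ∂surfaceMeasure‖ ≤
      A * (ε / (A + A' * A + 1)) := by
    have hI : ∀ {h : S2 → ℝ}, Integrable h surfaceMeasure →
        Integrable (fun y => (h y : ℂ) * f y) surfaceMeasure := fun hh =>
      hh.ofReal.mul_bdd hf.continuous.aestronglyMeasurable
        (Eventually.of_forall fun y => hA y (Set.mem_univ _))
    rw [← integral_sub (hI (hi x)) (hI (hip x p))]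
    refine (norm_integral_le_of_norm_le (((hi x).sub (hip x p)).abs.const_mul A)
      (Eventually.of_forall fun y => ?_)).trans ?_
    · rw [← sub_mul, ← Complex.ofReal_sub, norm_mul, Complex.norm_real, Real.norm_eq_abs, mul_comm]
      exact mul_le_mul_of_nonneg_right (hA y (Set.mem_univ _)) (abs_nonneg _)
    · rw [integral_const_mul]
      refine mul_le_mul_of_nonneg_left ?_ hA0
      refine le_trans (le_of_eq ?_) hp
      exact integral_inner (fun t => |κ t - p.eval t|) x
  have h2 : |zonalCoeff κ l - heightIntegral (p * legendre l)| ≤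
      A' * (ε / (A + A' * A + 1)) := by
    have hi' := hi pole
    have hip' := hip pole p
    simp only [inner_pole] at hi' hip'
    rw [zonalCoeff, heightIntegral_apply]
    simp only [Polynomial.eval_mul]
    have hI : ∀ {h : S2 → ℝ}, Integrable h surfaceMeasure →
        Integrable (fun y => h y * (legendre l).eval (y.1 2)) surfaceMeasure := fun hh =>
      hh.mul_bdd ((legendre l).continuous.comp continuous_height).aestronglyMeasurable
        (Eventually.of_forall fun y => hA' y (Set.mem_univ _))
    rw [← integral_sub (hI hi') (hI hip'), ← Real.norm_eq_abs]
    refine (norm_integral_le_of_norm_le ((hi'.sub hip').abs.const_mul A')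
      (Eventually.of_forall fun y => ?_)).trans ?_
    · rw [← sub_mul, norm_mul, Real.norm_eq_abs, mul_comm]
      exact mul_le_mul_of_nonneg_right (hA' y (Set.mem_univ _)) (abs_nonneg _)
    · rw [integral_const_mul]
      exact mul_le_mul_of_nonneg_left hp hA0'
  have h3 := hf.funk_hecke_polynomial x p
  have h4 : ∫ y, (κ (inner ℝ x.1 y.1) : ℂ) * f y ∂surfaceMeasure - (zonalCoeff κ l : ℝ) * f x =
      (∫ y, (κ (inner ℝ x.1 y.1) : ℂ) * f y ∂surfaceMeasure -
        ∫ y, ((p.eval (inner ℝ x.1 y.1) : ℝ) : ℂ) * f y ∂surfaceMeasure) -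
      ((zonalCoeff κ l - heightIntegral (p * legendre l) : ℝ) : ℂ) * f x := by
    rw [h3]; push_cast; ring
  rw [h4]
  refine (norm_sub_le _ _).trans ?_
  rw [norm_mul, Complex.norm_real, Real.norm_eq_abs]
  have h5 : |zonalCoeff κ l - heightIntegral (p * legendre l)| * ‖f x‖ ≤
      A' * (ε / (A + A' * A + 1)) * A :=
    mul_le_mul h2 (hA x (Set.mem_univ _)) (norm_nonneg _) (by positivity)
  have h6 : A * (ε / (A + A' * A + 1)) + A' * (ε / (A + A' * A + 1)) * A ≤ ε := by
    have : A * (ε / (A + A' * A + 1)) + A' * (ε / (A + A' * A + 1)) * A =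
        ε * ((A + A' * A) / (A + A' * A + 1)) := by ring
    rw [this]
    refine mul_le_of_le_one_right hε.le ?_
    rw [div_le_one (by positivity)]
    linarith
  linarith

theorem integral_mul_legendre {κ : ℝ → ℝ} (hκ : Measurable κ) {M : ℝ} (hM : ∀ t, |κ t| ≤ M)
    (l : ℕ) (x z : S2) :
    ∫ y, κ (inner ℝ x.1 y.1) * (legendre l).eval (inner ℝ z.1 y.1) ∂surfaceMeasure =
      zonalCoeff κ l * (legendre l).eval (inner ℝ z.1 x.1) := by
  have h := (isHarmonicOfDegree_legendre l z).funk_hecke hκ hM x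
  simp only [← Complex.ofReal_mul] at h
  rw [integral_complex_ofReal] at h
  exact_mod_cast h

theorem integral_legendre_mul_legendre (k l : ℕ) (x z : S2) :
    ∫ y, (legendre k).eval (inner ℝ x.1 y.1) * (legendre l).eval (inner ℝ z.1 y.1)
      ∂surfaceMeasure =
      if k = l then 4 * Real.pi / (2 * l + 1) * (legendre l).eval (inner ℝ z.1 x.1) else 0 := by
  have h := (isHarmonicOfDegree_legendre l z).funk_hecke_polynomial x (legendre k)
  simp only [← Complex.ofReal_mul] at h
  rw [integral_complex_ofReal] at h
  have h' : ∫ y, (legendre k).eval (inner ℝ x.1 y.1) * (legendre l).eval (inner ℝ z.1 y.1)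
      ∂surfaceMeasure = heightIntegral (legendre k * legendre l) *
        (legendre l).eval (inner ℝ z.1 x.1) := by exact_mod_cast h
  rw [h']
  split_ifs with hkl
  · rw [hkl, heightIntegral_legendre_sq]
  · rw [heightIntegral_legendre_mul_legendre hkl, zero_mul]

/-- By the reproducing identity `4π/(2l+1) P_l(⟨z, x⟩)` is the `L²` product of two zonal functions,
each of squared norm `4π/(2l+1)`. -/
theorem abs_legendre_le_one (l : ℕ) (x z : S2) :
    |(legendre l).eval (inner ℝ z.1 x.1)| ≤ 1 := by
  have h := integral_legendre_mul_legendre l l x z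
  rw [if_pos rfl] at h
  have hpi := Real.pi_pos
  have hN : 0 < 4 * Real.pi / (2 * l + 1) := by positivity
  have hsq : ∀ w : S2, ∫ y, (legendre l).eval (inner ℝ w.1 y.1) ^ 2 ∂surfaceMeasure =
      4 * Real.pi / (2 * l + 1) := by
    intro w
    have := integral_legendre_mul_legendre l l w w
    rw [if_pos rfl, inner_self_S2, legendre_eval_one, mul_one] at this
    rw [← this]
    exact integral_congr_ae (Eventually.of_forall fun y => sq _)
  have hc : ∀ w : S2, Continuous fun y : S2 => (legendre l).eval (inner ℝ w.1 y.1) :=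
    continuous_eval_inner _
  have hb : |4 * Real.pi / (2 * l + 1) * (legendre l).eval (inner ℝ z.1 x.1)| ≤
      4 * Real.pi / (2 * l + 1) := by
    rw [← h, ← Real.norm_eq_abs]
    refine (norm_integral_le_of_norm_le (g := fun y : S2 =>
      ((legendre l).eval (inner ℝ x.1 y.1) ^ 2 + (legendre l).eval (inner ℝ z.1 y.1) ^ 2) *
        (1 / 2 : ℝ)) (integrable_of_continuous
      ((((hc x).pow 2).add ((hc z).pow 2)).mul continuous_const))
      (Eventually.of_forall fun y => ?_)).trans ?_
    · rw [norm_mul, Real.norm_eq_abs, Real.norm_eq_abs, ← sq_abs ((legendre l).eval _),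
        ← sq_abs ((legendre l).eval (inner ℝ z.1 y.1))]
      nlinarith [sq_nonneg (|(legendre l).eval (inner ℝ x.1 y.1)| -
        |(legendre l).eval (inner ℝ z.1 y.1)|)]
    · have hi : ∀ w : S2, Integrable (fun y : S2 => (legendre l).eval (inner ℝ w.1 y.1) ^ 2)
          surfaceMeasure := fun w => integrable_of_continuous ((hc w).pow 2)
      rw [integral_mul_const, integral_add (hi x) (hi z), hsq, hsq]
      linarith
  rw [abs_mul, abs_of_pos hN] at hb
  exact le_of_mul_le_mul_left (by linarith) hN

theorem sq_integral_mul_le {α : Type*} [MeasurableSpace α] {μ : Measure α} {f g : α → ℝ}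
    (hf : MemLp f 2 μ) (hg : MemLp g 2 μ) :
    (∫ a, f a * g a ∂μ) ^ 2 ≤ (∫ a, f a ^ 2 ∂μ) * ∫ a, g a ^ 2 ∂μ := by
  have hfg : Integrable (fun a => f a * g a) μ := hf.integrable_mul hg
  have h := discrim_le_zero (a := ∫ a, g a ^ 2 ∂μ) (b := 2 * ∫ a, f a * g a ∂μ)
    (c := ∫ a, f a ^ 2 ∂μ) fun t => by
      have h0 : 0 ≤ ∫ a, (f a + t * g a) ^ 2 ∂μ := integral_nonneg fun a => sq_nonneg _
      have h1 : ∀ a, (f a + t * g a) ^ 2 = f a ^ 2 + (2 * t) * (f a * g a) + t ^ 2 * g a ^ 2 :=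
        fun a => by ring
      simp only [h1] at h0
      have hi : Integrable (fun a => f a ^ 2 + (2 * t) * (f a * g a)) μ :=
        hf.integrable_sq.add (hfg.const_mul _)
      rw [integral_add hi (hg.integrable_sq.const_mul _),
        integral_add hf.integrable_sq (hfg.const_mul _), integral_const_mul,
        integral_const_mul] at h0
      linarith
  rw [discrim] at h
  linarith

/-! ### Second order isotropic fields -/

/-- A jointly measurable, square integrable field with rotationally invariant second moments. -/
structure IsSecondOrderIsotropic {Ω : Type*} [MeasurableSpace Ω] (P : Measure Ω)
    (T : S2 → Ω → ℝ) : Prop where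
  measurable : Measurable fun p : S2 × Ω => T p.1 p.2
  memLp : ∀ x, MemLp (T x) 2 P
  invariant : ∀ (g : SO3) (x y : S2),
    ∫ ω, T (rotate g x) ω * T (rotate g y) ω ∂P = ∫ ω, T x ω * T y ω ∂P

/-- The covariance of the field as a function of the inner product of the two points. -/
def covFn {Ω : Type*} [MeasurableSpace Ω] (P : Measure Ω) (T : S2 → Ω → ℝ) (t : ℝ) : ℝ :=
  ∫ ω, T pole ω * T (meridian (Set.projIcc (-1) 1 (by norm_num) t)) ω ∂P

namespace IsSecondOrderIsotropic

variable {Ω : Type*} [MeasurableSpace Ω] {P : Measure Ω}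
  {T : S2 → Ω → ℝ}

theorem measurable_left (hT : IsSecondOrderIsotropic P T) (x : S2) : Measurable (T x) :=
  hT.measurable.comp measurable_prodMk_left

theorem integral_mul (hT : IsSecondOrderIsotropic P T) (x y : S2) :
    ∫ ω, T x ω * T y ω ∂P = covFn P T (inner ℝ x.1 y.1) := by
  obtain ⟨g, hx, hy⟩ := exists_rotate_pole_meridian x y
  rw [covFn, Set.projIcc_of_mem _ (inner_mem_Icc x y), ← hT.invariant g pole, hx, hy]

theorem integral_sq (hT : IsSecondOrderIsotropic P T) (x : S2) :
    ∫ ω, T x ω ^ 2 ∂P = covFn P T 1 := by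
  rw [← inner_self_S2 x, ← hT.integral_mul]
  exact integral_congr_ae (Eventually.of_forall fun ω => sq _)

theorem covFn_one_nonneg (hT : IsSecondOrderIsotropic P T) : 0 ≤ covFn P T 1 := by
  rw [← hT.integral_sq pole]
  exact integral_nonneg fun ω => sq_nonneg _

theorem abs_covFn_le (hT : IsSecondOrderIsotropic P T) (t : ℝ) : |covFn P T t| ≤ covFn P T 1 := by
  refine abs_le_of_sq_le_sq ?_ hT.covFn_one_nonneg
  refine (sq_integral_mul_le (hT.memLp _) (hT.memLp _)).trans (le_of_eq ?_)
  rw [hT.integral_sq, hT.integral_sq, sq]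

theorem measurable_covFn [IsProbabilityMeasure P] (hT : IsSecondOrderIsotropic P T) :
    Measurable (covFn P T) := by
  have hm : Continuous meridian := by
    refine Continuous.subtype_mk ?_ _
    fun_prop
  have h : Measurable fun p : ℝ × Ω =>
      T pole p.2 * T (meridian (Set.projIcc (-1) 1 (by norm_num) p.1)) p.2 := by
    have h1 : Measurable fun p : ℝ × Ω =>
        (meridian (Set.projIcc (-1) 1 (by norm_num) p.1), p.2) :=
      ((hm.comp continuous_projIcc).measurable.comp measurable_fst).prodMk measurable_snd
    exact ((hT.measurable_left pole).comp measurable_snd).mul (hT.measurable.comp h1)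
  exact (h.stronglyMeasurable.integral_prod_right').measurable

theorem integrable_mul (hT : IsSecondOrderIsotropic P T) (x y : S2) :
    Integrable (fun ω => T x ω * T y ω) P :=
  (hT.memLp x).integrable_mul (hT.memLp y)

theorem integrable_sq_prod [IsProbabilityMeasure P] (hT : IsSecondOrderIsotropic P T) :
    Integrable (fun p : S2 × Ω => T p.1 p.2 ^ 2) (surfaceMeasure.prod P) := by
  rw [integrable_prod_iff (hT.measurable.pow_const 2).aestronglyMeasurable]
  refine ⟨Eventually.of_forall fun x => (hT.memLp x).integrable_sq, ?_⟩
  simp only [norm_pow, Real.norm_eq_abs, sq_abs, hT.integral_sq]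
  exact integrable_const _

theorem measurable_right (hT : IsSecondOrderIsotropic P T) (ω : Ω) : Measurable fun x => T x ω :=
  hT.measurable.comp measurable_prodMk_right

theorem ae_memLp [IsProbabilityMeasure P] (hT : IsSecondOrderIsotropic P T) :
    ∀ᵐ ω ∂P, MemLp (fun x => T x ω) 2 surfaceMeasure := by
  filter_upwards [hT.integrable_sq_prod.prod_left_ae] with ω hω
  exact (memLp_two_iff_integrable_sq (hT.measurable_right ω).aestronglyMeasurable).2 hω

end IsSecondOrderIsotropic

theorem memLp_of_continuous {h : S2 → ℝ} (hh : Continuous h) : MemLp h 2 surfaceMeasure :=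
  (memLp_two_iff_integrable_sq hh.aestronglyMeasurable).2 (integrable_of_continuous (hh.pow 2))

/-- The integral of the field against a function. -/
def pairing {Ω : Type*} (T : S2 → Ω → ℝ) (h : S2 → ℝ) (ω : Ω) : ℝ :=
  ∫ x, T x ω * h x ∂surfaceMeasure

namespace IsSecondOrderIsotropic

variable {Ω : Type*} [MeasurableSpace Ω] {P : Measure Ω}
  {T : S2 → Ω → ℝ}

theorem measurable_pairing (hT : IsSecondOrderIsotropic P T) {h : S2 → ℝ} (hh : Continuous h) :
    Measurable (pairing T h) := by
  have : Measurable fun p : Ω × S2 => T p.2 p.1 * h p.2 :=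
    (hT.measurable.comp measurable_swap).mul (hh.measurable.comp measurable_snd)
  exact (this.stronglyMeasurable.integral_prod_right').measurable

theorem memLp_pairing [IsProbabilityMeasure P] (hT : IsSecondOrderIsotropic P T)
    {h : S2 → ℝ} (hh : Continuous h) :
    MemLp (pairing T h) 2 P := by
  rw [memLp_two_iff_integrable_sq (hT.measurable_pairing hh).aestronglyMeasurable]
  refine Integrable.mono' (hT.integrable_sq_prod.integral_prod_right.mul_const
    (∫ x, h x ^ 2 ∂surfaceMeasure))
    ((hT.measurable_pairing hh).pow_const 2).aestronglyMeasurable ?_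
  filter_upwards [hT.ae_memLp] with ω hω
  rw [Real.norm_eq_abs, abs_of_nonneg (sq_nonneg _)]
  exact sq_integral_mul_le hω (memLp_of_continuous hh)

theorem integral_mul_pairing [IsProbabilityMeasure P] (hT : IsSecondOrderIsotropic P T)
    {h : S2 → ℝ} (hh : Continuous h)
    {X : Ω → ℝ} (hX : MemLp X 2 P) :
    ∫ ω, X ω * pairing T h ω ∂P = ∫ x, (∫ ω, X ω * T x ω ∂P) * h x ∂surfaceMeasure := by
  obtain ⟨A, hA⟩ := isCompact_univ.exists_bound_of_continuousOn hh.continuousOn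
  have hA0 : 0 ≤ A := (norm_nonneg _).trans (hA pole (Set.mem_univ _))
  have hint : Integrable (fun p : S2 × Ω => X p.2 * T p.1 p.2 * h p.1)
      (surfaceMeasure.prod P) := by
    have hXp : Integrable (fun p : S2 × Ω => X p.2 ^ 2) (surfaceMeasure.prod P) :=
      hX.integrable_sq.comp_snd surfaceMeasure
    refine Integrable.mono' ((hXp.add hT.integrable_sq_prod).mul_const A)
      ((hX.aestronglyMeasurable.comp_snd.mul hT.measurable.aestronglyMeasurable).mul
        hh.aestronglyMeasurable.comp_fst) (Eventually.of_forall fun p => ?_)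
    rw [norm_mul, norm_mul, Real.norm_eq_abs, Real.norm_eq_abs]
    refine mul_le_mul ?_ (hA _ (Set.mem_univ _)) (norm_nonneg _) (by simp; positivity)
    simp only [Pi.add_apply]
    nlinarith [sq_nonneg (|X p.2| - |T p.1 p.2|), sq_abs (X p.2), sq_abs (T p.1 p.2),
      sq_nonneg (X p.2), sq_nonneg (T p.1 p.2)]
  have h1 := integral_integral_swap (μ := surfaceMeasure) (ν := P)
    (f := fun x ω => X ω * T x ω * h x) hint
  simp only [integral_mul_const] at h1
  rw [h1]
  refine integral_congr_ae (Eventually.of_forall fun ω => ?_)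
  simp only [pairing, mul_assoc, integral_const_mul]

theorem integral_pairing_mul_pairing [IsProbabilityMeasure P] (hT : IsSecondOrderIsotropic P T)
    {h h' : S2 → ℝ}
    (hh : Continuous h) (hh' : Continuous h') :
    ∫ ω, pairing T h ω * pairing T h' ω ∂P =
      ∫ x, (∫ y, covFn P T (inner ℝ x.1 y.1) * h y ∂surfaceMeasure) * h' x ∂surfaceMeasure := by
  rw [hT.integral_mul_pairing hh' (hT.memLp_pairing hh)]
  refine integral_congr_ae (Eventually.of_forall fun x => ?_)
  simp only
  congr 1
  simp only [mul_comm (pairing T h _)]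
  rw [hT.integral_mul_pairing hh (hT.memLp x)]
  simp only [hT.integral_mul]

/-! ### The angular power spectrum -/

/-- The second moment of a pairing is the quadratic form of the covariance operator, which by
Funk-Hecke acts on `f`, and on its real and imaginary parts, as the scalar `zonalCoeff`. -/
theorem integral_norm_sq_complex_pairing [IsProbabilityMeasure P] (hT : IsSecondOrderIsotropic P T)
    {l : ℕ} {f : S2 → ℂ}
    (hf : IsHarmonicOfDegree l f) :
    ∫ ω, ‖∫ x, (T x ω : ℂ) * f x ∂surfaceMeasure‖ ^ 2 ∂P =
      zonalCoeff (covFn P T) l * ∫ x, ‖f x‖ ^ 2 ∂surfaceMeasure := by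
  have hre : Continuous fun x => (f x).re := Complex.continuous_re.comp hf.continuous
  have him : Continuous fun x => (f x).im := Complex.continuous_im.comp hf.continuous
  have hmul : ∀ (h : S2 → ℝ), Integrable h surfaceMeasure →
      Integrable (fun x => (h x : ℂ) * f x) surfaceMeasure := by
    intro h hh
    obtain ⟨A, hA⟩ := isCompact_univ.exists_bound_of_continuousOn hf.continuous.continuousOn
    exact hh.ofReal.mul_bdd hf.continuous.aestronglyMeasurable
      (Eventually.of_forall fun y => hA y (Set.mem_univ _))
  have hsplit : ∀ (h : S2 → ℝ), Integrable h surfaceMeasure →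
      (∫ x, (h x : ℂ) * f x ∂surfaceMeasure).re = ∫ x, h x * (f x).re ∂surfaceMeasure ∧
      (∫ x, (h x : ℂ) * f x ∂surfaceMeasure).im = ∫ x, h x * (f x).im ∂surfaceMeasure := by
    intro h hh
    constructor
    · have := integral_re (hmul h hh)
      simpa using this.symm
    · have := integral_im (hmul h hh)
      simpa using this.symm
  have h1 : ∫ ω, ‖∫ x, (T x ω : ℂ) * f x ∂surfaceMeasure‖ ^ 2 ∂P =
      ∫ ω, (pairing T (fun x => (f x).re) ω * pairing T (fun x => (f x).re) ω +
        pairing T (fun x => (f x).im) ω * pairing T (fun x => (f x).im) ω) ∂P := by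
    refine integral_congr_ae ?_
    filter_upwards [hT.ae_memLp] with ω hω
    obtain ⟨e1, e2⟩ := hsplit _ (hω.integrable one_le_two)
    rw [← Complex.normSq_eq_norm_sq, Complex.normSq_apply, e1, e2, pairing, pairing]
  have hcov : ∀ x : S2, Integrable (fun y : S2 => covFn P T (inner ℝ x.1 y.1)) surfaceMeasure :=
    fun x => Integrable.of_bound
      (hT.measurable_covFn.comp (continuous_inner_S2 x).measurable).aestronglyMeasurable
      (covFn P T 1) (Eventually.of_forall fun y => hT.abs_covFn_le _)
  have hfh : ∀ x : S2,
      ∫ y, covFn P T (inner ℝ x.1 y.1) * (f y).re ∂surfaceMeasure =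
        zonalCoeff (covFn P T) l * (f x).re ∧
      ∫ y, covFn P T (inner ℝ x.1 y.1) * (f y).im ∂surfaceMeasure =
        zonalCoeff (covFn P T) l * (f x).im := by
    intro x
    have h := hf.funk_hecke hT.measurable_covFn hT.abs_covFn_le x
    obtain ⟨e1, e2⟩ := hsplit _ (hcov x)
    rw [← e1, ← e2, h]
    simp
  have hi : ∀ {h : S2 → ℝ}, Continuous h →
      Integrable (fun ω => pairing T h ω * pairing T h ω) P := fun hh =>
    (hT.memLp_pairing hh).integrable_mul (hT.memLp_pairing hh)
  rw [h1, integral_add (hi hre) (hi him),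
    hT.integral_pairing_mul_pairing hre hre, hT.integral_pairing_mul_pairing him him]
  simp only [(hfh _).1, (hfh _).2]
  rw [← integral_add (integrable_of_continuous (by fun_prop))
    (integrable_of_continuous (by fun_prop)), ← integral_const_mul]
  refine integral_congr_ae (Eventually.of_forall fun x => ?_)
  simp only
  rw [← Complex.normSq_eq_norm_sq, Complex.normSq_apply]
  ring

/-- Only the modulus matters. As `T` is real, the coefficient is the conjugate of the pairing with
`Y_{l,|m|}` when `0 ≤ m`, and the pairing itself up to sign when `m < 0`. This also shows that `C_l`
does not depend on `m`. -/
theorem integral_norm_fourierCoeff_sq [IsProbabilityMeasure P] (hT : IsSecondOrderIsotropic P T)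
    {l : ℕ} {m : ℤ}
    (hm : |m| ≤ (l : ℤ)) :
    ∫ ω, ‖fourierCoeff T l m ω‖ ^ 2 ∂P = zonalCoeff (covFn P T) l := by
  have hm' : m.natAbs ≤ l := by
    rw [Int.abs_eq_natAbs] at hm; exact_mod_cast hm
  have h := hT.integral_norm_sq_complex_pairing
    (isHarmonicOfDegree_sphericalHarmonicNonneg l m.natAbs)
  rw [integral_norm_sphericalHarmonicNonneg_sq hm', mul_one] at h
  rw [← h]
  refine integral_congr_ae (Eventually.of_forall fun ω => ?_)
  simp only
  congr 1
  unfold fourierCoeff sphericalHarmonic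
  split_ifs with h0
  · rw [← RCLike.norm_conj (∫ x, (T x ω : ℂ) * _ ∂surfaceMeasure), ← integral_conj]
    simp
  · simp only [map_mul, Complex.conj_conj, mul_left_comm ((T _ ω : ℝ) : ℂ)]
    rw [integral_const_mul, norm_mul]
    simp

theorem zonalCoeff_nonneg [IsProbabilityMeasure P] (hT : IsSecondOrderIsotropic P T) (l : ℕ) :
    0 ≤ zonalCoeff (covFn P T) l := by
  rw [← hT.integral_norm_fourierCoeff_sq (l := l) (m := 0) (by simp)]
  exact integral_nonneg fun ω => by positivity

end IsSecondOrderIsotropic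

/-! ### Mean square oscillation of square integrable functions -/

theorem integrable_bump_mul_fst (n : ℕ) {u : S2 → ℝ} (hu : Integrable u surfaceMeasure) :
    Integrable (fun p : S2 × S2 => (bump n).eval (inner ℝ p.1.1 p.2.1) * u p.1)
      (surfaceMeasure.prod surfaceMeasure) := by
  have hc : Continuous fun p : S2 × S2 => (bump n).eval (inner ℝ p.1.1 p.2.1) :=
    (bump n).continuous.comp continuous_inner_S2_prod
  obtain ⟨A, hA⟩ := isCompact_univ.exists_bound_of_continuousOn hc.continuousOn
  exact (hu.comp_fst surfaceMeasure).bdd_mul hc.aestronglyMeasurable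
    (Eventually.of_forall fun p => hA p (Set.mem_univ _))

theorem integral_bump_mul_fst (n : ℕ) {u : S2 → ℝ} (hu : Integrable u surfaceMeasure) :
    ∫ p : S2 × S2, (bump n).eval (inner ℝ p.1.1 p.2.1) * u p.1
      ∂(surfaceMeasure.prod surfaceMeasure) = ∫ x, u x ∂surfaceMeasure := by
  rw [integral_prod _ (integrable_bump_mul_fst n hu)]
  simp only [integral_mul_const, integral_eval_inner, heightIntegral_bump, one_mul]

theorem integrable_bump_mul_snd (n : ℕ) {u : S2 → ℝ} (hu : Integrable u surfaceMeasure) :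
    Integrable (fun p : S2 × S2 => (bump n).eval (inner ℝ p.1.1 p.2.1) * u p.2)
      (surfaceMeasure.prod surfaceMeasure) := by
  have h := (integrable_bump_mul_fst n hu).swap
  refine h.congr (Eventually.of_forall fun p => ?_)
  simp [Function.comp, real_inner_comm]

theorem integral_bump_mul_snd (n : ℕ) {u : S2 → ℝ} (hu : Integrable u surfaceMeasure) :
    ∫ p : S2 × S2, (bump n).eval (inner ℝ p.1.1 p.2.1) * u p.2
      ∂(surfaceMeasure.prod surfaceMeasure) = ∫ x, u x ∂surfaceMeasure := by
  rw [← integral_bump_mul_fst n hu, ← integral_prod_swap]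
  simp [real_inner_comm]

theorem bump_inner_nonneg (n : ℕ) (x y : S2) : 0 ≤ (bump n).eval (inner ℝ x.1 y.1) :=
  bump_nonneg n (inner_mem_Icc x y).1

/-- The mean square oscillation of a function at the scale of the approximate identity. -/
def meanOscillation (n : ℕ) (f : S2 → ℝ) : ℝ :=
  ∫ p : S2 × S2, (bump n).eval (inner ℝ p.1.1 p.2.1) * (f p.1 - f p.2) ^ 2
    ∂(surfaceMeasure.prod surfaceMeasure)

theorem meanOscillation_nonneg (n : ℕ) (f : S2 → ℝ) : 0 ≤ meanOscillation n f :=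
  integral_nonneg fun p => mul_nonneg (bump_inner_nonneg n p.1 p.2) (sq_nonneg _)

theorem integrable_bump_mul_sub_sq (n : ℕ) {f : S2 → ℝ} (hf : MemLp f 2 surfaceMeasure) :
    Integrable (fun p : S2 × S2 => (bump n).eval (inner ℝ p.1.1 p.2.1) * (f p.1 - f p.2) ^ 2)
      (surfaceMeasure.prod surfaceMeasure) := by
  have hc : Continuous fun p : S2 × S2 => (bump n).eval (inner ℝ p.1.1 p.2.1) :=
    (bump n).continuous.comp continuous_inner_S2_prod
  refine Integrable.mono' (((integrable_bump_mul_fst n hf.integrable_sq).add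
    (integrable_bump_mul_snd n hf.integrable_sq)).const_mul 2)
    (hc.aestronglyMeasurable.mul
      ((hf.aestronglyMeasurable.comp_fst.sub hf.aestronglyMeasurable.comp_snd).pow 2))
    (Eventually.of_forall fun p => ?_)
  have hb := bump_inner_nonneg n p.1 p.2
  rw [Real.norm_eq_abs, abs_of_nonneg (by positivity)]
  simp only [Pi.add_apply]
  nlinarith [mul_nonneg hb (sq_nonneg (f p.1 + f p.2))]

theorem meanOscillation_le (n : ℕ) {f : S2 → ℝ} (hf : MemLp f 2 surfaceMeasure) :
    meanOscillation n f ≤ 4 * ∫ x, f x ^ 2 ∂surfaceMeasure := by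
  have hi := (integrable_bump_mul_fst n hf.integrable_sq).add
    (integrable_bump_mul_snd n hf.integrable_sq)
  calc _ ≤ ∫ p : S2 × S2, 2 * ((bump n).eval (inner ℝ p.1.1 p.2.1) * f p.1 ^ 2 +
        (bump n).eval (inner ℝ p.1.1 p.2.1) * f p.2 ^ 2)
        ∂(surfaceMeasure.prod surfaceMeasure) := by
        refine integral_mono (integrable_bump_mul_sub_sq n hf) (hi.const_mul 2) fun p => ?_
        have hb := bump_inner_nonneg n p.1 p.2
        simp only
        nlinarith [mul_nonneg hb (sq_nonneg (f p.1 + f p.2))]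
    _ = _ := by
        rw [integral_const_mul, integral_add (integrable_bump_mul_fst n hf.integrable_sq)
          (integrable_bump_mul_snd n hf.integrable_sq),
          integral_bump_mul_fst n hf.integrable_sq, integral_bump_mul_snd n hf.integrable_sq]
        ring

/-- Approximate `f` in `L²` by a continuous `g`: the oscillation of `f - g` is controlled by its
norm uniformly in `n`, and that of `g` vanishes by uniform continuity. -/
theorem tendsto_meanOscillation {f : S2 → ℝ} (hf : MemLp f 2 surfaceMeasure) :
    Tendsto (fun n => meanOscillation n f) atTop (𝓝 0) := by
  rw [Metric.tendsto_nhds]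
  intro ε hε
  have hpi := Real.pi_pos
  have hf' : MemLp f (ENNReal.ofReal 2) surfaceMeasure := by simpa using hf
  -- The final bound is `2 (4 · ε/16 + ε/8) = 3ε/4`, which is below `ε`.
  obtain ⟨g, hg, hg2⟩ := hf'.exists_boundedContinuous_integral_rpow_sub_le two_pos
    (ε := ε / 16) (by positivity)
  have hgc : Continuous fun x => g x := g.continuous
  have hr : MemLp (fun x => f x - g x) 2 surfaceMeasure :=
    hf.sub (by simpa using hg2)
  have hg' : ∫ x, (f x - g x) ^ 2 ∂surfaceMeasure ≤ ε / 16 := by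
    refine le_trans (le_of_eq ?_) hg
    refine integral_congr_ae (Eventually.of_forall fun x => ?_)
    simp
  filter_upwards [eventually_integral_bump_mul_le (w := fun p => (g p.1 - g p.2) ^ 2)
    (by fun_prop) (by simp) (ε / (32 * Real.pi)) (by positivity)] with n hn
  have hwi : Integrable (fun p : S2 × S2 => (bump n).eval (inner ℝ p.1.1 p.2.1) *
      (g p.1 - g p.2) ^ 2) (surfaceMeasure.prod surfaceMeasure) :=
    integrable_bump_mul_sub_sq n (f := fun x => g x) (by simpa using hg2)
  have h1 : meanOscillation n (fun x => g x) ≤ ε / 8 := by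
    rw [meanOscillation, integral_prod _ hwi]
    calc _ ≤ ∫ _ : S2, ε / (32 * Real.pi) ∂surfaceMeasure := by
          refine integral_mono hwi.integral_prod_left (integrable_const _) fun x => ?_
          refine le_trans (le_of_eq ?_) (hn x)
          refine integral_congr_ae (Eventually.of_forall fun y => ?_)
          simp
      _ = ε / 8 := by
          rw [integral_const, surfaceMeasure_real_univ, smul_eq_mul]
          field_simp
          norm_num
  have h2 := meanOscillation_le n hr
  have h3 : meanOscillation n f ≤
      2 * (meanOscillation n (fun x => f x - g x) + meanOscillation n fun x => g x) := by
    unfold meanOscillation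
    rw [← integral_add (integrable_bump_mul_sub_sq n hr) hwi, ← integral_const_mul]
    refine integral_mono (integrable_bump_mul_sub_sq n hf)
      (((integrable_bump_mul_sub_sq n hr).add hwi).const_mul 2) fun p => ?_
    have hb := bump_inner_nonneg n p.1 p.2
    simp only
    nlinarith [mul_nonneg hb (sq_nonneg (((f p.1 - g p.1) - (f p.2 - g p.2)) -
      (g p.1 - g p.2)))]
  rw [Real.dist_eq, sub_zero, abs_of_nonneg (meanOscillation_nonneg n f)]
  linarith

/-- The sum of the reproducing kernels of degree less than `L`. -/
def reproducingSum (L : ℕ) (x y : S2) : ℝ :=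
  ∑ l ∈ Finset.range L,
    (2 * (l : ℝ) + 1) / (4 * Real.pi) * (legendre l).eval (inner ℝ x.1 y.1)

theorem continuous_reproducingSum (L : ℕ) (x : S2) : Continuous (reproducingSum L x) := by
  unfold reproducingSum
  exact continuous_finsetSum _ fun l _ => continuous_const.mul (continuous_eval_inner _ _)

/-! ### Mean square continuity and the Legendre expansion of the covariance -/

namespace IsSecondOrderIsotropic

variable {Ω : Type*} [MeasurableSpace Ω] {P : Measure Ω} {T : S2 → Ω → ℝ}

theorem integral_sub_sq (hT : IsSecondOrderIsotropic P T) (x y : S2) :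
    ∫ ω, (T x ω - T y ω) ^ 2 ∂P = 2 * (covFn P T 1 - covFn P T (inner ℝ x.1 y.1)) := by
  have h1 : ∀ ω, (T x ω - T y ω) ^ 2 = T x ω ^ 2 + T y ω ^ 2 - 2 * (T x ω * T y ω) :=
    fun ω => by ring
  have hi : Integrable (fun ω => T x ω ^ 2 + T y ω ^ 2) P :=
    (hT.memLp x).integrable_sq.add (hT.memLp y).integrable_sq
  simp only [h1]
  rw [integral_sub hi ((hT.integrable_mul x y).const_mul 2),
    integral_add (hT.memLp x).integrable_sq (hT.memLp y).integrable_sq, integral_const_mul,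
    hT.integral_sq, hT.integral_sq, hT.integral_mul]
  ring

theorem integrable_covFn_mul [IsProbabilityMeasure P] (hT : IsSecondOrderIsotropic P T)
    {h : S2 → ℝ} (hh : Continuous h) (x : S2) :
    Integrable (fun y : S2 => covFn P T (inner ℝ x.1 y.1) * h y) surfaceMeasure := by
  obtain ⟨A, hA⟩ := isCompact_univ.exists_bound_of_continuousOn hh.continuousOn
  exact Integrable.mul_bdd (c := A) (Integrable.of_bound
    (hT.measurable_covFn.comp (continuous_inner_S2 x).measurable).aestronglyMeasurable
    (covFn P T 1) (Eventually.of_forall fun p => hT.abs_covFn_le _))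
    hh.aestronglyMeasurable (Eventually.of_forall fun p => hA p (Set.mem_univ _))

theorem integrable_bump_mul_covFn [IsProbabilityMeasure P] (hT : IsSecondOrderIsotropic P T)
    (n : ℕ) : Integrable (fun p : S2 × S2 => (bump n).eval (inner ℝ p.1.1 p.2.1) *
      (2 * (covFn P T 1 - covFn P T (inner ℝ p.1.1 p.2.1))))
      (surfaceMeasure.prod surfaceMeasure) := by
  have hcm : Measurable fun p : S2 × S2 => covFn P T (inner ℝ p.1.1 p.2.1) :=
    hT.measurable_covFn.comp continuous_inner_S2_prod.measurable
  have hbc : Continuous fun p : S2 × S2 => (bump n).eval (inner ℝ p.1.1 p.2.1) :=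
    (bump n).continuous.comp continuous_inner_S2_prod
  obtain ⟨A, hA⟩ := isCompact_univ.exists_bound_of_continuousOn hbc.continuousOn
  refine Integrable.bdd_mul (c := A) ?_ hbc.aestronglyMeasurable
    (Eventually.of_forall fun p => hA p (Set.mem_univ _))
  refine ((integrable_const _).sub ?_).const_mul 2
  exact Integrable.of_bound hcm.aestronglyMeasurable (covFn P T 1)
    (Eventually.of_forall fun p => hT.abs_covFn_le _)

theorem integrable_bump_mul_sub_sq_prod [IsProbabilityMeasure P]
    (hT : IsSecondOrderIsotropic P T) (n : ℕ) :
    Integrable (fun q : (S2 × S2) × Ω =>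
      (bump n).eval (inner ℝ q.1.1.1 q.1.2.1) * (T q.1.1 q.2 - T q.1.2 q.2) ^ 2)
      ((surfaceMeasure.prod surfaceMeasure).prod P) := by
  have hbc : Continuous fun p : S2 × S2 => (bump n).eval (inner ℝ p.1.1 p.2.1) :=
    (bump n).continuous.comp continuous_inner_S2_prod
  have h1 : Measurable fun q : (S2 × S2) × Ω => T q.1.1 q.2 :=
    hT.measurable.comp ((measurable_fst.comp measurable_fst).prodMk measurable_snd)
  have h2 : Measurable fun q : (S2 × S2) × Ω => T q.1.2 q.2 :=
    hT.measurable.comp ((measurable_snd.comp measurable_fst).prodMk measurable_snd)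
  have hm : Measurable fun q : (S2 × S2) × Ω =>
      (bump n).eval (inner ℝ q.1.1.1 q.1.2.1) * (T q.1.1 q.2 - T q.1.2 q.2) ^ 2 :=
    (hbc.measurable.comp measurable_fst).mul ((h1.sub h2).pow_const 2)
  rw [integrable_prod_iff hm.aestronglyMeasurable]
  have hsq : ∀ p : S2 × S2, Integrable (fun ω => (T p.1 ω - T p.2 ω) ^ 2) P := fun p =>
    ((hT.memLp p.1).sub (hT.memLp p.2)).integrable_sq
  refine ⟨Eventually.of_forall fun p => (hsq p).const_mul ((bump n).eval (inner ℝ p.1.1 p.2.1)), ?_⟩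
  refine (hT.integrable_bump_mul_covFn n).congr (Eventually.of_forall fun p => ?_)
  simp only [norm_mul, norm_pow, Real.norm_eq_abs, sq_abs, integral_const_mul, hT.integral_sub_sq,
    abs_of_nonneg (bump_inner_nonneg n p.1 p.2)]

theorem integral_bump_mul_covFn [IsProbabilityMeasure P] (hT : IsSecondOrderIsotropic P T)
    (n : ℕ) (x : S2) :
    ∫ y, (bump n).eval (inner ℝ x.1 y.1) *
        (2 * (covFn P T 1 - covFn P T (inner ℝ x.1 y.1))) ∂surfaceMeasure =
      2 * (covFn P T 1 -
        ∫ y : S2, covFn P T (y.1 2) * (bump n).eval (y.1 2) ∂surfaceMeasure) := by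
  have h1 : ∀ y : S2, (bump n).eval (inner ℝ x.1 y.1) *
      (2 * (covFn P T 1 - covFn P T (inner ℝ x.1 y.1))) =
      2 * covFn P T 1 * (bump n).eval (inner ℝ x.1 y.1) -
        2 * (covFn P T (inner ℝ x.1 y.1) * (bump n).eval (inner ℝ x.1 y.1)) := fun y => by ring
  simp only [h1]
  rw [integral_sub ((integrable_of_continuous (continuous_eval_inner _ _)).const_mul _)
    ((hT.integrable_covFn_mul (continuous_eval_inner _ x) x).const_mul 2),
    integral_const_mul, integral_const_mul, integral_eval_inner, heightIntegral_bump,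
    integral_inner (fun t => covFn P T t * (bump n).eval t) x]
  ring

theorem integral_meanOscillation [IsProbabilityMeasure P] (hT : IsSecondOrderIsotropic P T)
    (n : ℕ) :
    ∫ ω, meanOscillation n (fun x => T x ω) ∂P = 8 * Real.pi * (covFn P T 1 -
      ∫ y : S2, covFn P T (y.1 2) * (bump n).eval (y.1 2) ∂surfaceMeasure) := by
  unfold meanOscillation
  rw [← integral_integral_swap (μ := surfaceMeasure.prod surfaceMeasure) (ν := P)
    (f := fun p ω => (bump n).eval (inner ℝ p.1.1 p.2.1) * (T p.1 ω - T p.2 ω) ^ 2)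
    (hT.integrable_bump_mul_sub_sq_prod n)]
  simp only [integral_const_mul, hT.integral_sub_sq]
  rw [integral_prod _ (hT.integrable_bump_mul_covFn n)]
  simp only [hT.integral_bump_mul_covFn]
  rw [integral_const, surfaceMeasure_real_univ, smul_eq_mul]
  ring

/-- Here joint measurability takes the place of continuity of `κ` at `1`. Almost every path is in
`L²` of the sphere, so its oscillation tends to zero, dominated by four times its squared norm. The
expected oscillation is `8π` times the gap between `κ(1)` and the smoothed value. -/
theorem tendsto_integral_covFn_mul_bump [IsProbabilityMeasure P]
    (hT : IsSecondOrderIsotropic P T) :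
    Tendsto (fun n => ∫ y : S2, covFn P T (y.1 2) * (bump n).eval (y.1 2) ∂surfaceMeasure) atTop
      (𝓝 (covFn P T 1)) := by
  have hlim : Tendsto (fun n => ∫ ω, meanOscillation n (fun x => T x ω) ∂P) atTop
      (𝓝 (∫ _, 0 ∂P)) := by
    refine tendsto_integral_of_dominated_convergence
      (fun ω => 4 * ∫ x, T x ω ^ 2 ∂surfaceMeasure)
      (fun n => (hT.integrable_bump_mul_sub_sq_prod n).integral_prod_right.aestronglyMeasurable)
      (hT.integrable_sq_prod.integral_prod_right.const_mul 4) (fun n => ?_) ?_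
    · filter_upwards [hT.ae_memLp] with ω hω
      rw [Real.norm_eq_abs, abs_of_nonneg (meanOscillation_nonneg n _)]
      exact meanOscillation_le n hω
    · filter_upwards [hT.ae_memLp] with ω hω
      exact tendsto_meanOscillation hω
  simp only [hT.integral_meanOscillation, integral_zero] at hlim
  have h2 := (hlim.const_mul (1 / (8 * Real.pi))).const_sub (covFn P T 1)
  rw [mul_zero, sub_zero] at h2
  refine h2.congr fun n => ?_
  have := Real.pi_ne_zero
  field_simp
  ring

theorem integral_covFn_mul_reproducingSum [IsProbabilityMeasure P]
    (hT : IsSecondOrderIsotropic P T) (L : ℕ) (x y : S2) :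
    ∫ z, covFn P T (inner ℝ x.1 z.1) * reproducingSum L y z ∂surfaceMeasure =
      ∑ l ∈ Finset.range L, (2 * (l : ℝ) + 1) / (4 * Real.pi) * zonalCoeff (covFn P T) l *
        (legendre l).eval (inner ℝ y.1 x.1) := by
  simp only [reproducingSum, Finset.mul_sum]
  rw [integral_finsetSum]
  · refine Finset.sum_congr rfl fun l _ => ?_
    simp only [mul_left_comm (covFn P T _)]
    rw [integral_const_mul, integral_mul_legendre hT.measurable_covFn hT.abs_covFn_le, mul_assoc]
  · intro l _
    exact hT.integrable_covFn_mul (continuous_const.mul (continuous_eval_inner _ _)) x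

theorem integral_mul_pairing_reproducingSum [IsProbabilityMeasure P]
    (hT : IsSecondOrderIsotropic P T) (L : ℕ) (x y : S2) :
    ∫ ω, T x ω * pairing T (reproducingSum L y) ω ∂P =
      ∑ l ∈ Finset.range L, (2 * (l : ℝ) + 1) / (4 * Real.pi) * zonalCoeff (covFn P T) l *
        (legendre l).eval (inner ℝ y.1 x.1) := by
  rw [hT.integral_mul_pairing (continuous_reproducingSum L y) (hT.memLp x)]
  simp only [hT.integral_mul]
  exact hT.integral_covFn_mul_reproducingSum L x y

theorem integral_pairing_reproducingSum_sq [IsProbabilityMeasure P]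
    (hT : IsSecondOrderIsotropic P T) (L : ℕ) (x : S2) :
    ∫ ω, pairing T (reproducingSum L x) ω * pairing T (reproducingSum L x) ω ∂P =
      ∑ l ∈ Finset.range L, (2 * (l : ℝ) + 1) / (4 * Real.pi) * zonalCoeff (covFn P T) l := by
  rw [hT.integral_pairing_mul_pairing (continuous_reproducingSum L x)
    (continuous_reproducingSum L x)]
  simp only [hT.integral_covFn_mul_reproducingSum]
  simp only [reproducingSum, Finset.sum_mul_sum]
  have hi : ∀ l k : ℕ, Integrable (fun y : S2 => (2 * (l : ℝ) + 1) / (4 * Real.pi) *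
      zonalCoeff (covFn P T) l * (legendre l).eval (inner ℝ x.1 y.1) *
      ((2 * (k : ℝ) + 1) / (4 * Real.pi) * (legendre k).eval (inner ℝ x.1 y.1)))
      surfaceMeasure := fun l k => integrable_of_continuous
    ((continuous_const.mul (continuous_eval_inner _ _)).mul
      (continuous_const.mul (continuous_eval_inner _ _)))
  rw [integral_finsetSum _ fun l _ => integrable_finsetSum _ fun k _ => hi l k]
  refine Finset.sum_congr rfl fun l hl => ?_
  rw [integral_finsetSum _ fun k _ => hi l k]
  have h1 : ∀ k : ℕ, ∫ y : S2, (2 * (l : ℝ) + 1) / (4 * Real.pi) *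
      zonalCoeff (covFn P T) l * (legendre l).eval (inner ℝ x.1 y.1) *
      ((2 * (k : ℝ) + 1) / (4 * Real.pi) * (legendre k).eval (inner ℝ x.1 y.1)) ∂surfaceMeasure =
      if l = k then (2 * (l : ℝ) + 1) / (4 * Real.pi) * zonalCoeff (covFn P T) l else 0 := by
    intro k
    simp only [mul_mul_mul_comm _ ((legendre l).eval _)]
    rw [integral_const_mul, integral_legendre_mul_legendre]
    split_ifs with hkl
    · subst hkl
      rw [inner_self_S2, legendre_eval_one]
      have := Real.pi_ne_zero
      have h2 : 2 * (l : ℝ) + 1 ≠ 0 := by positivity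
      field_simp
    · simp
  simp only [h1, Finset.sum_ite_eq, hl, if_true]

/-- The cross term and the second moment of the truncated multipole expansion are the same partial
sum, as for an orthogonal projection. -/
theorem integral_sub_pairing_sq [IsProbabilityMeasure P]
    (hT : IsSecondOrderIsotropic P T) (L : ℕ) (x : S2) :
    ∫ ω, (T x ω - pairing T (reproducingSum L x) ω) ^ 2 ∂P = covFn P T 1 -
      ∑ l ∈ Finset.range L, (2 * (l : ℝ) + 1) / (4 * Real.pi) * zonalCoeff (covFn P T) l := by
  have hp := hT.memLp_pairing (continuous_reproducingSum L x)
  have h1 : ∀ ω, (T x ω - pairing T (reproducingSum L x) ω) ^ 2 =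
      T x ω ^ 2 - 2 * (T x ω * pairing T (reproducingSum L x) ω) +
        pairing T (reproducingSum L x) ω * pairing T (reproducingSum L x) ω := fun ω => by ring
  have hi1 : Integrable (fun ω => T x ω * pairing T (reproducingSum L x) ω) P :=
    (hT.memLp x).integrable_mul hp
  have hi2 : Integrable (fun ω => pairing T (reproducingSum L x) ω *
      pairing T (reproducingSum L x) ω) P := hp.integrable_mul hp
  have hi3 : Integrable (fun ω => T x ω ^ 2 - 2 * (T x ω * pairing T (reproducingSum L x) ω)) P :=
    (hT.memLp x).integrable_sq.sub (hi1.const_mul 2)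
  simp only [h1]
  rw [integral_add hi3 hi2,
    integral_sub (hT.memLp x).integrable_sq (hi1.const_mul 2), integral_const_mul,
    hT.integral_sq, hT.integral_mul_pairing_reproducingSum,
    hT.integral_pairing_reproducingSum_sq]
  simp only [inner_self_S2, legendre_eval_one, mul_one]
  ring

theorem sum_zonalCoeff_le [IsProbabilityMeasure P] (hT : IsSecondOrderIsotropic P T) (L : ℕ) :
    ∑ l ∈ Finset.range L, (2 * (l : ℝ) + 1) / (4 * Real.pi) * zonalCoeff (covFn P T) l ≤
      covFn P T 1 := by
  have h := hT.integral_sub_pairing_sq L pole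
  have h0 : 0 ≤ ∫ ω, (T pole ω - pairing T (reproducingSum L pole) ω) ^ 2 ∂P :=
    integral_nonneg fun ω => sq_nonneg _
  linarith

theorem mul_zonalCoeff_nonneg [IsProbabilityMeasure P] (hT : IsSecondOrderIsotropic P T) (l : ℕ) :
    0 ≤ (2 * (l : ℝ) + 1) / (4 * Real.pi) * zonalCoeff (covFn P T) l :=
  mul_nonneg (by have := Real.pi_pos; positivity) (hT.zonalCoeff_nonneg l)

theorem summable_zonalCoeff [IsProbabilityMeasure P] (hT : IsSecondOrderIsotropic P T) :
    Summable fun l : ℕ => (2 * (l : ℝ) + 1) / (4 * Real.pi) * zonalCoeff (covFn P T) l :=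
  summable_of_sum_range_le hT.mul_zonalCoeff_nonneg hT.sum_zonalCoeff_le

/-- The bump is nonnegative with mass one and `P_k ≤ 1`, so its Legendre coefficients are at most
`(2k+1)/(4π)`, those of a point mass. As the spectrum is nonnegative, the bound passes to the sum
term by term. -/
theorem integral_covFn_mul_bump_le [IsProbabilityMeasure P] (hT : IsSecondOrderIsotropic P T)
    (n : ℕ) :
    ∫ y : S2, covFn P T (y.1 2) * (bump n).eval (y.1 2) ∂surfaceMeasure ≤
      ∑' l : ℕ, (2 * (l : ℝ) + 1) / (4 * Real.pi) * zonalCoeff (covFn P T) l := by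
  have hmem : bump n ∈ Submodule.span ℝ (Set.range legendre) := by rw [span_legendre]; trivial
  obtain ⟨c, hc⟩ := (Finsupp.mem_span_range_iff_exists_finsupp).1 hmem
  rw [Finsupp.sum] at hc
  have hpi := Real.pi_pos
  have hcb : ∀ k ∈ c.support, c k ≤ (2 * (k : ℝ) + 1) / (4 * Real.pi) := by
    intro k hk
    have h1 : heightIntegral (bump n * legendre k) = c k * (4 * Real.pi / (2 * k + 1)) := by
      rw [← hc, Finset.sum_mul, map_sum, Finset.sum_eq_single k]
      · rw [smul_mul_assoc, map_smul, heightIntegral_legendre_sq, smul_eq_mul]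
      · intro j _ hj
        rw [smul_mul_assoc, map_smul, heightIntegral_legendre_mul_legendre hj, smul_zero]
      · exact fun h => absurd hk h
    have h2 : heightIntegral (bump n * legendre k) ≤ heightIntegral (bump n) := by
      refine integral_mono (integrable_eval_height _) (integrable_eval_height _) fun y => ?_
      rw [← inner_pole, Polynomial.eval_mul]
      exact mul_le_of_le_one_right (bump_inner_nonneg n pole y)
        ((le_abs_self _).trans (abs_legendre_le_one k y pole))
    rw [heightIntegral_bump, h1] at h2
    rw [le_div_iff₀ (by positivity)]
    have h3 : (0 : ℝ) < 2 * k + 1 := by positivity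
    rw [mul_div_assoc', div_le_one h3] at h2
    exact h2
  have hsum : ∫ y : S2, covFn P T (y.1 2) * (bump n).eval (y.1 2) ∂surfaceMeasure =
      ∑ k ∈ c.support, c k * zonalCoeff (covFn P T) k := by
    rw [← hc]
    simp only [Polynomial.eval_finsetSum, Polynomial.eval_smul, smul_eq_mul, Finset.mul_sum,
      mul_left_comm (covFn P T _)]
    rw [integral_finsetSum]
    · simp only [integral_const_mul, zonalCoeff]
    · intro k _
      have h := hT.integrable_covFn_mul (continuous_eval_inner (legendre k) pole) pole
      simp only [inner_pole] at h
      exact h.const_mul _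
  rw [hsum]
  calc _ ≤ ∑ k ∈ c.support, (2 * (k : ℝ) + 1) / (4 * Real.pi) * zonalCoeff (covFn P T) k :=
        Finset.sum_le_sum fun k hk =>
          mul_le_mul_of_nonneg_right (hcb k hk) (hT.zonalCoeff_nonneg k)
    _ ≤ _ := hT.summable_zonalCoeff.sum_le_tsum _ fun k _ => hT.mul_zonalCoeff_nonneg k

/-- An isotropic, square integrable and jointly measurable field is continuous in mean square:
its variance is the sum of the variances of its multipole components. -/
theorem hasSum_zonalCoeff [IsProbabilityMeasure P] (hT : IsSecondOrderIsotropic P T) :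
    HasSum (fun l : ℕ => (2 * (l : ℝ) + 1) / (4 * Real.pi) * zonalCoeff (covFn P T) l)
      (covFn P T 1) := by
  have h1 : ∑' l : ℕ, (2 * (l : ℝ) + 1) / (4 * Real.pi) * zonalCoeff (covFn P T) l =
      covFn P T 1 := by
    refine le_antisymm (hT.summable_zonalCoeff.tsum_le_of_sum_range_le hT.sum_zonalCoeff_le) ?_
    exact le_of_tendsto' hT.tendsto_integral_covFn_mul_bump hT.integral_covFn_mul_bump_le
  rw [← h1]
  exact hT.summable_zonalCoeff.hasSum

theorem summable_norm_zonalCoeff_mul_legendre [IsProbabilityMeasure P]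
    (hT : IsSecondOrderIsotropic P T) (x y : S2) :
    Summable fun l : ℕ => ‖(2 * (l : ℝ) + 1) / (4 * Real.pi) * zonalCoeff (covFn P T) l *
      (legendre l).eval (inner ℝ y.1 x.1)‖ := by
  refine Summable.of_nonneg_of_le (fun l => norm_nonneg _) (fun l => ?_) hT.summable_zonalCoeff
  rw [norm_mul, Real.norm_eq_abs, Real.norm_eq_abs, abs_of_nonneg (hT.mul_zonalCoeff_nonneg l)]
  exact mul_le_of_le_one_right (hT.mul_zonalCoeff_nonneg l) (abs_legendre_le_one l x y)

/-- The expansion of the covariance in Legendre polynomials. -/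
theorem hasSum_covFn_inner [IsProbabilityMeasure P] (hT : IsSecondOrderIsotropic P T)
    (x y : S2) :
    HasSum (fun l : ℕ => (2 * (l : ℝ) + 1) / (4 * Real.pi) * zonalCoeff (covFn P T) l *
      (legendre l).eval (inner ℝ y.1 x.1)) (covFn P T (inner ℝ x.1 y.1)) := by
  rw [(hT.summable_norm_zonalCoeff_mul_legendre x y).of_norm.hasSum_iff_tendsto_nat]
  -- The truncation error is the covariance of `T x` with the remainder of `T y`. By Cauchy-Schwarz
  -- it is bounded through the variance of the remainder, which tends to zero by
  -- `hasSum_zonalCoeff`.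
  have hb : ∀ L : ℕ, |∑ l ∈ Finset.range L, (2 * (l : ℝ) + 1) / (4 * Real.pi) *
      zonalCoeff (covFn P T) l * (legendre l).eval (inner ℝ y.1 x.1) -
      covFn P T (inner ℝ x.1 y.1)| ≤ Real.sqrt (covFn P T 1 * (covFn P T 1 -
      ∑ l ∈ Finset.range L, (2 * (l : ℝ) + 1) / (4 * Real.pi) * zonalCoeff (covFn P T) l)) := by
    intro L
    have hp := hT.memLp_pairing (continuous_reproducingSum L y)
    have h1 := sq_integral_mul_le (hT.memLp x) ((hT.memLp y).sub hp)
    simp only [Pi.sub_apply, mul_sub] at h1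
    have hi : Integrable (fun ω => T x ω * pairing T (reproducingSum L y) ω) P :=
      (hT.memLp x).integrable_mul hp
    rw [integral_sub (hT.integrable_mul x y) hi, hT.integral_mul,
      hT.integral_mul_pairing_reproducingSum, hT.integral_sq, hT.integral_sub_pairing_sq] at h1
    rw [abs_sub_comm]
    exact Real.abs_le_sqrt h1
  rw [tendsto_iff_norm_sub_tendsto_zero]
  refine squeeze_zero (fun L => norm_nonneg _) hb ?_
  have h2 := ((hT.hasSum_zonalCoeff.tendsto_sum_nat.const_sub (covFn P T 1)).const_mul
    (covFn P T 1)).sqrt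
  simpa using h2

end IsSecondOrderIsotropic

/-! ### The spherical Laplace operator on zonal functions -/

theorem iteratedFDeriv_two_eq_of_hasDerivAt {E : Type*} [NormedAddCommGroup E] [NormedSpace ℝ E]
    {F : E → ℝ} {x v : E} (hF : ContDiffAt ℝ 2 F x) {φ' : ℝ → ℝ} {c : ℝ}
    (h1 : ∀ᶠ s in 𝓝 (0 : ℝ), HasDerivAt (fun s : ℝ => F (x + s • v)) (φ' s) s)
    (h2 : HasDerivAt φ' c 0) : iteratedFDeriv ℝ 2 F x ![v, v] = c := by
  rw [iteratedFDeriv_two_apply]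
  simp only [Matrix.cons_val_zero, Matrix.cons_val_one]
  have hline : ∀ s : ℝ, HasDerivAt (fun s : ℝ => x + s • v) v s := fun s => by
    simpa using ((hasDerivAt_id s).smul_const v).const_add x
  have hcont : Tendsto (fun s : ℝ => x + s • v) (𝓝 0) (𝓝 x) := by
    have := (hline 0).continuousAt.tendsto
    simpa using this
  have hev : ∀ᶠ y in 𝓝 x, DifferentiableAt ℝ F y := by
    filter_upwards [hF.eventually (by simp)] with y hy
    exact hy.differentiableAt (by norm_num)
  have hφ : φ' =ᶠ[𝓝 0] fun s => fderiv ℝ F (x + s • v) v := by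
    filter_upwards [h1, hcont.eventually hev] with s hs hd
    exact hs.unique (hd.hasFDerivAt.comp_hasDerivAt s (hline s))
  have hd2 : DifferentiableAt ℝ (fderiv ℝ F) x :=
    (hF.fderiv_right (m := 1) (by norm_num)).differentiableAt (by norm_num)
  have h3 : HasDerivAt (fun s : ℝ => fderiv ℝ F (x + s • v) v) (fderiv ℝ (fderiv ℝ F) x v v) 0 := by
    have h4 : HasFDerivAt (fderiv ℝ F) (fderiv ℝ (fderiv ℝ F) x) (x + (0 : ℝ) • v) := by
      simpa using hd2.hasFDerivAt
    have h5 := h4.comp_hasDerivAt (0 : ℝ) (hline 0)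
    exact h5.clm_apply (hasDerivAt_const _ _) |>.congr_deriv (by simp)
  exact h3.unique (h2.congr_of_eventuallyEq hφ.symm)

theorem contDiff_eval_inner (p : Polynomial ℝ) (w : E3) (n : WithTop ℕ∞) :
    ContDiff ℝ n fun y : E3 => p.eval (inner ℝ w y) := by
  have h : ContDiff ℝ n fun t : ℝ => p.eval t := by
    simpa using p.contDiff_aeval (𝕜 := ℝ) n
  exact h.comp (contDiff_const.inner ℝ contDiff_id)

open Polynomial in
-- Along the line `x + s e_i` the radially constant extension is `p((t + s w_i) / |x + s e_i|)`, a
-- function of one variable. The three second derivatives at `s = 0` add up to Legendre's operator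
-- because `|w| = |x| = 1`.
theorem sphericalLaplacian_eval_inner (p : ℝ[X]) (w x : S2) :
    sphericalLaplacian (fun y => p.eval (inner ℝ w.1 y)) x =
      ((1 - X ^ 2) * derivative (derivative p) - 2 * X * derivative p).eval
        (inner ℝ w.1 x.1) := by
  set t : ℝ := inner ℝ w.1 x.1 with ht
  have hx0 : x.1 ≠ 0 := fun h => by
    have := mem_sphere_zero_iff_norm.1 x.2
    rw [h, norm_zero] at this
    exact zero_ne_one this
  have hF : ContDiffAt ℝ 2 (fun y : E3 => p.eval (inner ℝ w.1 (‖y‖⁻¹ • y))) x.1 := by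
    have h1 : ContDiffAt ℝ 2 (fun y : E3 => ‖y‖⁻¹ • y) x.1 :=
      ((contDiffAt_norm ℝ hx0).inv (norm_ne_zero_iff.2 hx0)).smul contDiffAt_id
    exact (contDiff_eval_inner p w.1 2).contDiffAt.comp x.1 h1
  have key : ∀ i : Fin 3, iteratedFDeriv ℝ 2 (fun y : E3 => p.eval (inner ℝ w.1 (‖y‖⁻¹ • y))) x.1
      ![EuclideanSpace.basisFun (Fin 3) ℝ i, EuclideanSpace.basisFun (Fin 3) ℝ i] =
      (derivative (derivative p)).eval t * (w.1 i - t * x.1 i) ^ 2 +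
        (derivative p).eval t * (-2 * w.1 i * x.1 i + t * (3 * x.1 i ^ 2 - 1)) := by
    intro i
    set e : E3 := EuclideanSpace.basisFun (Fin 3) ℝ i with he
    have hwe : inner ℝ w.1 e = w.1 i := by
      rw [he, EuclideanSpace.basisFun_apply, EuclideanSpace.inner_single_right]; simp
    have hxe : inner ℝ x.1 e = x.1 i := by
      rw [he, EuclideanSpace.basisFun_apply, EuclideanSpace.inner_single_right]; simp
    have hee : ‖e‖ = 1 := by rw [he]; exact (EuclideanSpace.basisFun (Fin 3) ℝ).norm_eq_one i
    -- `q s` is the squared norm of `x + s e`, and `r s` the reciprocal of the norm.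
    let q : ℝ → ℝ := fun s => 1 + 2 * s * x.1 i + s ^ 2
    let r : ℝ → ℝ := fun s => (Real.sqrt (q s))⁻¹
    have hq0 : q 0 = 1 := by simp [q]
    have hr0 : r 0 = 1 := by simp [r, hq0]
    have hxi : x.1 i ^ 2 ≤ 1 := by
      have h1 := abs_real_inner_le_norm x.1 e
      rw [hxe, hee, mem_sphere_zero_iff_norm.1 x.2, mul_one] at h1
      exact (sq_le_one_iff_abs_le_one _).2 h1
    have hqnn : ∀ s, 0 ≤ q s := fun s => by
      simp only [q]
      nlinarith [sq_nonneg (s + x.1 i)]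
    have hqpos : ∀ᶠ s in 𝓝 (0 : ℝ), 0 < q s := by
      have hc : Continuous q := by fun_prop
      exact hc.continuousAt.eventually (lt_mem_nhds (by rw [hq0]; exact one_pos))
    have hnorm : ∀ s : ℝ, ‖x.1 + s • e‖ = Real.sqrt (q s) := by
      intro s
      rw [eq_comm, Real.sqrt_eq_iff_eq_sq (hqnn s) (norm_nonneg _), @norm_add_sq_real,
        inner_smul_right, hxe, norm_smul, hee, mem_sphere_zero_iff_norm.1 x.2, mul_one,
        Real.norm_eq_abs, sq_abs]
      simp only [q]
      ring
    have hr : ∀ s : ℝ, 0 < q s → HasDerivAt r (-(x.1 i + s) * r s ^ 3) s := by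
      intro s hs
      have h1 : HasDerivAt q (2 * x.1 i + 2 * s) s := by
        have := (((hasDerivAt_id s).const_mul 2).mul_const (x.1 i)).const_add 1 |>.add
          ((hasDerivAt_id s).pow 2)
        refine this.congr_deriv ?_
        simp
      have h2 := (h1.sqrt hs.ne').inv (Real.sqrt_ne_zero'.2 hs)
      refine h2.congr_deriv ?_
      have h3 := (Real.sqrt_ne_zero'.2 hs)
      simp only [r]
      field_simp
    have hval : ∀ s : ℝ, inner ℝ w.1 (‖x.1 + s • e‖⁻¹ • (x.1 + s • e)) = (t + s * w.1 i) * r s := by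
      intro s
      rw [inner_smul_right, inner_add_right, inner_smul_right, hwe, hnorm, ← ht]
      simp only [r]
      ring
    have hu : ∀ s : ℝ, 0 < q s → HasDerivAt (fun s => (t + s * w.1 i) * r s)
        (w.1 i * r s - (t + s * w.1 i) * (x.1 i + s) * r s ^ 3) s := by
      intro s hs
      have h1 : HasDerivAt (fun s : ℝ => t + s * w.1 i) (w.1 i) s := by
        simpa using ((hasDerivAt_id s).mul_const (w.1 i)).const_add t
      refine (h1.mul (hr s hs)).congr_deriv ?_
      ring
    refine iteratedFDeriv_two_eq_of_hasDerivAt hF (φ' := fun s =>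
      (derivative p).eval ((t + s * w.1 i) * r s) *
        (w.1 i * r s - (t + s * w.1 i) * (x.1 i + s) * r s ^ 3)) ?_ ?_
    · filter_upwards [hqpos] with s hs
      simp only [hval]
      exact (p.hasDerivAt _).comp s (hu s hs)
    · have hs : 0 < q 0 := by rw [hq0]; exact one_pos
      have h1 := ((derivative p).hasDerivAt ((t + 0 * w.1 i) * r 0)).comp 0 (hu 0 hs)
      have h2 : HasDerivAt (fun s : ℝ => t + s * w.1 i) (w.1 i) 0 := by
        simpa using ((hasDerivAt_id (0 : ℝ)).mul_const (w.1 i)).const_add t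
      have h3 : HasDerivAt (fun s : ℝ => x.1 i + s) 1 0 := (hasDerivAt_id (0 : ℝ)).const_add _
      have h4 := ((hr 0 hs).const_mul (w.1 i)).sub ((h2.mul h3).mul ((hr 0 hs).pow 3))
      refine (h1.mul h4).congr_deriv ?_
      simp [hr0]
      ring
  rw [sphericalLaplacian,
    InnerProductSpace.laplacian_eq_iteratedFDeriv_orthonormalBasis _
      (EuclideanSpace.basisFun (Fin 3) ℝ)]
  simp only [key, Fin.sum_univ_three]
  have hw := sum_sq_S2 w
  have hx := sum_sq_S2 x
  have hwx : w.1 0 * x.1 0 + w.1 1 * x.1 1 + w.1 2 * x.1 2 = t := by rw [ht, inner_E3]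
  simp only [eval_sub, eval_mul, eval_one, eval_pow, eval_X, eval_ofNat]
  set p2 := (derivative (derivative p)).eval t
  set p1 := (derivative p).eval t
  linear_combination p2 * hw + (p2 * t ^ 2 + 3 * t * p1) * hx - (2 * t * p2 + 2 * p1) * hwx

theorem sphericalLaplacian_legendre (l : ℕ) (w x : S2) :
    sphericalLaplacian (fun y => (legendre l).eval (inner ℝ w.1 y)) x =
      -((l : ℝ) * (l + 1)) * (legendre l).eval (inner ℝ w.1 x.1) := by
  rw [sphericalLaplacian_eval_inner, legendre_ode]
  simp

/-! ### Correlations of Legendre functions along Brownian paths -/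

/-- A continuous function whose values are governed by the integrated exponential decay law decays
exponentially. -/
theorem eq_exp_mul_of_integral_equation {u : ℝ → ℝ} (hu : Continuous u) {μ s t : ℝ} (hst : s ≤ t)
    (h : ∀ r, s ≤ r → u r + μ * ∫ v in s..r, u v = u s) :
    u t = Real.exp (-μ * (t - s)) * u s := by
  have hU : ∀ r, HasDerivAt (fun r => ∫ v in s..r, u v) (u r) r := fun r =>
    intervalIntegral.integral_hasDerivAt_right (hu.intervalIntegrable _ _)
      (hu.stronglyMeasurableAtFilter _ _) hu.continuousAt
  -- Integrating factor: the second factor equals `u r` for `s ≤ r` by `h`, but in this form it is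
  -- differentiable, and `W` is constant.
  let W : ℝ → ℝ := fun r => Real.exp (μ * (r - s)) * (u s - μ * ∫ v in s..r, u v)
  have hW : ∀ r, HasDerivAt W (Real.exp (μ * (r - s)) * μ * (u s - μ * ∫ v in s..r, u v) +
      Real.exp (μ * (r - s)) * (-(μ * u r))) r := by
    intro r
    have h1 : HasDerivAt (fun r => Real.exp (μ * (r - s))) (Real.exp (μ * (r - s)) * μ) r := by
      have := (((hasDerivAt_id r).sub_const s).const_mul μ).exp
      refine this.congr_deriv ?_
      simp
    exact h1.mul (((hU r).const_mul μ).const_sub _)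
  have hconst := constant_of_has_deriv_right_zero (f := W) (a := s) (b := t)
    (fun r _ => (hW r).continuousAt.continuousWithinAt) (fun r hr => by
      refine ((hW r).congr_deriv ?_).hasDerivWithinAt
      linear_combination (-(Real.exp (μ * (r - s)) * μ)) * h r hr.1) t ⟨hst, le_rfl⟩
  have h1 := h t hst
  simp only [W, sub_self, mul_zero, Real.exp_zero, intervalIntegral.integral_same, sub_zero,
    one_mul] at hconst
  rw [← hconst, ← mul_assoc, ← Real.exp_add]
  have h2 : -μ * (t - s) + μ * (t - s) = 0 := by ring
  rw [h2, Real.exp_zero, one_mul]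
  linarith

theorem integral_mul_intervalIntegral_of_bounded {Ω : Type*} [MeasurableSpace Ω] {P : Measure Ω}
    [IsProbabilityMeasure P] {k : Ω → ℝ} {a : ℝ → Ω → ℝ} (hk : Measurable k)
    (hkb : ∀ ω, ‖k ω‖ ≤ 1) (ha : Measurable fun q : ℝ × Ω => a q.1 q.2)
    (hab : ∀ v ω, ‖a v ω‖ ≤ 1) {r : ℝ} (hr : 0 ≤ r) :
    ∫ ω, k ω * (∫ v in (0 : ℝ)..r, a v ω) ∂P = ∫ v in (0 : ℝ)..r, ∫ ω, k ω * a v ω ∂P := by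
  simp only [intervalIntegral.integral_of_le hr, ← integral_const_mul]
  have hI : Integrable (Function.uncurry fun (ω : Ω) (v : ℝ) => k ω * a v ω)
      (P.prod (volume.restrict (Set.Ioc (0 : ℝ) r))) := by
    have hm : Measurable fun q : Ω × ℝ => k q.1 * a q.2 q.1 :=
      (hk.comp measurable_fst).mul (ha.comp measurable_swap)
    refine Integrable.of_bound hm.aestronglyMeasurable 1 (Eventually.of_forall fun q => ?_)
    simp only [Function.uncurry, norm_mul]
    exact mul_le_one₀ (hkb _) (norm_nonneg _) (hab _ _)
  exact integral_integral_swap hI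

namespace IsSphericalBrownianMotion

variable {Ω : Type*} [MeasurableSpace Ω] {P : Measure Ω}
  {B : ℝ≥0 → Ω → S2} {x : S2}

theorem measurable_eval_inner (hB : IsSphericalBrownianMotion P B x) (p : Polynomial ℝ) (w : S2)
    (t : ℝ≥0) : Measurable fun ω => p.eval (inner ℝ w.1 (B t ω).1) :=
  (continuous_eval_inner p w).measurable.comp (hB.measurable t)

/-- As `P_l(⟨w, ·⟩)` is an eigenfunction, the martingale is `a_r + μ ∫₀^r a`. Testing it against the
bounded variable `a_s`, known at time `s`, gives `u(r) + μ ∫_s^r u = u(s)` for `u(r) = E[a_s a_r]`.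
The martingale problem suffices; the Markov property is not needed. -/
theorem integral_legendre_mul [IsProbabilityMeasure P]
    (hB : IsSphericalBrownianMotion P B x) (l : ℕ) (w : S2)
    {s t : ℝ≥0} (hst : s ≤ t) :
    ∫ ω, (legendre l).eval (inner ℝ w.1 (B s ω).1) * (legendre l).eval (inner ℝ w.1 (B t ω).1) ∂P =
      Real.exp (-((l : ℝ) * (l + 1)) * (t - s)) *
        ∫ ω, (legendre l).eval (inner ℝ w.1 (B s ω).1) *
          (legendre l).eval (inner ℝ w.1 (B s ω).1) ∂P := by
  set μ : ℝ := (l : ℝ) * (l + 1) with hμ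
  let f : E3 → ℝ := fun y => (legendre l).eval (inner ℝ w.1 y)
  let a : ℝ≥0 → Ω → ℝ := fun r ω => f (B r ω).1
  have ham : ∀ r, Measurable (a r) := fun r => hB.measurable_eval_inner (legendre l) w r
  have hab : ∀ r ω, ‖a r ω‖ ≤ 1 := fun r ω => abs_legendre_le_one l (B r ω) w
  have hac : ∀ ω, Continuous fun r => a r ω := fun ω =>
    (continuous_eval_inner (legendre l) w).comp (hB.continuous_paths ω)
  have hacr : ∀ ω, Continuous fun r : ℝ => a r.toNNReal ω := fun ω =>
    (hac ω).comp continuous_real_toNNReal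
  have hai : ∀ r, Integrable (a r) P := fun r =>
    Integrable.of_bound (ham r).aestronglyMeasurable 1 (Eventually.of_forall (hab r))
  have hprod : ∀ r, Integrable (fun ω => a s ω * a r ω) P := fun r =>
    (hai r).bdd_mul (ham s).aestronglyMeasurable (Eventually.of_forall (hab s))
  set ℱ := Filtration.natural B fun t => (hB.measurable t).stronglyMeasurable with hℱ
  let N : ℝ≥0 → Ω → ℝ := fun r ω => a r ω + μ * ∫ v in (0 : ℝ)..r, a v.toNNReal ω
  have hN : Martingale N ℱ P := by
    have h := hB.martingale f (contDiff_eval_inner (legendre l) w.1 _)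
    have he : (fun (t : ℝ≥0) ω => f (B t ω).1 -
        ∫ s in (0 : ℝ)..t, sphericalLaplacian f (B s.toNNReal ω)) = N := by
      funext r ω
      simp only [f, sphericalLaplacian_legendre, intervalIntegral.integral_const_mul]
      simp only [N, a, f, hμ]
      ring
    rw [← he]
    exact h
  have hNs : ∀ r, s ≤ r → ∫ ω, a s ω * N r ω ∂P = ∫ ω, a s ω * N s ω ∂P := by
    intro r hr
    have hsm : StronglyMeasurable[ℱ s] (a s) := by
      have h1 : StronglyMeasurable[ℱ s] (B s) := Filtration.stronglyAdapted_natural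
        (fun t => (hB.measurable t).stronglyMeasurable) s
      exact (continuous_eval_inner (legendre l) w).comp_stronglyMeasurable h1
    have hint : Integrable (fun ω => a s ω * N r ω) P :=
      (hN.integrable r).bdd_mul (ham s).aestronglyMeasurable (Eventually.of_forall (hab s))
    have h2 := condExp_mul_of_stronglyMeasurable_left (m := ℱ s) (μ := P) hsm hint
      (hN.integrable r)
    rw [← integral_condExp (ℱ.le s)]
    refine integral_congr_ae ?_
    filter_upwards [h2, hN.2 s r hr] with ω h3 h4
    have h5 : P[fun ω => a s ω * N r ω | ℱ s] ω = a s ω * (P[N r | ℱ s]) ω := h3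
    rw [h5, h4]
  let u : ℝ → ℝ := fun r => ∫ ω, a s ω * a r.toNNReal ω ∂P
  have huc : Continuous u := by
    refine continuous_of_dominated (bound := fun _ => 1)
      (fun r => (hprod _).aestronglyMeasurable) (fun r => Eventually.of_forall fun ω => ?_)
      (integrable_const _) (Eventually.of_forall fun ω => continuous_const.mul (hacr ω))
    rw [norm_mul]
    exact mul_le_one₀ (hab _ _) (norm_nonneg _) (hab _ _)
  have hjm : Measurable fun q : ℝ × Ω => a q.1.toNNReal q.2 :=
    measurable_uncurry_of_continuous_of_measurable (u := fun (r : ℝ) ω => a r.toNNReal ω)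
      hacr fun r => ham _
  have hfub : ∀ r : ℝ≥0, ∫ ω, a s ω * (∫ v in (0 : ℝ)..r, a v.toNNReal ω) ∂P =
      ∫ v in (0 : ℝ)..r, u v := fun r =>
    integral_mul_intervalIntegral_of_bounded (ham s) (hab s) hjm (fun v => hab v.toNNReal)
      r.coe_nonneg
  have hNu : ∀ r : ℝ≥0, ∫ ω, a s ω * N r ω ∂P = u r + μ * ∫ v in (0 : ℝ)..r, u v := by
    intro r
    have h1 : ∀ ω, a s ω * N r ω = a s ω * a r ω +
        μ * (a s ω * ∫ v in (0 : ℝ)..r, a v.toNNReal ω) := fun ω => by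
      simp only [N]; ring
    have hI1 : Integrable (fun ω => a s ω * N r ω) P :=
      (hN.integrable r).bdd_mul (ham s).aestronglyMeasurable (Eventually.of_forall (hab s))
    have hI2 : Integrable (fun ω => μ * (a s ω * ∫ v in (0 : ℝ)..r, a v.toNNReal ω)) P := by
      refine (hI1.sub (hprod r)).congr (Eventually.of_forall fun ω => ?_)
      simp only [Pi.sub_apply, h1]; ring
    simp only [h1]
    rw [integral_add (hprod r) hI2, integral_const_mul, hfub]
    simp only [u, Real.toNNReal_coe]
  have hint : ∀ r : ℝ, (s : ℝ) ≤ r → u r + μ * ∫ v in (s : ℝ)..r, u v = u s := by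
    intro r hr
    lift r to ℝ≥0 using s.2.trans hr
    have h1 := hNs r (by exact_mod_cast hr)
    rw [hNu, hNu] at h1
    -- The martingale integrates from time `0`; the part up to `s` is common to both sides and
    -- cancels.
    have h2 := intervalIntegral.integral_add_adjacent_intervals
      (huc.intervalIntegrable (μ := volume) 0 (s : ℝ)) (huc.intervalIntegrable (s : ℝ) r)
    rw [← h2] at h1
    linarith
  have hfin := eq_exp_mul_of_integral_equation huc (by exact_mod_cast hst : (s : ℝ) ≤ t) hint
  simp only [u, Real.toNNReal_coe] at hfin
  exact hfin

/-- Integrating `integral_legendre_mul` over `w` turns the products into `P_l(⟨B_s, B_t⟩)` on the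
left and `P_l(⟨B_s, B_s⟩) = 1` on the right, so the law of `B_s` drops out. -/
theorem integral_legendre_inner [IsProbabilityMeasure P]
    (hB : IsSphericalBrownianMotion P B x) (l : ℕ)
    {s t : ℝ≥0} (hst : s ≤ t) :
    ∫ ω, (legendre l).eval (inner ℝ (B s ω).1 (B t ω).1) ∂P =
      Real.exp (-((l : ℝ) * (l + 1)) * (t - s)) := by
  have hN : (4 * Real.pi / (2 * (l : ℝ) + 1)) ≠ 0 := by
    have := Real.pi_pos
    positivity
  have hrep : ∀ r : ℝ≥0, ∀ ω, ∫ w : S2, (legendre l).eval (inner ℝ w.1 (B s ω).1) *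
      (legendre l).eval (inner ℝ w.1 (B r ω).1) ∂surfaceMeasure =
      4 * Real.pi / (2 * l + 1) * (legendre l).eval (inner ℝ (B s ω).1 (B r ω).1) := by
    intro r ω
    have h := integral_legendre_mul_legendre l l (B r ω) (B s ω)
    rw [if_pos rfl] at h
    rw [← h]
    refine integral_congr_ae (Eventually.of_forall fun w => ?_)
    simp only [real_inner_comm w.1]
    ring
  have hmeas : ∀ r : ℝ≥0, Measurable fun q : S2 × Ω =>
      (legendre l).eval (inner ℝ q.1.1 (B r q.2).1) := fun r =>
    ((legendre l).continuous.comp continuous_inner_S2_prod).measurable.comp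
      (measurable_fst.prodMk ((hB.measurable r).comp measurable_snd))
  have hI : ∀ r : ℝ≥0, Integrable (fun q : S2 × Ω => (legendre l).eval (inner ℝ q.1.1 (B s q.2).1) *
      (legendre l).eval (inner ℝ q.1.1 (B r q.2).1)) (surfaceMeasure.prod P) := by
    intro r
    refine Integrable.of_bound ((hmeas s).mul (hmeas r)).aestronglyMeasurable 1
      (Eventually.of_forall fun q => ?_)
    rw [norm_mul]
    exact mul_le_one₀ (abs_legendre_le_one l _ _) (norm_nonneg _) (abs_legendre_le_one l _ _)
  have hswap : ∀ r : ℝ≥0, ∫ w : S2, ∫ ω, (legendre l).eval (inner ℝ w.1 (B s ω).1) *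
      (legendre l).eval (inner ℝ w.1 (B r ω).1) ∂P ∂surfaceMeasure =
      4 * Real.pi / (2 * l + 1) * ∫ ω, (legendre l).eval (inner ℝ (B s ω).1 (B r ω).1) ∂P := by
    intro r
    rw [integral_integral_swap (f := fun (w : S2) ω => (legendre l).eval (inner ℝ w.1 (B s ω).1) *
      (legendre l).eval (inner ℝ w.1 (B r ω).1)) (hI r)]
    simp only [hrep, integral_const_mul]
  have h1 := hswap t
  simp only [hB.integral_legendre_mul l _ hst, integral_const_mul] at h1
  rw [hswap s] at h1
  simp only [inner_self_S2, legendre_eval_one] at h1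
  simp only [integral_const, probReal_univ, smul_eq_mul, mul_one] at h1
  refine mul_left_cancel₀ hN ?_
  rw [← h1]
  ring

end IsSphericalBrownianMotion

/-! ### Freezing one of two independent variables -/

/-- Integration of a function of two independent variables, one of them frozen first. -/
theorem integrable_and_integral_of_indepFun {Ω Ω' E : Type*} [MeasurableSpace Ω]
    [MeasurableSpace Ω'] [MeasurableSpace E] {P : Measure Ω} [IsProbabilityMeasure P]
    {Y : Ω → Ω'} {X : Ω → E} (hY : Measurable Y) (hX : Measurable X) (hYX : IndepFun Y X P)
    {G : Ω' → E → ℝ} (hG : Measurable fun q : Ω' × E => G q.1 q.2) {K : ℝ}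
    (hi : ∀ e, Integrable (fun ω => G (Y ω) e) P) (hK : ∀ e, ∫ ω, ‖G (Y ω) e‖ ∂P ≤ K) :
    Integrable (fun ω => G (Y ω) (X ω)) P ∧
      ∫ ω, G (Y ω) (X ω) ∂P = ∫ ω, (∫ ω', G (Y ω') (X ω) ∂P) ∂P := by
  have hmap := (indepFun_iff_map_prod_eq_prod_map_map hY.aemeasurable hX.aemeasurable).1 hYX
  have : IsProbabilityMeasure (P.map Y) := Measure.isProbabilityMeasure_map hY.aemeasurable
  have : IsProbabilityMeasure (P.map X) := Measure.isProbabilityMeasure_map hX.aemeasurable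
  have hGe : ∀ e, Measurable fun y => G y e := fun e => hG.comp measurable_prodMk_right
  have hsec : ∀ e, ∫ y, G y e ∂(P.map Y) = ∫ ω, G (Y ω) e ∂P := fun e =>
    integral_map hY.aemeasurable (hGe e).aestronglyMeasurable
  have hsecn : ∀ e, ∫ y, ‖G y e‖ ∂(P.map Y) = ∫ ω, ‖G (Y ω) e‖ ∂P := fun e =>
    integral_map hY.aemeasurable (hGe e).norm.aestronglyMeasurable
  have hI : Integrable (fun q : Ω' × E => G q.1 q.2) ((P.map Y).prod (P.map X)) := by
    rw [integrable_prod_iff' hG.aestronglyMeasurable]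
    refine ⟨Eventually.of_forall fun e => ?_, ?_⟩
    · exact (integrable_map_measure (hGe e).aestronglyMeasurable hY.aemeasurable).2 (hi e)
    · refine Integrable.of_bound
        (hG.stronglyMeasurable.norm.integral_prod_left' (μ := P.map Y)).aestronglyMeasurable K
        (Eventually.of_forall fun e => ?_)
      rw [Real.norm_of_nonneg (integral_nonneg fun _ => norm_nonneg _), hsecn]
      exact hK e
  have hpair : AEMeasurable (fun ω => (Y ω, X ω)) P := (hY.prodMk hX).aemeasurable
  refine ⟨?_, ?_⟩
  · have h := hI
    rw [← hmap, integrable_map_measure hG.aestronglyMeasurable hpair] at h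
    exact h
  · have h1 : ∫ ω, G (Y ω) (X ω) ∂P = ∫ q, G q.1 q.2 ∂(P.map fun ω => (Y ω, X ω)) :=
      (integral_map (f := fun q : Ω' × E => G q.1 q.2) hpair hG.aestronglyMeasurable).symm
    rw [h1, hmap, integral_prod_symm _ hI]
    simp only [hsec]
    exact integral_map hX.aemeasurable (f := fun e => ∫ ω', G (Y ω') e ∂P) (by
      simp only [← hsec]
      exact (hG.stronglyMeasurable.integral_prod_left' (μ := P.map Y)).aestronglyMeasurable)

/-- A second order isotropic field observed at two independent random points. -/
theorem IsSecondOrderIsotropic.integrable_and_integral_of_indepFun {Ω Ω' : Type*}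
    [MeasurableSpace Ω] [MeasurableSpace Ω'] {P : Measure Ω} [IsProbabilityMeasure P]
    {Y : Ω → Ω'} {U V : Ω → S2} {T : S2 → Ω' → ℝ} (hY : Measurable Y) (hU : Measurable U)
    (hV : Measurable V) (hYUV : IndepFun Y (fun ω => (U ω, V ω)) P)
    (hTm : Measurable fun p : S2 × Ω' => T p.1 p.2)
    (hT : IsSecondOrderIsotropic P fun x ω => T x (Y ω)) :
    Integrable (fun ω => T (U ω) (Y ω) * T (V ω) (Y ω)) P ∧
      ∫ ω, T (U ω) (Y ω) * T (V ω) (Y ω) ∂P =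
        ∫ ω, covFn P (fun x ω => T x (Y ω)) (inner ℝ (U ω).1 (V ω).1) ∂P := by
  have h := SphereField.integrable_and_integral_of_indepFun
    (G := fun (y : Ω') (e : S2 × S2) => T e.1 y * T e.2 y)
    (K := covFn P (fun x ω => T x (Y ω)) 1) hY (hU.prodMk hV) hYUV
    ((hTm.comp ((measurable_fst.comp measurable_snd).prodMk measurable_fst)).mul
      (hTm.comp ((measurable_snd.comp measurable_snd).prodMk measurable_fst)))
    (fun e => hT.integrable_mul e.1 e.2) (fun e => ?_)
  · refine ⟨h.1, h.2.trans ?_⟩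
    simp only [hT.integral_mul]
  · have h2 : ∀ ω, ‖T e.1 (Y ω) * T e.2 (Y ω)‖ ≤
        (1 / 2) * T e.1 (Y ω) ^ 2 + (1 / 2) * T e.2 (Y ω) ^ 2 := fun ω => by
      rw [norm_mul, Real.norm_eq_abs, Real.norm_eq_abs, ← sq_abs (T e.1 (Y ω)),
        ← sq_abs (T e.2 (Y ω))]
      nlinarith [sq_nonneg (|T e.1 (Y ω)| - |T e.2 (Y ω)|)]
    have hs : ∀ x, Integrable (fun ω => (1 / 2) * T x (Y ω) ^ 2) P := fun x =>
      (hT.memLp x).integrable_sq.const_mul _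
    refine (integral_mono (hT.integrable_mul e.1 e.2).norm ((hs e.1).add (hs e.2)) h2).trans ?_
    simp only [Pi.add_apply]
    rw [integral_add (hs _) (hs _), integral_const_mul, integral_const_mul, hT.integral_sq e.1,
      hT.integral_sq e.2]
    linarith

/-- The Legendre expansion of the expected covariance at two random points. -/
theorem IsSecondOrderIsotropic.hasSum_integral_covFn {Ω : Type*} [MeasurableSpace Ω]
    {P : Measure Ω} [IsProbabilityMeasure P] {T : S2 → Ω → ℝ} (hT : IsSecondOrderIsotropic P T)
    {U V : Ω → S2} (hU : Measurable U) (hV : Measurable V) :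
    HasSum (fun l : ℕ => (2 * (l : ℝ) + 1) / (4 * Real.pi) * zonalCoeff (covFn P T) l *
      ∫ ω, (legendre l).eval (inner ℝ (U ω).1 (V ω).1) ∂P)
      (∫ ω, covFn P T (inner ℝ (U ω).1 (V ω).1) ∂P) := by
  have hm : ∀ l, Measurable fun ω => (legendre l).eval (inner ℝ (U ω).1 (V ω).1) := fun l =>
    ((legendre l).continuous.comp continuous_inner_S2_prod).measurable.comp (hU.prodMk hV)
  have hi : ∀ l : ℕ, Integrable (fun ω => (2 * (l : ℝ) + 1) / (4 * Real.pi) *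
      zonalCoeff (covFn P T) l * (legendre l).eval (inner ℝ (U ω).1 (V ω).1)) P := fun l =>
    (Integrable.of_bound (hm l).aestronglyMeasurable 1
      (Eventually.of_forall fun ω => abs_legendre_le_one l _ _)).const_mul _
  have hs : Summable fun l : ℕ => ∫ ω, ‖(2 * (l : ℝ) + 1) / (4 * Real.pi) *
      zonalCoeff (covFn P T) l * (legendre l).eval (inner ℝ (U ω).1 (V ω).1)‖ ∂P := by
    refine Summable.of_nonneg_of_le (fun l => integral_nonneg fun _ => norm_nonneg _)
      (fun l => ?_) hT.summable_zonalCoeff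
    refine (integral_mono (hi l).norm (integrable_const ((2 * (l : ℝ) + 1) / (4 * Real.pi) *
      zonalCoeff (covFn P T) l)) fun ω => ?_).trans (by simp)
    rw [norm_mul, Real.norm_of_nonneg (hT.mul_zonalCoeff_nonneg l)]
    exact mul_le_of_le_one_right (hT.mul_zonalCoeff_nonneg l) (abs_legendre_le_one l _ _)
  have h := hasSum_integral_of_summable_integral_norm hi hs
  have he : ∀ ω, ∑' l : ℕ, (2 * (l : ℝ) + 1) / (4 * Real.pi) * zonalCoeff (covFn P T) l *
      (legendre l).eval (inner ℝ (U ω).1 (V ω).1) = covFn P T (inner ℝ (U ω).1 (V ω).1) :=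
    fun ω => by
      rw [(hT.hasSum_covFn_inner (V ω) (U ω)).tsum_eq, real_inner_comm]
  simp only [he, integral_const_mul] at h
  exact h

/-- Gaussian marginals have finite second moments, and equality in law of the rotated field gives
equality of the product moments. -/
theorem IsIsotropicGaussianField.isSecondOrderIsotropic {Ω : Type*} {𝓕T : MeasurableSpace Ω}
    [mΩ : MeasurableSpace Ω] {P : Measure Ω} {T : S2 → Ω → ℝ}
    (hT : IsIsotropicGaussianField 𝓕T P T) : IsSecondOrderIsotropic P T where
  measurable := hT.measurable.mono (sup_le_sup le_rfl (MeasurableSpace.comap_mono hT.le)) le_rfl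
  memLp x := (hT.gaussian.hasGaussianLaw_eval x).memLp_two
  invariant g x y :=
    ((hT.isotropic g).comp ((measurable_pi_apply x).mul (measurable_pi_apply y))).integral_eq

/-! ### The time-changed Brownian motion -/

/-- A σ-algebra `m` is regarded as the random variable `id` from `Ω` to `(Ω, m)`. Freezing then
applies to a field measurable with respect to `m`, without a space of paths. -/
theorem indepFun_id_of_indep {Ω E : Type*} {m mΩ : MeasurableSpace Ω} [mE : MeasurableSpace E]
    {P : Measure[mΩ] Ω} {X : Ω → E} (h : Indep m (MeasurableSpace.comap X mE) P) :
    @IndepFun Ω Ω E mΩ m mE id X P := by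
  refine (@IndepFun_iff_Indep Ω Ω E mΩ m mE id X P).2 ?_
  rwa [MeasurableSpace.comap_id]

theorem measurable_legendre_inner_path {Ω : Type*} [MeasurableSpace Ω] {B : ℝ≥0 → Ω → S2}
    (hBc : ∀ ω, Continuous fun t => B t ω) (hBm : ∀ t, Measurable (B t)) (l : ℕ) :
    Measurable fun q : Ω × (ℝ≥0 × ℝ≥0) =>
      (legendre l).eval (inner ℝ (B q.2.1 q.1).1 (B q.2.2 q.1).1) := by
  have hj := measurable_uncurry_of_continuous_of_measurable (u := B) hBc hBm
  have hc := ((legendre l).continuous.comp continuous_inner_S2_prod).measurable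
  exact hc.comp ((hj.comp (measurable_snd.fst.prodMk measurable_fst)).prodMk
    (hj.comp (measurable_snd.snd.prodMk measurable_fst)))

theorem measurable_timeChange {Ω : Type*} [MeasurableSpace Ω] {B : ℝ≥0 → Ω → S2} {τ : Ω → ℝ≥0}
    (hBc : ∀ ω, Continuous fun t => B t ω) (hBm : ∀ t, Measurable (B t)) (hτ : Measurable τ) :
    Measurable fun ω => B (τ ω) ω :=
  (measurable_uncurry_of_continuous_of_measurable (u := B) hBc hBm).comp (hτ.prodMk measurable_id)

/-- The Brownian motion at a random time is a function of the paths of the motion and the clock. -/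
theorem measurable_timeChange_comap {Ω : Type*} {B : ℝ≥0 → Ω → S2} {D : ℝ≥0 → Ω → ℝ≥0}
    (hBc : ∀ ω, Continuous fun t => B t ω) (t : ℝ≥0) :
    Measurable[MeasurableSpace.comap (fun ω => ((fun t => B t ω), (fun t => D t ω))) inferInstance]
      fun ω => B (D t ω) ω := by
  let m : MeasurableSpace Ω :=
    MeasurableSpace.comap (fun ω => ((fun t => B t ω), (fun t => D t ω))) inferInstance
  have hp : Measurable[m] fun ω => ((fun t => B t ω), (fun t => D t ω)) :=
    comap_measurable _
  exact measurable_timeChange hBc (fun t => (measurable_pi_apply t).comp (measurable_fst.comp hp))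
    ((measurable_pi_apply t).comp (measurable_snd.comp hp))

/-- With the clock frozen the expectation is `exp(-l(l+1)(D_t - D_s))`; the increment has the law of
`D_{t-s}`, whose Laplace transform is known. -/
theorem integral_legendre_timeChange {Ω : Type*} [mΩ : MeasurableSpace Ω] {P : Measure Ω}
    [IsProbabilityMeasure P] {B : ℝ≥0 → Ω → S2} {D : ℝ≥0 → Ω → ℝ≥0} {x : S2} {b : ℝ} {M : Measure ℝ}
    (hB : IsSphericalBrownianMotion P B x) (hD : IsSubordinator P D b M)
    (hBD : IndepFun (fun ω t => B t ω) (fun ω t => D t ω) P) (l : ℕ) {s t : ℝ≥0} (hst : s ≤ t) :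
    ∫ ω, (legendre l).eval (inner ℝ (B (D s ω) ω).1 (B (D t ω) ω).1) ∂P =
      Real.exp (-((t : ℝ) - s) * laplaceExponent b M ((l : ℝ) * (l + 1))) := by
  have hm : MeasurableSpace.comap (fun ω t => B t ω) inferInstance ≤ mΩ :=
    (measurable_pi_lambda (fun ω t => B t ω) fun t => hB.measurable t).comap_le
  have hX : Measurable fun ω => (D s ω, D t ω) := (hD.measurable s).prodMk (hD.measurable t)
  have hind : @IndepFun Ω Ω (ℝ≥0 × ℝ≥0) mΩ
      (MeasurableSpace.comap (fun ω t => B t ω) inferInstance) inferInstance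
      id (fun ω => (D s ω, D t ω)) P := by
    have h1 : IndepFun (fun ω t => B t ω) (fun ω => (D s ω, D t ω)) P :=
      hBD.comp measurable_id ((measurable_pi_apply s).prodMk (measurable_pi_apply t))
    exact indepFun_id_of_indep ((IndepFun_iff_Indep _ _ _).1 h1)
  -- Joint measurability is needed for the σ-algebra generated by `B`, the one independent of the
  -- clock; continuity of the paths provides it.
  have hjoint : @Measurable (Ω × (ℝ≥0 × ℝ≥0)) ℝ
      (@Prod.instMeasurableSpace _ _ (MeasurableSpace.comap (fun ω t => B t ω) inferInstance) _) _
      fun q => (legendre l).eval (inner ℝ (B q.2.1 q.1).1 (B q.2.2 q.1).1) :=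
    @measurable_legendre_inner_path Ω (MeasurableSpace.comap (fun ω t => B t ω) inferInstance) B
      hB.continuous_paths
      (fun t => (measurable_pi_apply t).comp (comap_measurable (fun ω t => B t ω))) l
  have hbd : ∀ (ω : Ω) (e : ℝ≥0 × ℝ≥0),
      ‖(legendre l).eval (inner ℝ (B e.1 ω).1 (B e.2 ω).1)‖ ≤ 1 := fun ω e =>
    abs_legendre_le_one l _ _
  have hi : ∀ e : ℝ≥0 × ℝ≥0,
      Integrable (fun ω => (legendre l).eval (inner ℝ (B e.1 ω).1 (B e.2 ω).1)) P := fun e =>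
    Integrable.of_bound (((legendre l).continuous.comp continuous_inner_S2_prod).measurable.comp
      ((hB.measurable e.1).prodMk (hB.measurable e.2))).aestronglyMeasurable 1
      (Eventually.of_forall fun ω => hbd ω e)
  have h := @integrable_and_integral_of_indepFun Ω Ω (ℝ≥0 × ℝ≥0) mΩ
    (MeasurableSpace.comap (fun ω t => B t ω) inferInstance) _ P _ id (fun ω => (D s ω, D t ω))
    (measurable_id'' hm) hX hind
    (fun ω e => (legendre l).eval (inner ℝ (B e.1 ω).1 (B e.2 ω).1)) hjoint 1 hi (fun e => by
      refine (integral_mono (hi e).norm (integrable_const 1) fun ω => hbd ω e).trans (by simp))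
  have h2 : ∫ ω, (legendre l).eval (inner ℝ (B (D s ω) ω).1 (B (D t ω) ω).1) ∂P =
      ∫ ω, (∫ ω', (legendre l).eval (inner ℝ (B (D s ω) ω').1 (B (D t ω) ω').1) ∂P) ∂P := h.2
  rw [h2]
  simp only [fun ω => hB.integral_legendre_inner l (hD.monotone_paths ω hst)]
  have h3 := ((hD.stationary_increments s (t - s)).comp
    (u := fun r => Real.exp (-((l : ℝ) * (l + 1)) * r)) (by fun_prop)).integral_eq
  rw [add_tsub_cancel_of_le hst] at h3
  have h4 := hD.laplace_transform (t - s) ((l : ℝ) * (l + 1)) (by positivity)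
  rw [NNReal.coe_sub hst] at h4
  exact h3.trans h4

/-! ### The limit of infinite time separation -/

theorem laplaceExponent_nonneg {b : ℝ} (hb : 0 ≤ b) {M : Measure ℝ}
    (hM : IsSubordinatorLevyMeasure M) {μ : ℝ} (hμ : 0 ≤ μ) : 0 ≤ laplaceExponent b M μ := by
  refine add_nonneg (mul_nonneg hb hμ) (integral_nonneg_of_ae ?_)
  have h : ∀ᵐ y ∂M, y ∉ Set.Iic (0 : ℝ) := measure_eq_zero_iff_ae_notMem.1 hM.support
  filter_upwards [h] with y hy
  have hy0 : 0 < y := not_le.1 hy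
  have : Real.exp (-μ * y) ≤ 1 := Real.exp_le_one_iff.2 (by nlinarith)
  simpa using this

theorem tendsto_exp_neg_sub_mul {c : ℝ} (hc : 0 ≤ c) (s : ℝ≥0) :
    Tendsto (fun t : ℝ≥0 => Real.exp (-((t : ℝ) - s) * c)) atTop
      (𝓝 (if c = 0 then 1 else 0)) := by
  split_ifs with h
  · simp [h]
  · have hpos : 0 < c := lt_of_le_of_ne hc (Ne.symm h)
    refine Real.tendsto_exp_atBot.comp (Tendsto.atBot_mul_const hpos ?_)
    exact tendsto_neg_atTop_atBot.comp
      (tendsto_atTop_add_const_right _ _ (NNReal.tendsto_coe_atTop.2 tendsto_id))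

/-- Dominated convergence for a series with exponentially decaying terms. -/
theorem hasSum_and_tendsto_of_hasSum_exp {a c : ℕ → ℝ} (ha : ∀ l, 0 ≤ a l) (hs : Summable a)
    (hc : ∀ l, 0 ≤ c l) {s : ℝ≥0} {F : ℝ≥0 → ℝ}
    (hF : ∀ t, s ≤ t → HasSum (fun l => a l * Real.exp (-((t : ℝ) - s) * c l)) (F t)) :
    ∃ S, HasSum (fun l => a l * (if c l = 0 then 1 else 0)) S ∧ Tendsto F atTop (𝓝 S) := by
  have hsum : Summable fun l => a l * (if c l = 0 then (1 : ℝ) else 0) := by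
    refine Summable.of_nonneg_of_le (fun l => ?_) (fun l => ?_) hs
    · split_ifs <;> simp [ha l]
    · split_ifs <;> simp [ha l]
  refine ⟨_, hsum.hasSum, ?_⟩
  have h := tendsto_tsum_of_dominated_convergence (𝓕 := atTop)
    (f := fun (t : ℝ≥0) l => a l * Real.exp (-((t : ℝ) - s) * c l)) (bound := a) hs
    (fun l => (tendsto_exp_neg_sub_mul (hc l) s).const_mul (a l))
    (by
      filter_upwards [eventually_ge_atTop s] with t ht l
      have ht' : (s : ℝ) ≤ t := by exact_mod_cast ht
      rw [norm_mul, Real.norm_of_nonneg (ha l), Real.norm_of_nonneg (Real.exp_nonneg _)]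
      refine mul_le_of_le_one_right (ha l) (Real.exp_le_one_iff.2 ?_)
      nlinarith [hc l])
  refine h.congr' ?_
  filter_upwards [eventually_ge_atTop s] with t ht
  exact (hF t ht).tsum_eq

end SphereField

end

/-! ### The time covariance -/

theorem theorem2 {Ω : Type*} (𝓕T : MeasurableSpace Ω) [mΩ : MeasurableSpace Ω]
    (P : Measure Ω) [IsProbabilityMeasure P]
    -- the isotropic Gaussian field and its angular power spectrum
    (T : S2 → Ω → ℝ) (hT : IsIsotropicGaussianField 𝓕T P T)
    (C : ℕ → ℝ) (hC : IsAngularPowerSpectrum P T C)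
    -- for each starting point, a rotational Brownian motion and a subordinator
    (B : S2 → ℝ≥0 → Ω → S2) (hB : ∀ y, IsSphericalBrownianMotion P (B y) y)
    (b : ℝ) (hb : 0 ≤ b) (M : Measure ℝ) (hM : IsSubordinatorLevyMeasure M)
    (D : S2 → ℝ≥0 → Ω → ℝ≥0) (hD : ∀ y, IsSubordinator P (D y) b M)
    -- the Brownian motion and its clock are independent, and the field is independent of both
    (hBD : ∀ y, IndepFun (fun ω t => B y t ω) (fun ω t => D y t ω) P)
    (hTBD : ∀ y, Indep 𝓕T
      (MeasurableSpace.comap (fun ω => ((fun t => B y t ω), (fun t => D y t ω))) inferInstance) P)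
    (x : S2) (g : SO3) (t₁ : ℝ≥0) :
    (∀ t₂ : ℝ≥0, t₁ ≤ t₂ →
      Integrable
        (fun ω => coordField T B D t₁ (rotate g x) ω * coordField T B D t₂ (rotate g x) ω) P ∧
      HasSum
        (fun l : ℕ => (2 * (l : ℝ) + 1) / (4 * Real.pi) * C l *
          Real.exp (-((t₂ : ℝ) - t₁) * laplaceExponent b M ((l : ℝ) * (l + 1))))
        (∫ ω, coordField T B D t₁ (rotate g x) ω * coordField T B D t₂ (rotate g x) ω ∂P)) ∧
    -- the case `t₂ = ∞`, as a limit: `exp (-t Ψ)` tends to `1` if `Ψ = 0` and to `0` otherwise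
    (∃ S : ℝ,
      HasSum
        (fun l : ℕ => (2 * (l : ℝ) + 1) / (4 * Real.pi) * C l *
          (if laplaceExponent b M ((l : ℝ) * (l + 1)) = 0 then 1 else 0)) S ∧
      Tendsto
        (fun t₂ : ℝ≥0 =>
          ∫ ω, coordField T B D t₁ (rotate g x) ω * coordField T B D t₂ (rotate g x) ω ∂P)
        atTop (𝓝 S)) := by
  have hT2 := hT.isSecondOrderIsotropic
  have hCz : ∀ l, C l = zonalCoeff (covFn P T) l := fun l => by
    obtain ⟨m, hm, h⟩ := hC l
    rw [h, hT2.integral_norm_fourierCoeff_sq hm]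
  simp only [hCz]
  -- The motion and the clock are given for every starting point, and the limit formula does not
  -- involve it; `y` may be any point of the sphere.
  set y := rotate g x
  have hmain : ∀ t₂ : ℝ≥0, t₁ ≤ t₂ →
      Integrable (fun ω => coordField T B D t₁ y ω * coordField T B D t₂ y ω) P ∧
      HasSum
        (fun l : ℕ => (2 * (l : ℝ) + 1) / (4 * Real.pi) * zonalCoeff (covFn P T) l *
          Real.exp (-((t₂ : ℝ) - t₁) * laplaceExponent b M ((l : ℝ) * (l + 1))))
        (∫ ω, coordField T B D t₁ y ω * coordField T B D t₂ y ω ∂P) := by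
    intro t₂ ht
    have hcomap : MeasurableSpace.comap (fun ω => ((fun t => B y t ω), (fun t => D y t ω)))
        inferInstance ≤ mΩ :=
      ((measurable_pi_lambda (fun ω t => B y t ω) fun t => (hB y).measurable t).prodMk
        (measurable_pi_lambda (fun ω t => D y t ω) fun t => (hD y).measurable t)).comap_le
    have hUm : ∀ t, Measurable[MeasurableSpace.comap
        (fun ω => ((fun t => B y t ω), (fun t => D y t ω))) inferInstance]
        fun ω => B y (D y t ω) ω := fun t => measurable_timeChange_comap (hB y).continuous_paths t
    have hU : ∀ t, Measurable fun ω => B y (D y t ω) ω := fun t => (hUm t).mono hcomap le_rfl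
    -- Both endpoints are measurable for the σ-algebra generated jointly by the paths of the motion
    -- and of the clock, so the pair is independent of the field.
    have hind : @IndepFun Ω Ω (S2 × S2) mΩ 𝓕T inferInstance id
        (fun ω => (B y (D y t₁ ω) ω, B y (D y t₂ ω) ω)) P :=
      indepFun_id_of_indep (indep_of_indep_of_le_right (hTBD y) ((hUm t₁).prodMk (hUm t₂)).comap_le)
    have h := @IsSecondOrderIsotropic.integrable_and_integral_of_indepFun Ω Ω mΩ 𝓕T P _ id
      (fun ω => B y (D y t₁ ω) ω) (fun ω => B y (D y t₂ ω) ω) T (measurable_id'' hT.le) (hU t₁)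
      (hU t₂) hind hT.measurable hT2
    refine ⟨h.1, ?_⟩
    have hs := hT2.hasSum_integral_covFn (hU t₁) (hU t₂)
    simp only [fun l => integral_legendre_timeChange (hB y) (hD y) (hBD y) l ht] at hs
    have he : ∫ ω, coordField T B D t₁ y ω * coordField T B D t₂ y ω ∂P =
        ∫ ω, covFn P T (inner ℝ (B y (D y t₁ ω) ω).1 (B y (D y t₂ ω) ω).1) ∂P := h.2
    rw [he]
    exact hs
  refine ⟨hmain, ?_⟩
  exact hasSum_and_tendsto_of_hasSum_exp (fun l => hT2.mul_zonalCoeff_nonneg l)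
    hT2.summable_zonalCoeff (fun l => laplaceExponent_nonneg hb hM (by positivity))
    fun t₂ ht => (hmain t₂ ht).2
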